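/- **Setting.** Let $p$ be an odd prime and let $\mathfrak o$ be a complete discrete valuation ring with finite residue field $\kappa$ of characteristic $p$ (for example the ring of integers of a finite extension of $\mathbb Q_p$), with fraction field $F$, uniformizer $\pi$ and $f=\#\kappa$. Let $n\ge 2$, let $V$ be an $F$-vector space with a quadratic form $q$, and let $L\subset V$ be an $\mathfrak o$-lattice of rank $n$ that spans $V$ and has an $\mathfrak o$-basis in which $q|_L$ is represented by the diagonal matrix $$B=\mathrm{diag}(u_1,\dots,u_{n-2},\pi^{d_1}v_1,\pi^{d_2}v_2),\qquad u_i,v_j\in\mathfrak o^\times,\quad 0\le d_1\le d_2,$$ that is, $q(\sum x_ie_i)=\sum B_{ii}x_i^2$ (so $\mathrm{GK}(L)=(0,\dots,0,d_1,d_2)$). **Notation.** The Gross-Keating invariant $\mathrm{GK}(M)$ of an integral lattice $M\subset V$ represented by a half-integral symmetric matrix $B'$ is the lexicographically greatest sequence of integers $0\le a_1\le\dots\le a_n$ such that for some $U\in\mathrm{GL}_n(\mathfrak o)$ the matrix $(b_{ij})={}^tUB'U$ satisfies $\mathrm{ord}(b_{ii})\ge a_i$ and $\mathrm{ord}(2b_{ij})\ge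 (a_i+a_j)/2$ for all $i\le j$; lattices that are not integral have no invariant. For an integral lattice $M$ write the reduction of $(M,q)$ modulo $\pi$ as $M\otimes\kappa=\overline M_0\perp\mathrm{Rad}$ with $\overline M_0$ nondegenerate. One assigns $a^+$ (respectively $a^-$) to $M$ if $a=\dim_\kappa\overline M_0$ is even and positive and $\overline M_0$ is split, i.e. an orthogonal sum of hyperbolic planes (respectively nonsplit); if $a=\dim_\kappa\overline M_0$ is odd or $0$, both $a^+$ and $a^-$ (which are then identified) are assigned to $M$. For an integer $b\ge0$ let $\mathcal S_{(L,a^{\pm},b)}$ (one set for each sign) be the set of lattices $M\supseteq L$ in $V$ with $\mathrm{GK}(M)\succeq(0,\dots,0)$ (that is, $M$ integral), such that $M/L$ has length $b$ over $\mathfrak o$ and $a^\pm$ is assigned to $M$. If $a$ is odd or $0$, then $\mathcal S_{(L,a^+,b)}=\mathcal S_{(L,a^-,b)}$, $\#\mathcal S_{(L,a^\pm,b)}$ denotes its cardinality, and $\chi(a^\pm)\#\mathcal S_{(L,a^\pm,b)}$ denotes $0$ if $a$ is odd and $\#\mathcal S_{(L,a^\pm,b)}$ if $a=0$. If $a$ is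 even and positive, then $\#\mathcal S_{(L,a^\pm,b)}:=\#\mathcal S_{(L,a^+,b)}+\#\mathcal S_{(L,a^-,b)}$ and $\chi(a^\pm)\#\mathcal S_{(L,a^\pm,b)}:=\#\mathcal S_{(L,a^+,b)}-\#\mathcal S_{(L,a^-,b)}$. Let $\delta(m)=1$ if $m$ is even and $0$ if $m$ is odd. Let $(x,y)$ be the Hilbert symbol of $F$: $1$ if $x\xi^2+y\eta^2=1$ has a solution in $F$, and $-1$ otherwise. Empty sums are $0$. **Proposition.** For every integer $b\ge 0$ all the sets $\mathcal S_{(L,a^+,b)}$ and $\mathcal S_{(L,a^-,b)}$ are finite, and the following hold. (1) We have $$\#\mathcal S_{(L,(n-2)^\pm,b)}=\begin{cases}\sum_{i=0}^b f^i & 0\le b<\frac{d_1}2,\\ \sum_{i=0}^{\lfloor (d_1-1)/2\rfloor}f^i & \frac{d_1}2\le b<\frac{d_2}2,\\ \sum_{i=0}^{\lfloor (d_1-1)/2\rfloor+\lfloor (d_2-1)/2\rfloor-b}f^i & \frac{d_2}2\le b<\frac{d_1+d_2}2,\ \delta(d_1+d_2)\ne(-v_1v_2,\pi),\\ (2b-d_2+1)f^{\frac{d_1+d_2}2-b-1}+\sum_{i=0}^{\frac{d_1+d_2}2-b-1}f^i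 & \frac{d_2}2\le b<\frac{d_1+d_2}2,\ \delta(d_1+d_2)=(-v_1v_2,\pi),\\ 0 & \frac{d_1+d_2}2\le b,\end{cases}$$ $$\#\mathcal S_{(L,(n-1)^\pm,b)}=\begin{cases}0 & 0\le b<\frac{d_1}2\text{ or }\frac{d_1+d_2}2\le b,\\ \delta(d_1)f^{d_1/2} & \frac{d_1}2\le b<\frac{d_2}2,\\ \delta(d_1)f^{\frac{d_1}2+\lfloor\frac{d_2-1}2\rfloor-b}+\delta(d_2)f^{\lfloor\frac{d_1+d_2}2\rfloor-b} & \frac{d_2}2\le b<\frac{d_1+d_2}2,\ \delta(d_1+d_2)\ne(-v_1v_2,\pi),\\ (2b-d_2+1)(f-1)f^{\frac{d_1+d_2}2-b-1} & \frac{d_2}2\le b<\frac{d_1+d_2}2,\ \delta(d_1+d_2)=(-v_1v_2,\pi),\end{cases}$$ $$\#\mathcal S_{(L,n^\pm,b)}=\begin{cases}0 & b\ne\frac{d_1+d_2}2,\\ d_1+1 & b=\frac{d_1+d_2}2,\ \delta(d_1+d_2)=(-v_1v_2,\pi),\\ \delta(d_1)\delta(d_2) & b=\frac{d_1+d_2}2,\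 \delta(d_1+d_2)\ne(-v_1v_2,\pi).\end{cases}$$ Here $\delta(d_1+d_2)=(-v_1v_2,\pi)$ if and only if $d_1+d_2$ is even and $-v_1v_2\in(\mathfrak o^\times)^2$. (2) If $n$ is even, then $$\chi((n-2)^\pm)\#\mathcal S_{(L,(n-2)^\pm,b)}=\begin{cases}((-1)^{\frac{n-2}2}u_1\cdots u_{n-2},\pi)\cdot\#\mathcal S_{(L,(n-2)^\pm,b)} & 0\le b<\frac{d_1+d_2}2,\\ 0 & \frac{d_1+d_2}2\le b.\end{cases}$$ (3) If $n$ is odd, then, with $\epsilon_j=((-1)^{\frac{n-1}2}u_1\cdots u_{n-2}v_j,\pi)$ for $j=1,2$, $$\chi((n-1)^\pm)\#\mathcal S_{(L,(n-1)^\pm,b)}=\begin{cases}0 & 0\le b<\frac{d_1}2\text{ or }\frac{d_1+d_2}2\le b,\\ \epsilon_1\,\delta(d_1)f^{d_1/2} & \frac{d_1}2\le b<\frac{d_2}2,\\ \epsilon_1 f^{\frac{d_1+d_2-1}2-b} & \frac{d_2}2\le b<\frac{d_1+d_2}2,\ \delta(d_1)=1,\ \delta(d_2)=0,\\ \epsilon_2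 f^{\frac{d_1+d_2-1}2-b} & \frac{d_2}2\le b<\frac{d_1+d_2}2,\ \delta(d_1)=0,\ \delta(d_2)=1,\\ 0 & \frac{d_2}2\le b<\frac{d_1+d_2}2,\ \delta(d_1+d_2)=1.\end{cases}$$ -/

import Mathlib

open scoped TensorProduct

namespace QuadLattice

section Basic

/-- `δ(m) = 1` if the integer `m` is even and `δ(m) = 0` otherwise. -/
def delta (m : ℤ) : ℤ := if Even m then 1 else 0

/-- The geometric sum `∑_{i = 0}^m f^i`, which is empty (equal to `0`) for `m < 0`. -/
def geomSum (f : ℕ) (m : ℤ) : ℚ := ∑ i ∈ Finset.range (m + 1).toNat, (f : ℚ) ^ i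

open Classical in
/-- The Hilbert symbol `(x, y)` of nonzero elements of a field: `1` if `x ξ² + y η² = 1` has a
solution in the field, and `-1` otherwise. -/
noncomputable def hilbertSymbol {F : Type*} [Field F] (x y : F) : ℤ :=
  if ∃ ξ η : F, x * ξ ^ 2 + y * η ^ 2 = 1 then 1 else -1

/-- The Hilbert symbol `(w, ϖ)` in the field `F`, for a unit `w` and an element `ϖ` of a subring
`O`. -/
noncomputable def unitSymbol (F : Type*) [Field F] {O : Type*} [CommRing O] [Algebra O F]
    (ϖ : O) (w : Oˣ) : ℤ :=
  hilbertSymbol (algebraMap O F w) (algebraMap O F ϖ)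

end Basic

section QuadraticSpace

variable {κ E : Type*} [Field κ] [AddCommGroup E] [Module κ E]

/-- A quadratic space is split if it is isometric to an orthogonal sum of `k` hyperbolic planes,
that is, to `(κ^k)^* × κ^k` with the form `(φ, x) ↦ φ x`. -/
def IsSplit (q : QuadraticForm κ E) : Prop :=
  ∃ k : ℕ, q.Equivalent (QuadraticForm.dualProd κ (Fin k → κ))

/-- The quadratic space `(E, q)` has type `a^ε` (with the sign `ε = ±1`): the nondegenerate part
`W` in `E = W ⊥ Rad` has dimension `a` and, if `a` is even and positive, it is split for `ε = 1`
and nonsplit for `ε = -1`. (Any complement `W` of the radical is orthogonal to it, and all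
complements are isometric.) -/
def HasType (q : QuadraticForm κ E) (a : ℕ) (ε : ℤˣ) : Prop :=
  ∃ W : Submodule κ E, IsCompl W q.radical ∧ Module.finrank κ W = a ∧
    (Even a → 0 < a → (IsSplit (q.comp W.subtype) ↔ ε = 1))

end QuadraticSpace

section GrossKeating

variable (O : Type*) [CommRing O] [IsLocalRing O] {F : Type*} [Field F] [Algebra O F]

/-- `ord(x) ≥ k`, for `x` in the fraction field of a discrete valuation ring `O` and a natural
number `k` (with `ord(0) = ∞`). -/
def OrdGE (k : ℕ) (x : F) : Prop :=
  ∃ c ∈ IsLocalRing.maximalIdeal O ^ k, algebraMap O F c = x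

/-- The set `S(B)` of non-decreasing sequences `(a_1, …, a_n)` of non-negative integers with
`ord(b_ii) ≥ a_i` and `ord(2 b_ij) ≥ (a_i + a_j) / 2` for `i ≤ j`. The last condition is
written as `ord((2 b_ij)²) ≥ a_i + a_j`. -/
def gkSet {n : ℕ} (B : Matrix (Fin n) (Fin n) F) : Set (Fin n → ℕ) :=
  {a | Monotone a ∧ (∀ i, OrdGE O (a i) (B i i)) ∧
    ∀ i j, i ≤ j → OrdGE O (a i + a j) ((2 * B i j) ^ 2)}

/-- `B[U] = ᵗU B U` for `U ∈ GL_n(O)`. -/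
def act {n : ℕ} (B : Matrix (Fin n) (Fin n) F) (U : GL (Fin n) O) : Matrix (Fin n) (Fin n) F :=
  ((U : Matrix (Fin n) (Fin n) O).map (algebraMap O F)).transpose * B *
    (U : Matrix (Fin n) (Fin n) O).map (algebraMap O F)

/-- `a` is the Gross-Keating invariant of the symmetric matrix `B`: it is the greatest element,
for the lexicographic order, of the union of the sets `S(B[U])`, `U ∈ GL_n(O)`. This union is
empty, and `B` has no invariant, unless `B` is half-integral. -/
def IsGrossKeating {n : ℕ} (B : Matrix (Fin n) (Fin n) F) (a : Fin n → ℕ) : Prop :=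
  IsGreatest {c : Lex (Fin n → ℕ) | ∃ U : GL (Fin n) O, ofLex c ∈ gkSet O (act O B U)} (toLex a)

end GrossKeating

section Lattice

variable {O F V : Type*} [CommRing O] [IsDomain O] [IsDiscreteValuationRing O]
  [Field F] [Algebra O F] [IsFractionRing O F]
  [AddCommGroup V] [Module O V] [Module F V] [IsScalarTower O F V]

/-- The symmetric matrix `B` representing the quadratic form `Q` on the family `x`, so that
`Q(∑ t_i x_i) = ᵗt B t`. Its entries are `(Q(x_i + x_j) - Q(x_i) - Q(x_j)) / 2`; in particular the
diagonal entries are `Q(x_i)`. -/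
def gram {ι : Type*} (Q : QuadraticForm F V) (x : ι → V) : Matrix ι ι F :=
  Matrix.of fun i j => QuadraticMap.polar Q (x i) (x j) / 2

/-- `a` is the Gross-Keating invariant of the quadratic lattice `(M, Q|_M)`. -/
def LatticeGK (Q : QuadraticForm F V) (M : Submodule O V) {n : ℕ} (a : Fin n → ℕ) : Prop :=
  ∃ e : Module.Basis (Fin n) O M, IsGrossKeating O (gram Q fun i => (e i : V)) a

/-- `q` is the quadratic form on the reduction `κ ⊗ M` of the quadratic lattice `(M, Q|_M)`, that
is, `Q` modulo the maximal ideal. In particular `Q` takes values in `O` on `M`. -/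
def IsReduction (Q : QuadraticForm F V) (M : Submodule O V)
    (q : QuadraticForm (IsLocalRing.ResidueField O) (IsLocalRing.ResidueField O ⊗[O] M)) : Prop :=
  ∀ x : M, ∃ c : O, algebraMap O F c = Q (x : V) ∧ q (1 ⊗ₜ[O] x) = IsLocalRing.residue O c

/-- `a^ε` (with the sign `ε = ±1`) is assigned to the quadratic lattice `M`, through its
reduction. -/
def Assigned (Q : QuadraticForm F V) (M : Submodule O V) (a : ℕ) (ε : ℤˣ) : Prop :=
  ∃ q : QuadraticForm (IsLocalRing.ResidueField O) (IsLocalRing.ResidueField O ⊗[O] M),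
    IsReduction Q M q ∧ HasType q a ε

/-- The set `S_(L, a^ε, b)` of the lattices `M ⊇ L` in `V` with `GK(M) ⪰ (0, …, 0)`, such that
`M / L` is an `O`-module of length `b`, and such that `a^ε` is assigned to `M`. -/
def overlattices (Q : QuadraticForm F V) (L : Submodule O V) (a : ℕ) (ε : ℤˣ) (b : ℕ) :
    Set (Submodule O V) :=
  {M | L ≤ M ∧ M.IsLattice F ∧
    (∃ (n : ℕ) (g : Fin n → ℕ), LatticeGK Q M g ∧ toLex (0 : Fin n → ℕ) ≤ toLex g) ∧
    Module.length O (M ⧸ L.submoduleOf M) = b ∧ Assigned Q M a ε}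

/-- `χ(a^ε)`: `0` for odd `a`, `1` for `a = 0`, and the sign `ε` for even positive `a`. -/
def chi (a : ℕ) (ε : ℤˣ) : ℤ := if Odd a then 0 else if a = 0 then 1 else ε

/-- The number `#S_(L, a^±, b)`. For `a` odd or zero, `S_(L, a^+, b) = S_(L, a^-, b)` is counted
once; for `a` even and positive, both sets are counted. -/
noncomputable def numS (Q : QuadraticForm F V) (L : Submodule O V) (a b : ℕ) : ℚ :=
  if Odd a ∨ a = 0 then ((overlattices Q L a 1 b).ncard : ℚ)
  else (overlattices Q L a 1 b).ncard + (overlattices Q L a (-1) b).ncard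

/-- The signed number `χ(a^±) #S_(L, a^±, b)`, with the same convention: it is
`#S_(L, a^+, b) - #S_(L, a^-, b)` for `a` even and positive. -/
noncomputable def signedNumS (Q : QuadraticForm F V) (L : Submodule O V) (a b : ℕ) : ℚ :=
  if Odd a ∨ a = 0 then (chi a 1 : ℚ) * (overlattices Q L a 1 b).ncard
  else (chi a 1 : ℚ) * (overlattices Q L a 1 b).ncard +
    (chi a (-1) : ℚ) * (overlattices Q L a (-1) b).ncard

end Lattice

end QuadLattice

open QuadLattice

/-!
An overlattice `M` of `L` on which `Q` is integral contains the unimodular part of `L`, so it is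
determined by a binary lattice. Such a lattice is spanned by `ϖ^(-i) x₀` and
`ϖ^(-j) (x₁ + s ϖ^(-i) x₀)` for unique `i`, `j` and a unique class `s` modulo `ϖ^j`
(`exists_eq_overLattice`, `overLattice_injective`), and `M / L` has length `i + j`
(`length_overLattice`). Integrality becomes a condition on the Gram matrix of this basis
(`IntegralParam`), whose determinant has order `d₁ + d₂ - 2(i + j)`. As `L` is nondegenerate, every
such lattice has a Gross-Keating invariant (`exists_latticeGK`).

The residue characteristic is odd, so the reduction of `M` can be diagonalized, and its type is read
off from the diagonal entries: over a finite field a nondegenerate form of even dimension `2 k` is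
split if and only if `(-1)^k` times its discriminant is a square (`hasType_iff_of_equivalent`). Hence
the rank modulo `ϖ` is `n` if `2(i + j) = d₁ + d₂`, is `n - 2` if the binary Gram matrix vanishes
modulo `ϖ`, and is `n - 1` otherwise. In the last case the sign is governed by the quadratic
character of the nonvanishing diagonal entry (`paramSign`), and the symbol `(w, ϖ)` of a unit `w` is
the quadratic character of its residue (`unitSymbol_eq_quadraticChar`).

It remains to count. For `2 j ≤ d₂` the integrality condition is a divisibility condition on `s`, and
these parameters contribute a geometric sum. For `d₂ < 2 j` there are parameters only if the binary
form is hyperbolic; they are the `s` close to one of two square roots (`numIntegral_eq`). The binary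
Gram matrix vanishes modulo `ϖ` if and only if it is integral for `ϖ⁻¹ Q`, so the lattices of rank
`n - 2` modulo `ϖ` are counted by the same formula with `d₁ - 1` and `d₂ - 1`. The signed count for
rank `n - 1` is a sum of quadratic characters of the values of quadratic polynomials over the residue
field (`signedIntegral_of_odd`, `signedIntegral_of_even`).
-/

namespace QuadLattice

set_option linter.unusedSectionVars false

/-! ### Quadratic forms over finite fields of odd characteristic -/

section FiniteFieldForms

open QuadraticMap Finset

variable {κ : Type*} [Field κ] {ι : Type*} [Fintype ι]

lemma weightedSumSquares_equivalent_reindex {ι' : Type*} [Fintype ι'] (σ : ι' ≃ ι) (w : ι → κ) :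
    (weightedSumSquares κ w).Equivalent (weightedSumSquares κ (w ∘ σ)) := by
  refine ⟨⟨LinearEquiv.funCongrLeft κ κ σ, fun x => ?_⟩⟩
  simp only [weightedSumSquares_apply, AddHom.toFun_eq_coe, LinearMap.coe_toAddHom,
    LinearEquiv.coe_coe, LinearEquiv.funCongrLeft_apply, LinearMap.funLeft_apply,
    Function.comp_apply]
  exact Equiv.sum_comp σ (fun i => w i • (x i * x i))

lemma weightedSumSquares_equivalent_scale {w w' : ι → κ} (c : ι → κˣ)
    (h : ∀ i, w' i * (c i : κ) ^ 2 = w i) :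
    (weightedSumSquares κ w).Equivalent (weightedSumSquares κ w') := by
  refine ⟨⟨⟨⟨⟨fun x i => c i * x i, fun x y => ?_⟩, fun r x => ?_⟩,
    fun x i => (c i)⁻¹ * x i, fun x => ?_, fun x => ?_⟩, fun x => ?_⟩⟩
  · ext i; simp [mul_add]
  · ext i; simp; ring
  · ext i; simp
  · ext i; simp
  · simp only [weightedSumSquares_apply, ← h]
    exact Finset.sum_congr rfl fun i _ => by simp only [smul_eq_mul]; ring

lemma toMatrix'_weightedSumSquares [DecidableEq ι] [Invertible (2 : κ)] (w : ι → κ) :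
    QuadraticForm.toMatrix' (weightedSumSquares κ w) = Matrix.diagonal w := by
  have hsq : ∀ x : ι → κ, weightedSumSquares κ w x = ∑ k, w k * (x k * x k) := fun x => by
    simp [weightedSumSquares_apply]
  have hpol : ∀ i j, polar (weightedSumSquares κ w) (Pi.single i 1) (Pi.single j 1)
      = if i = j then 2 * w i else 0 := by
    intro i j
    simp only [polar, hsq]
    have : ∀ k, w k * ((Pi.single i (1:κ) + Pi.single j (1:κ) : ι → κ) k *
        (Pi.single i (1:κ) + Pi.single j (1:κ) : ι → κ) k) -
        w k * ((Pi.single i 1 : ι → κ) k * (Pi.single i 1 : ι → κ) k) -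
        w k * ((Pi.single j 1 : ι → κ) k * (Pi.single j 1 : ι → κ) k)
        = if k = i then (if i = j then 2 * w i else 0) else 0 := by
      intro k
      by_cases hki : k = i
      · subst hki
        by_cases hkj : k = j
        · subst hkj; simp; ring
        · simp [hkj]
      · by_cases hkj : k = j
        · subst hkj; simp [hki]
        · simp [hki, hkj]
    rw [← Finset.sum_sub_distrib, ← Finset.sum_sub_distrib, Finset.sum_congr rfl fun k _ => this k]
    simp
  ext i j
  rw [QuadraticForm.toMatrix', LinearMap.toMatrix₂'_apply, associated_apply,
    Matrix.diagonal_apply]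
  have h := hpol i j
  simp only [polar] at h
  rw [h]
  split_ifs
  · simp [← mul_assoc]
  · simp

/-- The discriminant of a diagonal form is an invariant up to squares. -/
lemma exists_sq_mul_prod_of_equivalent (h2 : (2 : κ) ≠ 0) {w w' : ι → κ}
    (h : (weightedSumSquares κ w).Equivalent (weightedSumSquares κ w')) :
    ∃ c : κ, ∏ i, w i = c ^ 2 * ∏ i, w' i := by
  classical
  let _ := invertibleOfNonzero h2
  obtain ⟨g⟩ := h
  have h1 : (weightedSumSquares κ w').comp
      (g.toLinearEquiv : (ι → κ) →ₗ[κ] (ι → κ)) = weightedSumSquares κ w := by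
    ext x; simp
  refine ⟨(g.toLinearEquiv : (ι → κ) →ₗ[κ] (ι → κ)).toMatrix'.det, ?_⟩
  have h2 := QuadraticForm.discr'_comp (Q := weightedSumSquares κ w')
    (g.toLinearEquiv : (ι → κ) →ₗ[κ] (ι → κ))
  rw [h1, QuadraticForm.discr', QuadraticForm.discr', toMatrix'_weightedSumSquares,
    toMatrix'_weightedSumSquares, Matrix.det_diagonal, Matrix.det_diagonal] at h2
  rw [h2, pow_two]

lemma dualProd_equivalent_weightedSumSquares (h2 : (2 : κ) ≠ 0) (k : ℕ) :
    (QuadraticForm.dualProd κ (Fin k → κ)).Equivalent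
      (weightedSumSquares κ (Sum.elim (fun _ => 1) (fun _ => -1) : Fin k ⊕ Fin k → κ)) := by
  refine QuadraticMap.Equivalent.symm ?_
  let e₁ : (Fin k ⊕ Fin k → κ) ≃ₗ[κ] (Fin k → κ) × (Fin k → κ) :=
    { toFun := fun z => (fun i => z (.inl i) + z (.inr i), fun i => z (.inl i) - z (.inr i))
      map_add' := fun x y => by ext i <;> simp <;> ring
      map_smul' := fun r x => by ext i <;> simp <;> ring
      invFun := fun z => Sum.elim (fun i => (z.1 i + z.2 i) / 2) (fun i => (z.1 i - z.2 i) / 2)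
      left_inv := fun z => by
        ext (i | i) <;> simp <;> field_simp <;> ring
      right_inv := fun z => by
        ext i <;> simp <;> field_simp <;> ring }
  refine ⟨⟨e₁.trans ((dotProductEquiv κ (Fin k)).prodCongr (LinearEquiv.refl κ _)), fun z => ?_⟩⟩
  simp only [AddHom.toFun_eq_coe, LinearMap.coe_toAddHom, LinearEquiv.coe_coe,
    LinearEquiv.trans_apply, LinearEquiv.prodCongr_apply, QuadraticForm.dualProd_apply,
    weightedSumSquares_apply, Fintype.sum_sum_type]
  simp only [e₁, LinearEquiv.coe_mk, LinearMap.coe_mk, AddHom.coe_mk, LinearEquiv.refl_apply,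
    dotProductEquiv_apply_apply, dotProduct, Sum.elim_inl, Sum.elim_inr, ← Finset.sum_add_distrib]
  exact Finset.sum_congr rfl fun i _ => by simp only [smul_eq_mul]; ring

variable [Finite κ]

lemma exists_sq_add_sq_eq_one (h2 : (2 : κ) ≠ 0) {a b : κ} (ha : a ≠ 0) (hb : b ≠ 0) :
    ∃ x y : κ, a * x ^ 2 + b * y ^ 2 = 1 := by
  classical
  have := Fintype.ofFinite κ
  have hch : ringChar κ ≠ 2 := fun h => h2 (by
    have := ringChar.Nat.cast_ringChar (R := κ); rw [h] at this; exact_mod_cast this)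
  obtain ⟨x, y, h⟩ := FiniteField.exists_root_sum_quadratic (R := κ)
    (f := Polynomial.C a * Polynomial.X ^ 2 + Polynomial.C 0 * Polynomial.X + Polynomial.C (-1))
    (g := Polynomial.C b * Polynomial.X ^ 2 + Polynomial.C 0 * Polynomial.X + Polynomial.C 0)
    (Polynomial.degree_quadratic ha) (Polynomial.degree_quadratic hb)
    (FiniteField.odd_card_of_char_ne_two hch)
  refine ⟨x, y, ?_⟩
  simp at h
  linear_combination h

/-- `⟨a, b⟩ ≅ ⟨a b, 1⟩` over a finite field, since `⟨a, b⟩` represents `1`. -/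
lemma weightedSumSquares_equivalent_update (h2 : (2 : κ) ≠ 0) [DecidableEq ι] (w : ι → κ)
    {i j : ι} (hij : i ≠ j) (hi : w i ≠ 0) (hj : w j ≠ 0) :
    (weightedSumSquares κ w).Equivalent (weightedSumSquares κ
      (Function.update (Function.update w i (w i * w j)) j 1)) := by
  obtain ⟨α, β, h⟩ := exists_sq_add_sq_eq_one h2 hi hj
  have split : ∀ F : ι → κ, ∑ k, F k = F i + (F j + ∑ k ∈ (univ.erase i).erase j, F k) := by
    intro F
    rw [Finset.add_sum_erase _ _ (by simp [hij.symm]), Finset.add_sum_erase _ _ (by simp)]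
  refine ⟨⟨⟨⟨⟨fun x => Function.update (Function.update x i (-β * x i + α * x j)) j
      (w i * α * x i + w j * β * x j), fun x y => ?_⟩, fun r x => ?_⟩,
    fun y => Function.update (Function.update y i (-(w j * β) * y i + α * y j)) j
      (w i * α * y i + β * y j), fun x => ?_, fun x => ?_⟩, fun x => ?_⟩⟩
  · ext k
    by_cases hkj : k = j
    · subst hkj; simp; ring
    · by_cases hki : k = i
      · subst hki; simp [hkj]; ring
      · simp [hki, hkj]
  · ext k
    by_cases hkj : k = j
    · subst hkj; simp; ring
    · by_cases hki : k = i
      · subst hki; simp [hkj]; ring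
      · simp [hki, hkj]
  · ext k
    by_cases hkj : k = j
    · subst hkj; simp [hij]; linear_combination x k * h
    · by_cases hki : k = i
      · subst hki; simp [hkj]; linear_combination x k * h
      · simp [hki, hkj]
  · ext k
    by_cases hkj : k = j
    · subst hkj; simp [hij]; linear_combination x k * h
    · by_cases hki : k = i
      · subst hki; simp [hkj]; linear_combination x k * h
      · simp [hki, hkj]
  · simp only [weightedSumSquares_apply, smul_eq_mul]
    rw [split, split (fun k => w k * (x k * x k))]
    have : ∑ k ∈ (univ.erase i).erase j, w k * (x k * x k) = ∑ k ∈ (univ.erase i).erase j,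
        (Function.update (Function.update w i (w i * w j)) j 1) k *
        ((Function.update (Function.update x i (-β * x i + α * x j)) j
          (w i * α * x i + w j * β * x j)) k * (Function.update (Function.update x i
          (-β * x i + α * x j)) j (w i * α * x i + w j * β * x j)) k) := by
      refine Finset.sum_congr rfl fun k hk => ?_
      have hkj : k ≠ j := by simp at hk; exact hk.1
      have hki : k ≠ i := by simp at hk; exact hk.2
      simp [hkj, hki]
    rw [this]
    simp [hij]
    linear_combination (w i * x i ^ 2 + w j * x j ^ 2) * h

lemma weightedSumSquares_equivalent_of_finset (h2 : (2 : κ) ≠ 0) [DecidableEq ι] {w : ι → κ}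
    (hw : ∀ i, w i ≠ 0) (i₀ : ι) (s : Finset ι) (hs : i₀ ∉ s) :
    (weightedSumSquares κ w).Equivalent (weightedSumSquares κ
      (fun k => if k ∈ s then 1 else if k = i₀ then w i₀ * ∏ i ∈ s, w i else w k)) := by
  induction s using Finset.induction_on with
  | empty =>
    have : (fun k => if k ∈ (∅ : Finset ι) then (1 : κ) else
        if k = i₀ then w i₀ * ∏ i ∈ (∅ : Finset ι), w i else w k) = w := by
      ext k; by_cases h : k = i₀ <;> simp [h]
    rw [this]
  | insert j s hj ih =>
    have hi₀ : i₀ ∉ s := fun h => hs (Finset.mem_insert_of_mem h)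
    have hij : i₀ ≠ j := fun h => hs (h ▸ Finset.mem_insert_self _ _)
    refine (ih hi₀).trans ?_
    have key := weightedSumSquares_equivalent_update h2
      (fun k => if k ∈ s then 1 else if k = i₀ then w i₀ * ∏ i ∈ s, w i else w k) hij
      (by simp only [hi₀, if_false, if_true]
          exact mul_ne_zero (hw _) (Finset.prod_ne_zero_iff.2 fun i _ => hw i))
      (by simp [hj, hij.symm, hw])
    convert key using 2
    ext k
    by_cases hkj : k = j
    · subst hkj; simp
    · by_cases hki : k = i₀
      · subst hki
        simp [hkj, hj, hi₀, Finset.prod_insert, hij.symm]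
        ring
      · simp [hki, hkj]

/-- Diagonal forms of the same discriminant and dimension over a finite field are equivalent. -/
lemma weightedSumSquares_equivalent_of_prod (h2 : (2 : κ) ≠ 0) {w w' : ι → κ}
    (hw : ∀ i, w i ≠ 0) (hw' : ∀ i, w' i ≠ 0) {c : κ} (h : ∏ i, w i = c ^ 2 * ∏ i, w' i) :
    (weightedSumSquares κ w).Equivalent (weightedSumSquares κ w') := by
  classical
  rcases isEmpty_or_nonempty ι with hι | ⟨⟨i₀⟩⟩
  · rw [Subsingleton.elim w w']
  have hc : c ≠ 0 := by
    rintro rfl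
    exact Finset.prod_ne_zero_iff.2 (fun i _ => hw i) (by rw [h]; ring)
  have h₁ := weightedSumSquares_equivalent_of_finset h2 hw i₀ (univ.erase i₀) (by simp)
  have h₂ := weightedSumSquares_equivalent_of_finset h2 hw' i₀ (univ.erase i₀) (by simp)
  refine h₁.trans (Equivalent.trans ?_ h₂.symm)
  refine weightedSumSquares_equivalent_scale (fun k => if k = i₀ then Units.mk0 c hc else 1) ?_
  intro k
  by_cases hk : k = i₀
  · subst hk
    simp only [Finset.mem_erase, ne_eq, not_true_eq_false, false_and, if_false, if_true,
      Units.val_mk0]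
    rw [Finset.mul_prod_erase _ _ (by simp), Finset.mul_prod_erase _ _ (by simp), h]; ring
  · simp [hk]

/-- A nondegenerate diagonal form of dimension `2 k` over a finite field of odd characteristic is
split if and only if `(-1) ^ k` times its discriminant is a square. -/
lemma isSplit_weightedSumSquares_iff (h2 : (2 : κ) ≠ 0) {w : ι → κ} (hw : ∀ i, w i ≠ 0) {k : ℕ}
    (hk : Fintype.card ι = 2 * k) :
    IsSplit (weightedSumSquares κ w) ↔ IsSquare ((-1) ^ k * ∏ i, w i) := by
  have hcard : Fintype.card (Fin k ⊕ Fin k) = Fintype.card ι := by simp [hk]; ring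
  let σ : Fin k ⊕ Fin k ≃ ι := Fintype.equivOfCardEq hcard
  have hprod : ∏ i, (w ∘ σ) i = ∏ i, w i := Equiv.prod_comp σ w
  have hone : ((-1 : κ) ^ k) * (-1) ^ k = 1 := by rw [← mul_pow]; simp
  have hH : ∏ i, (Sum.elim (fun _ => 1) (fun _ => -1) : Fin k ⊕ Fin k → κ) i = (-1) ^ k := by
    simp [Fintype.prod_sum_type]
  constructor
  · rintro ⟨k', hk'⟩
    obtain ⟨g⟩ := hk'
    have hdim := g.toLinearEquiv.finrank_eq
    simp only [Module.finrank_fintype_fun_eq_card, Module.finrank_prod, Subspace.dual_finrank_eq,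
      Fintype.card_fin, hk] at hdim
    obtain rfl : k = k' := by omega
    have h := ((weightedSumSquares_equivalent_reindex σ w).symm.trans ⟨g⟩).trans
      (dualProd_equivalent_weightedSumSquares h2 k)
    obtain ⟨c, hc⟩ := exists_sq_mul_prod_of_equivalent h2 h
    rw [hprod, hH] at hc
    exact ⟨c, by rw [hc]; linear_combination c ^ 2 * hone⟩
  · rintro ⟨c, hc⟩
    refine ⟨k, (weightedSumSquares_equivalent_reindex σ w).trans (Equivalent.trans ?_
      (dualProd_equivalent_weightedSumSquares h2 k).symm)⟩
    refine weightedSumSquares_equivalent_of_prod h2 (fun i => hw _) ?_ (c := c) ?_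
    · rintro (i | i) <;> simp
    · rw [hprod, hH]
      linear_combination (-1) ^ k * hc - (∏ i, w i) * hone

/-- The type of a quadratic space in terms of a diagonalization: the rank is the number of nonzero
coefficients, the sign is determined by their product. -/
lemma hasType_iff_of_equivalent (h2 : (2 : κ) ≠ 0) {E : Type*} [AddCommGroup E] [Module κ E]
    {q : QuadraticForm κ E} {w : ι → κ} (h : q.Equivalent (weightedSumSquares κ w))
    {ι' : Type*} [Fintype ι'] (emb : ι' → ι) (hemb : Function.Injective emb)
    (hrange : ∀ i, w i ≠ 0 ↔ i ∈ Set.range emb) (a : ℕ) (ε : ℤˣ) :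
    HasType q a ε ↔ a = Fintype.card ι' ∧
      (Even a → 0 < a → (IsSquare ((-1) ^ (a / 2) * ∏ i, w (emb i)) ↔ ε = 1)) := by
  classical
  obtain ⟨g⟩ := h
  have : NeZero (2 : κ) := ⟨h2⟩
  have hne : ∀ i, w (emb i) ≠ 0 := fun i => (hrange _).2 ⟨i, rfl⟩
  let ρ : E →ₗ[κ] (ι' → κ) := (LinearMap.funLeft κ κ emb).comp (g.toLinearEquiv : E →ₗ[κ] (ι → κ))
  have hρ : ∀ x i, ρ x i = g x (emb i) := fun x i => rfl
  have hsurj : Function.Surjective ρ :=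
    (LinearMap.funLeft_surjective_of_injective κ κ emb hemb).comp g.toLinearEquiv.surjective
  have hrad : q.radical = LinearMap.ker ρ := by
    ext x
    have h1 : x ∈ q.radical ↔ g x ∈ (weightedSumSquares κ w).radical := by
      rw [← g.map_radical]
      exact ⟨fun hx => ⟨x, hx, rfl⟩, fun ⟨y, hy, hxy⟩ => g.toLinearEquiv.injective hxy ▸ hy⟩
    rw [h1, QuadraticForm.radical_weightedSumSquares, LinearMap.mem_ker, Pi.mem_spanSubset_iff]
    constructor
    · intro hx
      ext i
      exact hx (emb i) (by simpa using hne i)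
    · intro hx i hi
      obtain ⟨k, rfl⟩ := (hrange i).1 (by simpa using hi)
      exact congrFun hx k
  have hq : ∀ x, weightedSumSquares κ (w ∘ emb) (ρ x) = q x := by
    intro x
    rw [← g.map_app x, weightedSumSquares_apply, weightedSumSquares_apply]
    simp only [hρ, Function.comp_apply]
    rw [← Finset.sum_subset (Finset.subset_univ (univ.image emb)), Finset.sum_image
      (fun _ _ _ _ h => hemb h)]
    intro i _ hi
    have : w i = 0 := by
      by_contra hwi
      obtain ⟨k, rfl⟩ := (hrange i).1 hwi
      exact hi (by simp)
    simp [this]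
  have hW : ∀ W : Submodule κ E, IsCompl W q.radical →
      ∃ e : W ≃ₗ[κ] (ι' → κ), ∀ x : W, weightedSumSquares κ (w ∘ emb) (e x) = q x := by
    intro W hW
    refine ⟨LinearEquiv.ofBijective (ρ.comp W.subtype) ⟨?_, ?_⟩, fun x => hq x⟩
    · rw [← LinearMap.ker_eq_bot, LinearMap.ker_comp, ← hrad]
      rw [← Submodule.disjoint_iff_comap_eq_bot]
      exact hW.disjoint
    · intro y
      obtain ⟨x, rfl⟩ := hsurj y
      obtain ⟨u, hu, r, hr, rfl⟩ := Submodule.mem_sup.1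
        (hW.sup_eq_top ▸ Submodule.mem_top : x ∈ W ⊔ q.radical)
      rw [hrad, LinearMap.mem_ker] at hr
      exact ⟨⟨u, hu⟩, by simp [hr]⟩
  have hsplit : ∀ W : Submodule κ E, IsCompl W q.radical → Module.finrank κ W = a →
      Even a → (IsSplit (q.comp W.subtype) ↔ IsSquare ((-1) ^ (a / 2) * ∏ i, w (emb i))) := by
    intro W hc ha hev
    obtain ⟨e, he⟩ := hW W hc
    have hcard : a = Fintype.card ι' := by rw [← ha, e.finrank_eq]; simp
    have hk : Fintype.card ι' = 2 * (a / 2) := by rw [← hcard]; obtain ⟨m, hm⟩ := hev; omega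
    have h0 : (q.comp W.subtype).Equivalent (weightedSumSquares κ (w ∘ emb)) :=
      ⟨⟨e, fun x => he x⟩⟩
    rw [← Function.comp_def w emb] at *
    rw [← isSplit_weightedSumSquares_iff h2 (w := w ∘ emb) hne hk]
    exact ⟨fun ⟨k, hk⟩ => ⟨k, h0.symm.trans hk⟩, fun ⟨k, hk⟩ => ⟨k, h0.trans hk⟩⟩
  constructor
  · rintro ⟨W, hc, ha, hs⟩
    obtain ⟨e, he⟩ := hW W hc
    exact ⟨by rw [← ha, e.finrank_eq]; simp, fun hev hpos =>
      (hsplit W hc ha hev).symm.trans (hs hev hpos)⟩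
  · rintro ⟨ha, hs⟩
    obtain ⟨W, hc⟩ := Submodule.exists_isCompl q.radical
    obtain ⟨e, he⟩ := hW W hc.symm
    have hfr : Module.finrank κ W = a := by rw [e.finrank_eq, ha]; simp
    exact ⟨W, hc.symm, hfr, fun hev hpos => (hsplit W hc.symm hfr hev).trans (hs hev hpos)⟩

end FiniteFieldForms

/-! ### Arithmetic in the discrete valuation ring -/

section Valuation

open IsLocalRing

variable {O : Type*} [CommRing O] [IsDomain O] [IsDiscreteValuationRing O] {ϖ : O}

lemma residue_eq_zero_iff_dvd (hϖ : Irreducible ϖ) (x : O) : residue O x = 0 ↔ ϖ ∣ x := by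
  rw [residue_eq_zero_iff, hϖ.maximalIdeal_eq, Ideal.mem_span_singleton]

lemma pow_dvd_unit_mul_pow_iff (hϖ : Irreducible ϖ) (u : Oˣ) (a n : ℕ) :
    ϖ ^ a ∣ u * ϖ ^ n ↔ a ≤ n := by
  rw [Units.dvd_mul_left, pow_dvd_pow_iff hϖ.ne_zero hϖ.not_isUnit]

lemma pow_dvd_of_pow_dvd_sq (hϖ : Irreducible ϖ) {a b : ℕ} (hab : 2 * b ≤ a + 1) {x : O}
    (h : ϖ ^ a ∣ x ^ 2) : ϖ ^ b ∣ x := by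
  by_cases hx : x = 0
  · simp [hx]
  obtain ⟨n, u, rfl⟩ := IsDiscreteValuationRing.eq_unit_mul_pow_irreducible hx hϖ
  rw [mul_pow, ← pow_mul, ← Units.val_pow_eq_pow_val, pow_dvd_unit_mul_pow_iff hϖ] at h
  rw [pow_dvd_unit_mul_pow_iff hϖ]
  omega

lemma eq_zero_of_forall_pow_dvd (hϖ : Irreducible ϖ) {x : O} (h : ∀ k, ϖ ^ k ∣ x) : x = 0 := by
  by_contra hx
  obtain ⟨n, u, rfl⟩ := IsDiscreteValuationRing.eq_unit_mul_pow_irreducible hx hϖ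
  have := (pow_dvd_unit_mul_pow_iff hϖ u (n + 1) n).1 (h _)
  omega

lemma isUnit_two (h2 : (2 : ResidueField O) ≠ 0) : IsUnit (2 : O) := by
  rw [← residue_ne_zero_iff_isUnit, map_ofNat]
  exact h2

lemma two_ne_zero_of_residue (h2 : (2 : ResidueField O) ≠ 0) (F : Type*) [Field F] [Algebra O F]
    [IsFractionRing O F] : (2 : F) ≠ 0 := by
  have := ((isUnit_two h2).map (algebraMap O F)).ne_zero
  rwa [map_ofNat] at this

/-- Hensel's lemma for square roots of units. -/
lemma isSquare_unit_iff [IsAdicComplete (maximalIdeal O) O] (h2 : (2 : ResidueField O) ≠ 0)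
    (w : Oˣ) : IsSquare w ↔ IsSquare (residue O w) := by
  constructor
  · rintro ⟨c, rfl⟩
    exact ⟨residue O c, by simp⟩
  · rintro ⟨c, hc⟩
    obtain ⟨c, rfl⟩ := residue_surjective c
    have hcu : IsUnit c := by
      rw [← residue_ne_zero_iff_isUnit]
      intro h0
      rw [h0, mul_zero] at hc
      exact (residue_ne_zero_iff_isUnit (w : O)).2 w.isUnit hc
    obtain ⟨x, hx, -⟩ := HenselianRing.is_henselian (I := maximalIdeal O)
      (Polynomial.X ^ 2 - Polynomial.C (w : O)) (Polynomial.monic_X_pow_sub_C _ two_ne_zero) c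
      (by rw [← residue_eq_zero_iff]; simp [hc]; ring)
      (by
        refine IsUnit.map _ ?_
        have := (isUnit_two h2).mul hcu
        simpa [one_add_one_eq_two] using this)
    have hx' : x ^ 2 = w := by
      simpa [Polynomial.IsRoot, sub_eq_zero] using hx
    have hxu : IsUnit x := by
      rw [← isUnit_pow_iff two_ne_zero, hx']; exact w.isUnit
    exact ⟨hxu.unit, by ext; simp [← hx', pow_two]⟩

/-- If `w x² + ϖ y² = z²` has a solution with `z ≠ 0`, then `w` is a square modulo `ϖ`. -/
lemma isSquare_residue_of_eq (hϖ : Irreducible ϖ) (w : O) {x y z : O}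
    (hz : z ≠ 0) (h : w * x ^ 2 + ϖ * y ^ 2 = z ^ 2) : IsSquare (residue O w) := by
  by_contra hw
  -- infinite descent: `ϖ` divides `x`, `z`, and hence `y`
  have key : ∀ k, ∃ x' y' z' : O, z = ϖ ^ k * z' ∧ w * x' ^ 2 + ϖ * y' ^ 2 = z' ^ 2 := by
    intro k
    induction k with
    | zero => exact ⟨x, y, z, by simp, h⟩
    | succ k ih =>
      obtain ⟨x, y, z', rfl, hk⟩ := ih
      have hr : residue O w * residue O x ^ 2 = residue O z' ^ 2 := by
        have h' := congrArg (residue O) hk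
        rwa [map_add, map_mul, map_mul, map_pow, map_pow, map_pow,
          (residue_eq_zero_iff_dvd hϖ ϖ).2 dvd_rfl, zero_mul, add_zero] at h'
      have hx : residue O x = 0 := by
        by_contra hx
        exact hw ⟨residue O z' / residue O x, by field_simp; linear_combination hr⟩
      have hz' : residue O z' = 0 := by simpa [hx] using hr.symm
      obtain ⟨x, rfl⟩ := (residue_eq_zero_iff_dvd hϖ x).1 hx
      obtain ⟨z', rfl⟩ := (residue_eq_zero_iff_dvd hϖ z').1 hz'
      have h1 : y ^ 2 = ϖ * (z' ^ 2 - w * x ^ 2) := by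
        apply mul_left_cancel₀ hϖ.ne_zero; linear_combination hk
      obtain ⟨y, rfl⟩ := hϖ.prime.dvd_of_dvd_pow (Dvd.intro _ h1.symm)
      refine ⟨x, y, z', by ring, ?_⟩
      apply mul_left_cancel₀ hϖ.ne_zero; linear_combination h1
  exact hz (eq_zero_of_forall_pow_dvd hϖ fun k => by
    obtain ⟨_, _, z', hz', _⟩ := key k; exact ⟨z', hz'⟩)

lemma exists_hilbert_iff [IsAdicComplete (maximalIdeal O) O] (h2 : (2 : ResidueField O) ≠ 0)
    (hϖ : Irreducible ϖ) (F : Type*) [Field F] [Algebra O F] [IsFractionRing O F] (w : Oˣ) :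
    (∃ ξ η : F, algebraMap O F w * ξ ^ 2 + algebraMap O F ϖ * η ^ 2 = 1) ↔
      IsSquare (residue O w) := by
  constructor
  · rintro ⟨ξ, η, h⟩
    obtain ⟨x, z₁, hz₁, rfl⟩ := IsFractionRing.div_surjective (A := O) ξ
    obtain ⟨y, z₂, hz₂, rfl⟩ := IsFractionRing.div_surjective (A := O) η
    have h₁ : algebraMap O F z₁ ≠ 0 := by simpa using nonZeroDivisors.ne_zero hz₁
    have h₂ : algebraMap O F z₂ ≠ 0 := by simpa using nonZeroDivisors.ne_zero hz₂
    refine isSquare_residue_of_eq hϖ (w : O) (x := x * z₂) (y := y * z₁) (z := z₁ * z₂)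
      (mul_ne_zero (nonZeroDivisors.ne_zero hz₁) (nonZeroDivisors.ne_zero hz₂)) ?_
    apply IsFractionRing.injective O F
    field_simp at h
    simp only [map_add, map_mul, map_pow]
    linear_combination h
  · intro h
    obtain ⟨c, rfl⟩ := (isSquare_unit_iff h2 w).2 h
    refine ⟨(algebraMap O F c)⁻¹, 0, ?_⟩
    have : algebraMap O F c ≠ 0 := by simp
    simp; field_simp

variable [Fintype (ResidueField O)] [DecidableEq (ResidueField O)]

/-- The tame Hilbert symbol of a unit and a uniformizer is the quadratic character of the residue
class. -/
lemma unitSymbol_eq_quadraticChar [IsAdicComplete (maximalIdeal O) O]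
    (h2 : (2 : ResidueField O) ≠ 0) (hϖ : Irreducible ϖ) (F : Type*) [Field F] [Algebra O F]
    [IsFractionRing O F] (w : Oˣ) :
    unitSymbol F ϖ w = quadraticChar (ResidueField O) (residue O w) := by
  have hw : residue O (w : O) ≠ 0 := (residue_ne_zero_iff_isUnit _).2 w.isUnit
  rw [unitSymbol, hilbertSymbol]
  split_ifs with h
  · exact ((quadraticChar_one_iff_isSquare hw).2 ((exists_hilbert_iff h2 hϖ F w).1 h)).symm
  · refine (quadraticChar_neg_one_iff_not_isSquare.2 fun hs => h ?_).symm
    exact (exists_hilbert_iff h2 hϖ F w).2 hs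

end Valuation

/-! ### Sums of quadratic characters -/

section QuadraticCharSum

variable {κ : Type*} [Field κ] [Fintype κ] [DecidableEq κ]

lemma ringChar_ne_two_of_two_ne_zero (h2 : (2 : κ) ≠ 0) : ringChar κ ≠ 2 := fun h => h2 (by
  have := ringChar.Nat.cast_ringChar (R := κ); rw [h] at this; exact_mod_cast this)

lemma sum_quadraticChar_mul_add (h2 : (2 : κ) ≠ 0) {c : κ} (hc : c ≠ 0) :
    ∑ y : κ, quadraticChar κ (y * (y + c)) = -1 := by
  have hch := ringChar_ne_two_of_two_ne_zero h2
  -- for `y ≠ 0` put `z = 1 + c / y`, which takes every value but `1`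
  have h1 : ∑ y : κ, quadraticChar κ (y * (y + c)) =
      ∑ y ∈ Finset.univ.erase 0, quadraticChar κ (1 + c / y) := by
    rw [← Finset.add_sum_erase _ _ (Finset.mem_univ (0 : κ))]
    simp only [zero_mul, MulChar.map_zero, zero_add]
    refine Finset.sum_congr rfl fun y hy => ?_
    have hy0 : y ≠ 0 := by simpa using hy
    have : y * (y + c) = y ^ 2 * (1 + c / y) := by field_simp
    rw [this, map_mul, quadraticChar_sq_one' hy0, one_mul]
  have h3 : ∑ y ∈ Finset.univ.erase (0 : κ), quadraticChar κ (1 + c / y) =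
      ∑ z ∈ Finset.univ.erase (1 : κ), quadraticChar κ z := by
    refine Finset.sum_bij' (fun y _ => 1 + c / y) (fun z _ => c / (z - 1)) ?_ ?_ ?_ ?_ ?_
    · intro y hy
      have hy0 : y ≠ 0 := by simpa using hy
      simp [hc, hy0]
    · intro z hz
      have hz0 : z - 1 ≠ 0 := by simpa [sub_eq_zero] using hz
      simp [hc, hz0]
    · intro y hy
      have hy0 : y ≠ 0 := by simpa using hy
      simp; field_simp
    · intro z hz
      have hz0 : z - 1 ≠ 0 := by simpa [sub_eq_zero] using hz
      field_simp; ring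
    · intros; rfl
  have h4 := Finset.add_sum_erase Finset.univ (fun z => quadraticChar κ z)
    (Finset.mem_univ (1 : κ))
  rw [quadraticChar_sum_zero hch, map_one] at h4
  rw [h1, h3]; linarith

lemma sum_quadraticChar_sq_add (h2 : (2 : κ) ≠ 0) {c : κ} (hc : c ≠ 0) :
    ∑ y : κ, quadraticChar κ (y ^ 2 + c) = -1 := by
  have hch := ringChar_ne_two_of_two_ne_zero h2
  have h1 : ∑ y : κ, quadraticChar κ (y ^ 2 + c) =
      ∑ x : κ, (quadraticChar κ x + 1) * quadraticChar κ (x + c) := by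
    rw [← Finset.sum_fiberwise Finset.univ (fun y : κ => y ^ 2)]
    refine Finset.sum_congr rfl fun x _ => ?_
    rw [← quadraticChar_card_sqrts hch x, Finset.sum_congr rfl (g := fun _ =>
      quadraticChar κ (x + c)) (by intro y hy; rw [(Finset.mem_filter.1 hy).2])]
    rw [Finset.sum_const, nsmul_eq_mul]
    congr 3
    ext y; simp
  have h3 : ∑ x : κ, quadraticChar κ (x + c) = 0 := by
    rw [← quadraticChar_sum_zero hch]
    exact Equiv.sum_comp (Equiv.addRight c) (fun x => quadraticChar κ x)
  rw [h1]
  simp only [add_mul, one_mul, Finset.sum_add_distrib, h3, add_zero, ← map_mul]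
  exact sum_quadraticChar_mul_add h2 hc

lemma sum_quadraticChar_add_sq_mul (h2 : (2 : κ) ≠ 0) {a b : κ} (ha : a ≠ 0) (hb : b ≠ 0) :
    ∑ y : κ, quadraticChar κ (a + y ^ 2 * b) = -quadraticChar κ b := by
  have : ∀ y : κ, quadraticChar κ (a + y ^ 2 * b) =
      quadraticChar κ b * quadraticChar κ (y ^ 2 + a / b) := by
    intro y; rw [← map_mul]; congr 1; field_simp; ring
  simp only [this, ← Finset.mul_sum, sum_quadraticChar_sq_add h2 (div_ne_zero ha hb)]
  ring

lemma sum_quadraticChar_mul_left (h2 : (2 : κ) ≠ 0) (b : κ) :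
    ∑ y : κ, quadraticChar κ (b * y) = 0 := by
  simp only [map_mul, ← Finset.mul_sum,
    quadraticChar_sum_zero (ringChar_ne_two_of_two_ne_zero h2), mul_zero]

end QuadraticCharSum

/-! ### Residue systems -/

section ResidueSystems

open IsLocalRing

/-- `S` contains exactly one representative of each residue class modulo `m`. -/
def IsResidueSystem {O : Type*} [CommRing O] (m : O) (S : Finset O) : Prop :=
  ∀ s, ∃! t, t ∈ S ∧ m ∣ s - t

lemma IsResidueSystem.sum_filter {O : Type*} [CommRing O] {m : O} {S : Finset O}
    (hS : IsResidueSystem m S) (P : O → Prop) [DecidablePred P]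
    (hP : ∀ s t, m ∣ s - t → P s → P t) {α : Type*} (A : Finset α) (φ : α → O)
    (hφP : ∀ a ∈ A, P (φ a)) (hφ : ∀ s, P s → ∃! a, a ∈ A ∧ m ∣ s - φ a)
    {β : Type*} [AddCommMonoid β] (g : O → β) (hg : ∀ s t, m ∣ s - t → P s → g s = g t) :
    ∑ s ∈ S with P s, g s = ∑ a ∈ A, g (φ a) := by
  classical
  choose i hi hi' using fun s : {s // P s} => hφ s s.2
  choose j hj hj' using hS
  have hsymm : ∀ {s t : O}, m ∣ s - t → m ∣ t - s := fun h => by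
    rw [← neg_sub]; exact (dvd_neg).2 h
  refine Finset.sum_bij' (fun s hs => i ⟨s, (Finset.mem_filter.1 hs).2⟩) (fun a _ => j (φ a))
    ?_ ?_ ?_ ?_ ?_
  · intro s hs; exact (hi _).1
  · intro a ha
    exact Finset.mem_filter.2 ⟨(hj _).1, hP _ _ (hj (φ a)).2 (hφP a ha)⟩
  · intro s hs
    exact (hj' _ s ⟨(Finset.mem_filter.1 hs).1, hsymm (hi ⟨s, (Finset.mem_filter.1 hs).2⟩).2⟩).symm
  · intro a ha
    exact (hi' ⟨j (φ a), _⟩ a ⟨ha, hsymm (hj (φ a)).2⟩).symm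
  · intro s hs
    exact hg _ _ (hi ⟨s, (Finset.mem_filter.1 hs).2⟩).2 (Finset.mem_filter.1 hs).2

variable {O : Type*} [CommRing O] [IsDomain O] [IsDiscreteValuationRing O] {ϖ : O}

lemma exists_isResidueSystem [Finite (ResidueField O)] (hϖ : Irreducible ϖ) (k : ℕ) :
    ∃ S : Finset O, IsResidueSystem (ϖ ^ k) S ∧ S.card = Nat.card (ResidueField O) ^ k := by
  classical
  have hcard : Nat.card (O ⧸ Ideal.span {ϖ ^ k}) = Nat.card (ResidueField O) ^ k := by
    rw [← Ideal.span_singleton_pow, ← hϖ.maximalIdeal_eq]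
    have := cardQuot_pow_of_prime (P := maximalIdeal O) (i := k)
      (IsDiscreteValuationRing.not_a_field O)
    rw [Submodule.cardQuot_apply, Submodule.cardQuot_apply] at this
    exact this
  have : Finite (O ⧸ Ideal.span {ϖ ^ k}) := Nat.finite_of_card_ne_zero (by
    rw [hcard]; exact pow_ne_zero _ Nat.card_pos.ne')
  have := Fintype.ofFinite (O ⧸ Ideal.span {ϖ ^ k})
  have hinj : Function.Injective (Quotient.out : O ⧸ Ideal.span {ϖ ^ k} → O) :=
    fun x y h => by
      rw [← Quotient.out_eq x, ← Quotient.out_eq y, h]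
  refine ⟨Finset.univ.image (Quotient.out : O ⧸ Ideal.span {ϖ ^ k} → O), fun s => ?_, ?_⟩
  · refine ⟨Quotient.out (Ideal.Quotient.mk (Ideal.span {ϖ ^ k}) s), ⟨by simp, ?_⟩, ?_⟩
    · rw [← Ideal.mem_span_singleton, ← Ideal.Quotient.eq]
      exact (Quotient.out_eq _).symm
    · rintro t ⟨ht, hd⟩
      obtain ⟨x, -, rfl⟩ := Finset.mem_image.1 ht
      rw [← Ideal.mem_span_singleton, ← Ideal.Quotient.eq] at hd
      rw [hd]
      congr 1
      exact (Quotient.out_eq x).symm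
  · rw [Finset.card_image_of_injective _ hinj, Finset.card_univ, ← Nat.card_eq_fintype_card]
    exact hcard

variable (ϖ) in
/-- The residue class of `x / ϖ ^ k` if `ϖ ^ k` divides `x`, and `0` otherwise. -/
noncomputable def leadCoeff (k : ℕ) (x : O) : ResidueField O :=
  open Classical in if h : ϖ ^ k ∣ x then residue O h.choose else 0

lemma leadCoeff_mul (hϖ : Irreducible ϖ) (k : ℕ) (y : O) :
    leadCoeff ϖ k (ϖ ^ k * y) = residue O y := by
  have h : ϖ ^ k ∣ ϖ ^ k * y := Dvd.intro _ rfl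
  rw [leadCoeff, dif_pos h]
  congr 1
  exact (mul_left_cancel₀ (pow_ne_zero _ hϖ.ne_zero) h.choose_spec).symm

lemma leadCoeff_eq_zero_iff (hϖ : Irreducible ϖ) {k : ℕ} {x : O} (h : ϖ ^ k ∣ x) :
    leadCoeff ϖ k x = 0 ↔ ϖ ^ (k + 1) ∣ x := by
  obtain ⟨y, rfl⟩ := h
  rw [leadCoeff_mul hϖ, residue_eq_zero_iff_dvd hϖ, pow_succ,
    mul_dvd_mul_iff_left (pow_ne_zero _ hϖ.ne_zero)]

variable [Finite (ResidueField O)]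

lemma IsResidueSystem.sum_filter_dvd (hϖ : Irreducible ϖ) {j k : ℕ} (hkj : k ≤ j)
    {S Y : Finset O} (hS : IsResidueSystem (ϖ ^ j) S) (hY : IsResidueSystem (ϖ ^ (j - k)) Y)
    (c : O) {β : Type*} [AddCommMonoid β] (g : O → β)
    (hg : ∀ s t, ϖ ^ j ∣ s - t → ϖ ^ k ∣ s - c → g s = g t) [DecidablePred (ϖ ^ k ∣ · - c)] :
    ∑ s ∈ S with ϖ ^ k ∣ s - c, g s = ∑ y ∈ Y, g (c + ϖ ^ k * y) := by
  refine hS.sum_filter (fun s => ϖ ^ k ∣ s - c) (fun s t hst h => ?_) Y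
    (fun y => c + ϖ ^ k * y) (fun y _ => by simp) (fun s hs => ?_) g hg
  · have := dvd_sub h ((pow_dvd_pow ϖ hkj).trans hst)
    simpa using this
  · obtain ⟨r, hr⟩ := hs
    have key : ∀ y, ϖ ^ j ∣ s - (c + ϖ ^ k * y) ↔ ϖ ^ (j - k) ∣ r - y := by
      intro y
      have h1 : s - (c + ϖ ^ k * y) = ϖ ^ k * (r - y) := by linear_combination hr
      rw [h1, ← Nat.add_sub_cancel' hkj, pow_add, Nat.add_sub_cancel_left,
        mul_dvd_mul_iff_left (pow_ne_zero _ hϖ.ne_zero)]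
    simp only [key]
    exact hY r

lemma IsResidueSystem.card_filter_dvd (hϖ : Irreducible ϖ) {j k : ℕ} (hkj : k ≤ j)
    {S : Finset O} (hS : IsResidueSystem (ϖ ^ j) S) (c : O) [DecidablePred (ϖ ^ k ∣ · - c)] :
    (S.filter (fun s => ϖ ^ k ∣ s - c)).card = Nat.card (ResidueField O) ^ (j - k) := by
  obtain ⟨Y, hY, hc⟩ := exists_isResidueSystem hϖ (j - k)
  have := hS.sum_filter_dvd hϖ hkj hY c (fun _ => 1) (by simp)
  simpa [hc] using this

lemma IsResidueSystem.sum_residue [Fintype (ResidueField O)] (hϖ : Irreducible ϖ) {j : ℕ}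
    (hj : 0 < j) {S : Finset O} (hS : IsResidueSystem (ϖ ^ j) S) (h : ResidueField O → ℤ) :
    ∑ s ∈ S, h (residue O s) = Nat.card (ResidueField O) ^ (j - 1) * ∑ x, h x := by
  classical
  rw [← Finset.sum_fiberwise S (fun s => residue O s), Finset.mul_sum]
  refine Finset.sum_congr rfl fun x _ => ?_
  obtain ⟨c, rfl⟩ := residue_surjective x
  have hf : S.filter (fun s => residue O s = residue O c) = S.filter (fun s => ϖ ^ 1 ∣ s - c) := by
    ext s
    simp only [Finset.mem_filter, pow_one]
    rw [← residue_eq_zero_iff_dvd hϖ, map_sub, sub_eq_zero]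
  rw [Finset.sum_congr rfl (g := fun _ => h (residue O c))
    (by intro s hs; rw [(Finset.mem_filter.1 hs).2]), Finset.sum_const, hf,
    hS.card_filter_dvd hϖ hj c]
  simp

lemma IsResidueSystem.sum_leadCoeff [Fintype (ResidueField O)] (hϖ : Irreducible ϖ) {j k : ℕ}
    (hkj : k < j) {S : Finset O} (hS : IsResidueSystem (ϖ ^ j) S) (c : O)
    (h : ResidueField O → ℤ) [DecidablePred (ϖ ^ k ∣ · - c)] :
    ∑ s ∈ S with ϖ ^ k ∣ s - c, h (leadCoeff ϖ k (s - c)) =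
      Nat.card (ResidueField O) ^ (j - k - 1) * ∑ x, h x := by
  obtain ⟨Y, hY, hc⟩ := exists_isResidueSystem hϖ (j - k)
  rw [hS.sum_filter_dvd hϖ hkj.le hY c (fun s => h (leadCoeff ϖ k (s - c)))]
  · simp only [add_sub_cancel_left, leadCoeff_mul hϖ]
    exact hY.sum_residue hϖ (by omega) h
  · rintro s t ⟨r, hr⟩ ⟨y, hy⟩
    have h1 : t - c = ϖ ^ k * (y - ϖ ^ (j - k) * r) := by
      have : ϖ ^ j = ϖ ^ k * ϖ ^ (j - k) := by rw [← pow_add, Nat.add_sub_cancel' hkj.le]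
      rw [this] at hr
      linear_combination hy - hr
    have h2 : ϖ ∣ ϖ ^ (j - k) := dvd_pow_self _ (by omega)
    rw [h1, hy, leadCoeff_mul hϖ, leadCoeff_mul hϖ, map_sub, map_mul,
      (residue_eq_zero_iff_dvd hϖ _).2 h2, zero_mul, sub_zero]

end ResidueSystems

/-! ### Counting the parameters of binary overlattices -/

section Counting

open IsLocalRing Finset

variable {O : Type*} [CommRing O] [IsDomain O] [IsDiscreteValuationRing O] {ϖ : O}

/-- The integrality condition on the parameters `(i, j, s)` of a binary overlattice: the entries
`ϖ^(d₁ - 2i) v₁`, `ϖ^(d₁ - 2i - j) s v₁` and `ϖ^(d₂ - 2j) v₂ + ϖ^(d₁ - 2(i + j)) s² v₁` of its Gram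
matrix are integral, with denominators cleared. -/
def IntegralParam (ϖ : O) (v₁ v₂ : Oˣ) (d₁ d₂ i j : ℕ) (s : O) : Prop :=
  2 * i ≤ d₁ ∧ ϖ ^ (2 * i + j) ∣ ϖ ^ d₁ * s ∧
    ϖ ^ (2 * (i + j)) ∣ ϖ ^ (d₂ + 2 * i) * v₂ + ϖ ^ d₁ * s ^ 2 * v₁

/-- The Gram determinant `ϖ^(d₁ + d₂ - 2(i + j)) v₁ v₂` of an integral lattice is integral. -/
lemma IntegralParam.le (hϖ : Irreducible ϖ) {v₁ v₂ : Oˣ} {d₁ d₂ i j : ℕ} {s : O}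
    (h : IntegralParam ϖ v₁ v₂ d₁ d₂ i j s) : 2 * (i + j) ≤ d₁ + d₂ := by
  obtain ⟨h1, ⟨b, h2⟩, ⟨c, h3⟩⟩ := h
  have : ϖ ^ (2 * i + 2 * (i + j)) ∣ v₂ * ϖ ^ (d₁ + d₂ + 2 * i) := by
    refine ⟨ϖ ^ (d₁ - 2 * i) * c - b ^ 2 * v₁, ?_⟩
    have h4 : ϖ ^ d₁ = ϖ ^ (2 * i) * ϖ ^ (d₁ - 2 * i) := by
      rw [← pow_add, Nat.add_sub_cancel' h1]
    have h5 : (v₂ : O) * ϖ ^ (d₁ + d₂ + 2 * i) = ϖ ^ d₁ *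
        (ϖ ^ (d₂ + 2 * i) * v₂ + ϖ ^ d₁ * s ^ 2 * v₁) - (ϖ ^ d₁ * s) ^ 2 * v₁ := by ring
    rw [h5, h3, h2, h4]
    ring
  rw [pow_dvd_unit_mul_pow_iff hϖ] at this
  omega

lemma pow_dvd_or_of_isUnit_sub (hϖ : Irreducible ϖ) {k : ℕ} {x y : O} (hxy : IsUnit (x - y))
    (h : ϖ ^ k ∣ x * y) : ϖ ^ k ∣ x ∨ ϖ ^ k ∣ y := by
  by_cases hx : ϖ ∣ x
  · refine .inl (hϖ.prime.pow_dvd_of_dvd_mul_right k (fun hy => ?_) h)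
    exact hϖ.not_isUnit (isUnit_of_dvd_unit (dvd_sub hx hy) hxy)
  · exact .inr (hϖ.prime.pow_dvd_of_dvd_mul_left k hx h)

/-- If the sum of `ϖ^n v₂` and `ϖ^d s² v₁` is divisible by `ϖ^N` with `n < N`, then both terms
have order `n`. -/
lemma exists_unit_of_pow_dvd (hϖ : Irreducible ϖ) {v₁ v₂ : Oˣ} {n d N : ℕ} {s : O} (hn : n < N)
    (h : ϖ ^ N ∣ ϖ ^ n * v₂ + ϖ ^ d * s ^ 2 * v₁) :
    ∃ (e : ℕ) (u : Oˣ), s = u * ϖ ^ e ∧ d + 2 * e = n ∧ ϖ ^ (N - n) ∣ (v₂ : O) + u ^ 2 * v₁ := by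
  have hs : s ≠ 0 := by
    rintro rfl
    have h' : ϖ ^ N ∣ v₂ * ϖ ^ n := by simpa [mul_comm] using h
    rw [pow_dvd_unit_mul_pow_iff hϖ] at h'
    omega
  obtain ⟨e, u, rfl⟩ := IsDiscreteValuationRing.eq_unit_mul_pow_irreducible hs hϖ
  have h1 : ϖ ^ d * ((u : O) * ϖ ^ e) ^ 2 * v₁ = ((u ^ 2 * v₁ : Oˣ) : O) * ϖ ^ (d + 2 * e) := by
    push_cast; ring
  rw [h1] at h
  have hde : d + 2 * e = n := by
    rcases lt_trichotomy (d + 2 * e) n with hlt | heq | hgt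
    · exfalso
      have h2 : ϖ ^ (d + 2 * e + 1) ∣ ((u ^ 2 * v₁ : Oˣ) : O) * ϖ ^ (d + 2 * e) :=
        (dvd_add_right (dvd_mul_of_dvd_left (pow_dvd_pow ϖ (by omega)) _)).1
          ((pow_dvd_pow ϖ (by omega)).trans h)
      rw [pow_dvd_unit_mul_pow_iff hϖ] at h2
      omega
    · exact heq
    · exfalso
      have h2 : ϖ ^ (n + 1) ∣ ϖ ^ n * (v₂ : O) :=
        (dvd_add_left (dvd_mul_of_dvd_right (pow_dvd_pow ϖ (by omega)) _)).1
          ((pow_dvd_pow ϖ (by omega)).trans h)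
      rw [mul_comm, pow_dvd_unit_mul_pow_iff hϖ] at h2
      omega
  refine ⟨e, u, rfl, hde, ?_⟩
  have h3 : ϖ ^ N = ϖ ^ n * ϖ ^ (N - n) := by rw [← pow_add, Nat.add_sub_cancel' hn.le]
  have h4 : ϖ ^ n * (v₂ : O) + ((u ^ 2 * v₁ : Oˣ) : O) * ϖ ^ (d + 2 * e)
      = ϖ ^ n * ((v₂ : O) + u ^ 2 * v₁) := by rw [hde]; push_cast; ring
  rwa [h3, h4, mul_dvd_mul_iff_left (pow_ne_zero _ hϖ.ne_zero)] at h

variable {v₁ v₂ : Oˣ} {d₁ d₂ : ℕ}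

/-- For `2 j ≤ d₂` the first term of the last Gram entry is integral by itself, so that
integrality is a divisibility condition on `s`. -/
lemma integralParam_iff_of_le (hϖ : Irreducible ϖ) {b j : ℕ} (hjb : j ≤ b) (hj : 2 * j ≤ d₂)
    (s : O) : IntegralParam ϖ v₁ v₂ d₁ d₂ (b - j) j s ↔
      (2 * b + 1 - d₁) / 2 ≤ j ∧ ϖ ^ ((2 * b + 1 - d₁) / 2) ∣ s := by
  have e1 : 2 * (b - j + j) = 2 * b := by omega
  have h1 : ϖ ^ (2 * b) ∣ ϖ ^ (d₂ + 2 * (b - j)) * (v₂ : O) :=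
    dvd_mul_of_dvd_left (pow_dvd_pow ϖ (by omega)) _
  have h2 : ϖ ^ (2 * b) ∣ ϖ ^ (d₂ + 2 * (b - j)) * (v₂ : O) + ϖ ^ d₁ * s ^ 2 * v₁ ↔
      ϖ ^ (2 * b) ∣ ϖ ^ d₁ * s ^ 2 := by
    rw [dvd_add_right h1, Units.dvd_mul_right]
  rw [IntegralParam, e1, h2]
  constructor
  · rintro ⟨h3, -, h4⟩
    refine ⟨by omega, ?_⟩
    rcases le_or_gt (2 * b) d₁ with hb | hb
    · rw [show (2 * b + 1 - d₁) / 2 = 0 by omega]; simp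
    · have : ϖ ^ (2 * b) = ϖ ^ d₁ * ϖ ^ (2 * b - d₁) := by
        rw [← pow_add, Nat.add_sub_cancel' hb.le]
      rw [this, mul_dvd_mul_iff_left (pow_ne_zero _ hϖ.ne_zero)] at h4
      exact pow_dvd_of_pow_dvd_sq hϖ (by omega) h4
  · rintro ⟨h3, s, rfl⟩
    refine ⟨by omega, ?_, ?_⟩
    · rw [← mul_assoc, ← pow_add]
      exact dvd_mul_of_dvd_left (pow_dvd_pow ϖ (by omega)) _
    · rw [mul_pow, ← mul_assoc, ← pow_mul, ← pow_add]
      exact dvd_mul_of_dvd_left (pow_dvd_pow ϖ (by omega)) _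

/-- For `d₂ < 2 j` the two terms of the last Gram entry have to cancel, which makes `-v₁ v₂` a
square modulo `ϖ`. -/
lemma not_integralParam_of_lt (hϖ : Irreducible ϖ) [IsAdicComplete (maximalIdeal O) O]
    (h2 : (2 : ResidueField O) ≠ 0) {b j : ℕ} (hj : d₂ < 2 * j)
    (hhyp : ¬ (Even (d₁ + d₂) ∧ IsSquare (-(v₁ * v₂)))) (s : O) :
    ¬ IntegralParam ϖ v₁ v₂ d₁ d₂ (b - j) j s := by
  rintro ⟨-, -, h⟩
  obtain ⟨e, u, rfl, he, hd⟩ := exists_unit_of_pow_dvd hϖ (by omega) h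
  refine hhyp ⟨⟨d₁ + e - (b - j), by omega⟩, ?_⟩
  rw [isSquare_unit_iff h2]
  have h3 : ϖ ∣ (v₂ : O) + u ^ 2 * v₁ := (dvd_pow_self ϖ (by omega)).trans hd
  rw [← residue_eq_zero_iff_dvd hϖ] at h3
  refine ⟨residue O (u * v₁), ?_⟩
  push_cast
  simp only [map_add, map_mul, map_neg, map_pow] at h3 ⊢
  linear_combination -(residue O v₁) * h3

/-- For `d₂ < 2 j` the last Gram entry is `v₁` times the difference of two squares, and
integrality means that `s` is close to one of the two roots. -/
lemma integralParam_iff_of_lt (hϖ : Irreducible ϖ) (h2 : (2 : ResidueField O) ≠ 0)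
    (hd : d₁ ≤ d₂) {b j : ℕ}
    (hjb : j ≤ b) (hj : d₂ < 2 * j) (hb : 2 * b ≤ d₁ + d₂) (hev : Even (d₁ + d₂)) {c : Oˣ}
    (hc : (v₂ : O) = -(v₁ * c ^ 2)) (s : O) :
    IntegralParam ϖ v₁ v₂ d₁ d₂ (b - j) j s ↔
      ϖ ^ (b + j - (d₁ + d₂) / 2) ∣ s - ϖ ^ ((d₂ - d₁) / 2 + (b - j)) * c ∨
      ϖ ^ (b + j - (d₁ + d₂) / 2) ∣ s - -(ϖ ^ ((d₂ - d₁) / 2 + (b - j)) * c) := by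
  obtain ⟨D, hD⟩ := hev
  set r := (d₂ - d₁) / 2 + (b - j) with hr
  have hr2 : d₁ + 2 * r = d₂ + 2 * (b - j) := by omega
  have hrk : b + j - (d₁ + d₂) / 2 = r + (2 * j - d₂) := by omega
  rw [hrk]
  constructor
  · rintro ⟨-, -, h⟩
    obtain ⟨e, u, rfl, he, hdv⟩ := exists_unit_of_pow_dvd hϖ (by omega) h
    obtain rfl : e = r := by omega
    rw [show 2 * (b - j + j) - (d₂ + 2 * (b - j)) = 2 * j - d₂ by omega] at hdv
    have h3 : (v₂ : O) + u ^ 2 * v₁ = v₁ * ((u - c) * (u + c)) := by rw [hc]; ring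
    rw [h3, Units.dvd_mul_left] at hdv
    have key : ∀ y : O, ϖ ^ (2 * j - d₂) ∣ u - y →
        ϖ ^ (r + (2 * j - d₂)) ∣ u * ϖ ^ r - ϖ ^ r * y := by
      intro y hy
      rw [pow_add, show u * ϖ ^ r - ϖ ^ r * y = ϖ ^ r * (u - y) by ring]
      exact mul_dvd_mul_left _ hy
    have hu : IsUnit (((u : O) - c) - (u + c)) := by
      have : ((u : O) - c) - (u + c) = -(2 * c) := by ring
      rw [this]; exact ((isUnit_two h2).mul c.isUnit).neg
    rcases pow_dvd_or_of_isUnit_sub hϖ hu hdv with h | h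
    · exact .inl (key _ h)
    · refine .inr ?_
      have := key (-c) (by simpa using h)
      simpa using this
  · have key : ∀ c : O, (v₂ : O) = -(v₁ * c ^ 2) → ϖ ^ (r + (2 * j - d₂)) ∣ s - ϖ ^ r * c →
        IntegralParam ϖ v₁ v₂ d₁ d₂ (b - j) j s := by
      rintro c hc ⟨y, hy⟩
      have hs : s = ϖ ^ r * (c + ϖ ^ (2 * j - d₂) * y) := by
        rw [pow_add] at hy; linear_combination hy
      refine ⟨by omega, ?_, ?_⟩
      · rw [hs, ← mul_assoc, ← pow_add]
        exact dvd_mul_of_dvd_left (pow_dvd_pow ϖ (by omega)) _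
      · refine ⟨v₁ * y * (2 * c + ϖ ^ (2 * j - d₂) * y), ?_⟩
        have e1 : ϖ ^ (2 * (b - j + j)) = ϖ ^ (d₁ + 2 * r) * ϖ ^ (2 * j - d₂) := by
          rw [← pow_add]; congr 1; omega
        rw [e1, hs, ← hr2, hc]
        ring
    rintro (h | h)
    · exact key c hc h
    · exact key (-c) (by rw [hc]; ring) (by simpa using h)

lemma exists_unit_of_isSquare_neg_mul (h : IsSquare (-(v₁ * v₂))) :
    ∃ c : Oˣ, (v₂ : O) = -(v₁ * c ^ 2) := by
  obtain ⟨c, hc⟩ := h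
  have h1 : (v₁ : O) * v₂ = -(c * c) := by
    rw [eq_neg_iff_add_eq_zero, add_comm, ← Units.val_mul, ← hc]; simp
  refine ⟨c * v₁⁻¹, v₁.isUnit.mul_left_cancel ?_⟩
  have h2 : (v₁ : O) * (v₁⁻¹ : Oˣ) = 1 := by simp
  rw [h1]
  push_cast
  linear_combination (c : O) ^ 2 * (v₁ * (v₁⁻¹ : Oˣ) + 1) * h2

lemma not_both_dvd (hϖ : Irreducible ϖ) (h2 : (2 : ResidueField O) ≠ 0) {r k : ℕ} (hk : r < k)
    (c : Oˣ) (s : O) (h : ϖ ^ k ∣ s - ϖ ^ r * c) : ¬ ϖ ^ k ∣ s - -(ϖ ^ r * c) := by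
  intro h'
  have h1 : ϖ ^ k ∣ (((isUnit_two h2).unit * c : Oˣ) : O) * ϖ ^ r := by
    have := dvd_sub h' h
    convert this using 1
    push_cast
    rw [IsUnit.unit_spec]
    ring
  rw [pow_dvd_unit_mul_pow_iff hϖ] at h1
  omega

section Count

variable [IsAdicComplete (maximalIdeal O) O] [Finite (ResidueField O)]
  {T : ℕ → Finset O}

open Classical in
/-- The number of integral parameters `(i, j, s)` with `i + j = b`, where `s` runs over a system of
representatives modulo `ϖ ^ j`. -/
noncomputable def numIntegral (ϖ : O) (v₁ v₂ : Oˣ) (T : ℕ → Finset O) (d₁ d₂ b : ℕ) : ℕ :=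
  ∑ j ∈ range (b + 1), ((T j).filter (IntegralParam ϖ v₁ v₂ d₁ d₂ (b - j) j)).card

open Classical in
lemma card_filter_integralParam (hϖ : Irreducible ϖ) (h2 : (2 : ResidueField O) ≠ 0)
    (hT : ∀ j, IsResidueSystem (ϖ ^ j) (T j)) (hd : d₁ ≤ d₂) {b j : ℕ} (hjb : j ≤ b)
    (hb : 2 * b ≤ d₁ + d₂) :
    ((T j).filter (IntegralParam ϖ v₁ v₂ d₁ d₂ (b - j) j)).card =
      if 2 * j ≤ d₂ then if (2 * b + 1 - d₁) / 2 ≤ j then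
        Nat.card (ResidueField O) ^ (j - (2 * b + 1 - d₁) / 2) else 0
      else if Even (d₁ + d₂) ∧ IsSquare (-(v₁ * v₂)) then
        2 * Nat.card (ResidueField O) ^ ((d₁ + d₂) / 2 - b) else 0 := by
  split_ifs with h h' h'
  · rw [← (hT j).card_filter_dvd hϖ h' 0]
    congr 1
    ext s
    simp [integralParam_iff_of_le hϖ hjb h, h']
  · rw [card_eq_zero, filter_eq_empty_iff]
    intro s _
    rw [integralParam_iff_of_le hϖ hjb h]
    exact fun h => h' h.1
  · obtain ⟨hev, hsq⟩ := h'
    obtain ⟨c, hc⟩ := exists_unit_of_isSquare_neg_mul hsq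
    have hk : b + j - (d₁ + d₂) / 2 ≤ j := by obtain ⟨D, hD⟩ := hev; omega
    have e : j - (b + j - (d₁ + d₂) / 2) = (d₁ + d₂) / 2 - b := by
      obtain ⟨D, hD⟩ := hev; omega
    have h3 := (hT j).card_filter_dvd hϖ hk (ϖ ^ ((d₂ - d₁) / 2 + (b - j)) * c)
    have h4 := (hT j).card_filter_dvd hϖ hk (-(ϖ ^ ((d₂ - d₁) / 2 + (b - j)) * c))
    rw [e] at h3 h4
    rw [filter_congr (fun s _ => integralParam_iff_of_lt hϖ h2 hd hjb (by omega) hb hev hc s),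
      filter_or, card_union_of_disjoint, h3, h4, two_mul]
    rw [disjoint_filter]
    intro s _
    exact not_both_dvd hϖ h2 (by obtain ⟨D, hD⟩ := hev; omega) _ s
  · rw [card_eq_zero, filter_eq_empty_iff]
    intro s _
    exact not_integralParam_of_lt hϖ h2 (by omega) h' s

lemma numIntegral_of_lt (hϖ : Irreducible ϖ) {b : ℕ} (hb : d₁ + d₂ < 2 * b) :
    numIntegral ϖ v₁ v₂ T d₁ d₂ b = 0 := by
  classical
  refine sum_eq_zero fun j hj => ?_
  rw [card_eq_zero, filter_eq_empty_iff]
  intro s _ h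
  have := h.le hϖ
  simp only [mem_range] at hj
  omega

open Classical in
/-- The parameters with `2 j ≤ d₂` contribute the geometric sum, those with `d₂ < 2 j` (which exist
only if the binary form is hyperbolic) contribute the same number for each `j`. -/
lemma numIntegral_eq (hϖ : Irreducible ϖ) (h2 : (2 : ResidueField O) ≠ 0)
    (hT : ∀ j, IsResidueSystem (ϖ ^ j) (T j)) (hd : d₁ ≤ d₂) {b : ℕ}
    (hb : 2 * b ≤ d₁ + d₂) :
    numIntegral ϖ v₁ v₂ T d₁ d₂ b =
      ∑ i ∈ range (min b (d₂ / 2) + 1 - (2 * b + 1 - d₁) / 2), Nat.card (ResidueField O) ^ i +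
      if Even (d₁ + d₂) ∧ IsSquare (-(v₁ * v₂)) then
        2 * (b - d₂ / 2) * Nat.card (ResidueField O) ^ ((d₁ + d₂) / 2 - b) else 0 := by
  set m := (2 * b + 1 - d₁) / 2 with hm
  rw [numIntegral, sum_congr rfl fun j hj => card_filter_integralParam hϖ h2 hT hd
    (Nat.lt_succ_iff.1 (mem_range.1 hj)) hb, ← hm, sum_ite]
  congr 1
  · rw [sum_ite, sum_const_zero, add_zero, filter_filter]
    have : (range (b + 1)).filter (fun j => 2 * j ≤ d₂ ∧ m ≤ j) =
        Ico m (min b (d₂ / 2) + 1) := by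
      ext j; simp only [mem_filter, mem_range, mem_Ico]; omega
    rw [this, sum_Ico_eq_sum_range]
    simp
  · split_ifs
    · rw [sum_const, smul_eq_mul]
      have : (range (b + 1)).filter (fun j => ¬ 2 * j ≤ d₂) = Ico (d₂ / 2 + 1) (b + 1) := by
        ext j; simp only [mem_filter, mem_range, mem_Ico]; omega
      rw [this, Nat.card_Ico, Nat.add_sub_add_right]
      ring
    · simp

end Count

section Signed

variable [IsAdicComplete (maximalIdeal O) O] [Fintype (ResidueField O)]
  [DecidableEq (ResidueField O)] {T : ℕ → Finset O}

open Classical in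
/-- The quadratic character of the first nonzero diagonal entry modulo `ϖ` of the Gram matrix with
integral parameters `(i, j, s)`, and `0` if both vanish. -/
noncomputable def paramSign (ϖ : O) (v₁ v₂ : Oˣ) (d₁ d₂ i j : ℕ) (s : O) : ℤ :=
  if 2 * i = d₁ then quadraticChar (ResidueField O) (residue O v₁)
  else quadraticChar (ResidueField O)
    (leadCoeff ϖ (2 * (i + j)) (ϖ ^ (d₂ + 2 * i) * v₂ + ϖ ^ d₁ * s ^ 2 * v₁))

open Classical in
/-- The part of the signed number of integral parameters `(i, j, s)` with `i + j = b` and fixed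
`j`. -/
noncomputable def signedSum (ϖ : O) (v₁ v₂ : Oˣ) (T : ℕ → Finset O) (d₁ d₂ b j : ℕ) : ℤ :=
  ∑ s ∈ (T j).filter (IntegralParam ϖ v₁ v₂ d₁ d₂ (b - j) j),
    paramSign ϖ v₁ v₂ d₁ d₂ (b - j) j s

lemma leadCoeff_diag (hϖ : Irreducible ϖ) {b j m : ℕ} (hjb : j ≤ b) (hj : 2 * j ≤ d₂)
    (hm : 2 * b ≤ d₁ + 2 * m) (y : O) :
    leadCoeff ϖ (2 * (b - j + j)) (ϖ ^ (d₂ + 2 * (b - j)) * v₂ + ϖ ^ d₁ * (ϖ ^ m * y) ^ 2 * v₁) =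
      (if 2 * j = d₂ then residue O v₂ else 0) +
        if d₁ + 2 * m = 2 * b then residue O y ^ 2 * residue O v₁ else 0 := by
  have h1 : ϖ ^ (d₂ + 2 * (b - j)) = ϖ ^ (2 * b) * ϖ ^ (d₂ - 2 * j) := by
    rw [← pow_add]; congr 1; omega
  have h2 : ϖ ^ d₁ * (ϖ ^ m * y) ^ 2 * v₁ =
      ϖ ^ (2 * b) * (ϖ ^ (d₁ + 2 * m - 2 * b) * (y ^ 2 * v₁)) := by
    rw [← mul_assoc, ← pow_add, Nat.add_sub_cancel' hm]; ring
  have hres : ∀ k, residue O (ϖ ^ k) = if k = 0 then 1 else 0 := by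
    intro k
    rw [map_pow, (residue_eq_zero_iff_dvd hϖ ϖ).2 dvd_rfl, zero_pow_eq]
  rw [Nat.sub_add_cancel hjb, h1, h2, mul_assoc, ← mul_add, leadCoeff_mul hϖ, map_add, map_mul,
    map_mul, hres, hres, map_mul, map_pow, ite_mul, ite_mul]
  congr 1
  · simp only [one_mul, zero_mul]; congr 1; exact propext (by omega)
  · simp only [one_mul, zero_mul]; congr 1; exact propext (by omega)

lemma signedSum_of_eq (hϖ : Irreducible ϖ) (hT : ∀ j, IsResidueSystem (ϖ ^ j) (T j)) {b j : ℕ}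
    (hjb : j ≤ b) (hb : 2 * b < d₁ + d₂) (hj : 2 * (b - j) = d₁) :
    signedSum ϖ v₁ v₂ T d₁ d₂ b j = quadraticChar (ResidueField O) (residue O v₁) := by
  classical
  have hc := (hT j).card_filter_dvd hϖ le_rfl 0
  rw [signedSum, filter_congr (fun s _ => integralParam_iff_of_le hϖ hjb (by omega) s),
    show (2 * b + 1 - d₁) / 2 = j by omega]
  simp only [sub_zero, le_refl, true_and, Nat.sub_self, pow_zero] at hc ⊢
  rw [sum_congr rfl (g := fun _ => quadraticChar (ResidueField O) (residue O v₁))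
    (fun s _ => by rw [paramSign, if_pos hj]), sum_const, hc, one_smul]

lemma signedSum_of_gt {b j : ℕ} (hj : d₁ < 2 * (b - j)) :
    signedSum ϖ v₁ v₂ T d₁ d₂ b j = 0 := by
  classical
  rw [signedSum, sum_eq_zero]
  intro s hs
  have := (mem_filter.1 hs).2.1
  omega

open Classical in
/-- The terms with `2 j ≤ d₂`, summed over `s = ϖ ^ m y`. -/
lemma signedSum_of_le (hϖ : Irreducible ϖ) {b j : ℕ} (hjb : j ≤ b) (hj : 2 * j ≤ d₂)
    (hi : 2 * (b - j) < d₁) :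
    signedSum ϖ v₁ v₂ T d₁ d₂ b j = ∑ s ∈ T j with ϖ ^ ((2 * b + 1 - d₁) / 2) ∣ s - 0,
      quadraticChar (ResidueField O) ((if 2 * j = d₂ then residue O v₂ else 0) +
        if d₁ + 2 * ((2 * b + 1 - d₁) / 2) = 2 * b then
          leadCoeff ϖ ((2 * b + 1 - d₁) / 2) (s - 0) ^ 2 * residue O v₁ else 0) := by
  set m := (2 * b + 1 - d₁) / 2 with hm
  rw [signedSum]
  refine sum_congr ?_ fun s hs => ?_
  · ext s
    rw [mem_filter, mem_filter, integralParam_iff_of_le hϖ hjb hj, ← hm, sub_zero]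
    have : m ≤ j := by omega
    tauto
  · obtain ⟨y, hy⟩ := (mem_filter.1 hs).2
    rw [sub_zero] at hy
    rw [paramSign, if_neg hi.ne, hy, leadCoeff_diag hϖ hjb hj (m := m) (by omega), sub_zero,
      leadCoeff_mul hϖ]

/-- For `d₂ < 2 j` the parameters near a root contribute the values of a linear function modulo `ϖ`,
whose quadratic characters cancel. -/
lemma signedSum_of_lt (hϖ : Irreducible ϖ) (h2 : (2 : ResidueField O) ≠ 0)
    (hT : ∀ j, IsResidueSystem (ϖ ^ j) (T j)) (hd : d₁ ≤ d₂) {b j : ℕ} (hjb : j ≤ b)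
    (hj : d₂ < 2 * j) (hb : 2 * b < d₁ + d₂) :
    signedSum ϖ v₁ v₂ T d₁ d₂ b j = 0 := by
  classical
  by_cases hhyp : Even (d₁ + d₂) ∧ IsSquare (-(v₁ * v₂))
  · obtain ⟨hev, hsq⟩ := hhyp
    obtain ⟨c, hc⟩ := exists_unit_of_isSquare_neg_mul hsq
    have hk : b + j - (d₁ + d₂) / 2 < j := by obtain ⟨D, hD⟩ := hev; omega
    have key : ∀ c : O, (v₂ : O) = -(v₁ * c ^ 2) →
        ∑ s ∈ T j with ϖ ^ (b + j - (d₁ + d₂) / 2) ∣ s - ϖ ^ ((d₂ - d₁) / 2 + (b - j)) * c,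
          paramSign ϖ v₁ v₂ d₁ d₂ (b - j) j s = 0 := by
      intro c hc
      have h3 := (hT j).sum_leadCoeff hϖ hk (ϖ ^ ((d₂ - d₁) / 2 + (b - j)) * c)
        (fun x => quadraticChar _ (residue O (2 * c * v₁) * x))
      rw [sum_quadraticChar_mul_left h2, mul_zero] at h3
      rw [← h3]
      refine sum_congr rfl fun s hs => ?_
      obtain ⟨y, hy⟩ := (mem_filter.1 hs).2
      rw [hy, leadCoeff_mul hϖ, paramSign, if_neg (by omega)]
      have hX : ϖ ^ (d₂ + 2 * (b - j)) * v₂ + ϖ ^ d₁ * s ^ 2 * v₁ =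
          ϖ ^ (2 * (b - j + j)) * (v₁ * y * (2 * c + ϖ ^ (2 * j - d₂) * y)) := by
        obtain ⟨D, hD⟩ := hev
        have e1 : ϖ ^ (2 * (b - j + j)) =
            ϖ ^ (d₁ + 2 * ((d₂ - d₁) / 2 + (b - j))) * ϖ ^ (2 * j - d₂) := by
          rw [← pow_add]; congr 1; omega
        have e2 : b + j - (d₁ + d₂) / 2 = (d₂ - d₁) / 2 + (b - j) + (2 * j - d₂) := by omega
        have e3 : d₂ + 2 * (b - j) = d₁ + 2 * ((d₂ - d₁) / 2 + (b - j)) := by omega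
        have hs : s = ϖ ^ ((d₂ - d₁) / 2 + (b - j)) * (c + ϖ ^ (2 * j - d₂) * y) := by
          rw [e2, pow_add] at hy; linear_combination hy
        rw [e1, e3, hs, hc]
        ring
      have hz : residue O (ϖ ^ (2 * j - d₂)) = 0 :=
        (residue_eq_zero_iff_dvd hϖ _).2 (dvd_pow_self _ (by omega))
      rw [hX, leadCoeff_mul hϖ]
      congr 1
      simp only [map_mul, map_add, hz]
      ring
    rw [signedSum, filter_congr (fun s _ => integralParam_iff_of_lt hϖ h2 hd hjb hj hb.le hev hc s),
      filter_or, sum_union]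
    · have := key (-c) (by rw [hc]; ring)
      simp only [mul_neg] at this
      rw [key c hc, this, add_zero]
    · rw [disjoint_filter]
      intro s _
      exact not_both_dvd hϖ h2 (by obtain ⟨D, hD⟩ := hev; omega) _ s
  · rw [signedSum, sum_eq_zero]
    intro s hs
    exact absurd (mem_filter.1 hs).2 (not_integralParam_of_lt hϖ h2 hj hhyp s)

/-- For odd `d₁` the last Gram entry modulo `ϖ` is `0` if `2 j < d₂` and `v₂` if `2 j = d₂`. -/
lemma signedSum_of_odd (hϖ : Irreducible ϖ) (h2 : (2 : ResidueField O) ≠ 0)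
    (hT : ∀ j, IsResidueSystem (ϖ ^ j) (T j)) (hd : d₁ ≤ d₂) {b j : ℕ} (hjb : j ≤ b)
    (hb : 2 * b < d₁ + d₂) (hodd : Odd d₁) :
    signedSum ϖ v₁ v₂ T d₁ d₂ b j = if 2 * j = d₂ then
      quadraticChar (ResidueField O) (residue O v₂) *
        Nat.card (ResidueField O) ^ (j - (2 * b + 1 - d₁) / 2) else 0 := by
  classical
  obtain ⟨e, he⟩ := hodd
  rcases lt_or_ge d₂ (2 * j) with hj | hj
  · rw [signedSum_of_lt hϖ h2 hT hd hjb hj hb, if_neg hj.ne']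
  rcases lt_or_ge d₁ (2 * (b - j)) with hi | hi
  · rw [signedSum_of_gt hi, if_neg (by omega)]
  rw [signedSum_of_le hϖ hjb hj (by omega)]
  have hne : ¬ d₁ + 2 * ((2 * b + 1 - d₁) / 2) = 2 * b := by omega
  simp only [hne, if_false, add_zero]
  rw [sum_const, (hT j).card_filter_dvd hϖ (by omega)]
  split_ifs
  · simp [mul_comm]
  · simp

/-- For even `d₁` and `2 i < d₁` the last Gram entry modulo `ϖ` is `v₁ x²` if `2 j < d₂` and
`v₂ + v₁ x²` if `2 j = d₂`, where `x` runs over the residue field. For `2 i = d₁` the sign is that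
of the first Gram entry `v₁`. -/
lemma signedSum_of_even (hϖ : Irreducible ϖ) (h2 : (2 : ResidueField O) ≠ 0)
    (hT : ∀ j, IsResidueSystem (ϖ ^ j) (T j)) (hd : d₁ ≤ d₂) {b j : ℕ} (hjb : j ≤ b)
    (hb : 2 * b < d₁ + d₂) (heven : Even d₁) (hdb : d₁ ≤ 2 * b) :
    signedSum ϖ v₁ v₂ T d₁ d₂ b j = quadraticChar (ResidueField O) (residue O v₁) *
      (if j = b - d₁ / 2 then 1
      else if b - d₁ / 2 < j ∧ 2 * j < d₂ then
        ((Nat.card (ResidueField O) : ℤ) - 1) *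
          Nat.card (ResidueField O) ^ (j - (b - d₁ / 2) - 1)
      else if 2 * j = d₂ then -(Nat.card (ResidueField O) : ℤ) ^ (j - (b - d₁ / 2) - 1)
      else 0) := by
  classical
  obtain ⟨e, he⟩ := heven
  have hv₁ : residue O (v₁ : O) ≠ 0 := (residue_ne_zero_iff_isUnit _).2 v₁.isUnit
  have hv₂ : residue O (v₂ : O) ≠ 0 := (residue_ne_zero_iff_isUnit _).2 v₂.isUnit
  rcases lt_or_ge d₂ (2 * j) with hj | hj
  · rw [signedSum_of_lt hϖ h2 hT hd hjb hj hb, if_neg (by omega), if_neg (by omega),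
      if_neg (by omega), mul_zero]
  rcases lt_trichotomy d₁ (2 * (b - j)) with hi | hi | hi
  · rw [signedSum_of_gt hi, if_neg (by omega), if_neg (by omega), if_neg (by omega), mul_zero]
  · rw [signedSum_of_eq hϖ hT hjb hb hi.symm, if_pos (by omega), mul_one]
  rw [signedSum_of_le hϖ hjb hj hi, if_neg (show ¬ j = b - d₁ / 2 by omega)]
  have hm : (2 * b + 1 - d₁) / 2 = b - d₁ / 2 := by omega
  have heq : d₁ + 2 * ((2 * b + 1 - d₁) / 2) = 2 * b := by omega
  simp only [heq, if_true]
  rw [(hT j).sum_leadCoeff hϖ (by omega) 0 (fun x => quadraticChar (ResidueField O)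
    ((if 2 * j = d₂ then residue O v₂ else 0) + x ^ 2 * residue O v₁)), hm]
  rcases hj.eq_or_lt with hj | hj
  · simp only [hj, if_true, lt_irrefl, and_false, if_false]
    rw [sum_quadraticChar_add_sq_mul h2 hv₂ hv₁]
    ring
  · simp only [hj.ne, if_false, zero_add, map_mul]
    rw [if_pos ⟨by omega, hj⟩, ← sum_mul]
    have hsq : ∑ x : ResidueField O, quadraticChar (ResidueField O) (x ^ 2) =
        (Nat.card (ResidueField O) : ℤ) - 1 := by
      rw [← add_sum_erase _ _ (mem_univ (0 : ResidueField O)),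
        sum_congr rfl (g := fun _ => (1 : ℤ)) (fun x hx => quadraticChar_sq_one' (by simpa using hx))]
      simp [card_univ, Nat.card_eq_fintype_card, Fintype.card_pos]
    rw [hsq]
    ring

lemma sum_range_geometric_step (f : ℤ) (m K : ℕ) :
    ∑ j ∈ range K, (if j = m then 1 else if m < j then (f - 1) * f ^ (j - m - 1) else 0) =
      if m < K then f ^ (K - 1 - m) else 0 := by
  induction K with
  | zero => simp
  | succ K ih =>
    rw [sum_range_succ, ih]
    rcases lt_trichotomy K m with h | rfl | h
    · rw [if_neg (by omega), if_neg (by omega), if_neg (by omega), if_neg (by omega), add_zero]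
    · simp
    · rw [if_pos h, if_neg (by omega), if_pos h, if_pos (by omega)]
      obtain ⟨t, rfl⟩ := Nat.exists_eq_add_of_lt h
      have e1 : m + t + 1 - 1 - m = t := by omega
      have e2 : m + t + 1 - m - 1 = t := by omega
      have e3 : m + t + 1 + 1 - 1 - m = t + 1 := by omega
      rw [e1, e2, e3]; ring

/-- The signed number of integral parameters `(i, j, s)` with `i + j = b`. -/
noncomputable def signedIntegral (ϖ : O) (v₁ v₂ : Oˣ) (T : ℕ → Finset O) (d₁ d₂ b : ℕ) : ℤ :=
  ∑ j ∈ range (b + 1), signedSum ϖ v₁ v₂ T d₁ d₂ b j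

lemma signedIntegral_of_odd (hϖ : Irreducible ϖ) (h2 : (2 : ResidueField O) ≠ 0)
    (hT : ∀ j, IsResidueSystem (ϖ ^ j) (T j)) (hd : d₁ ≤ d₂) {b : ℕ}
    (hb : 2 * b < d₁ + d₂) (hodd : Odd d₁) :
    signedIntegral ϖ v₁ v₂ T d₁ d₂ b = if Even d₂ ∧ d₂ ≤ 2 * b then
      quadraticChar (ResidueField O) (residue O v₂) *
        Nat.card (ResidueField O) ^ ((d₁ + d₂ - 1) / 2 - b) else 0 := by
  rw [signedIntegral, sum_congr rfl fun j hj => signedSum_of_odd hϖ h2 hT hd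
    (Nat.lt_succ_iff.1 (mem_range.1 hj)) hb hodd]
  obtain ⟨e, he⟩ := hodd
  split_ifs with h
  · obtain ⟨⟨t, ht⟩, hdb⟩ := h
    rw [sum_eq_single t]
    · rw [if_pos (by omega)]
      congr 2
      omega
    · intro j _ hj; rw [if_neg (by omega)]
    · intro hn; simp only [mem_range] at hn; omega
  · refine sum_eq_zero fun j hj => if_neg fun hj' => h ⟨⟨j, by omega⟩, ?_⟩
    simp only [mem_range] at hj
    omega

lemma signedIntegral_of_even (hϖ : Irreducible ϖ) (h2 : (2 : ResidueField O) ≠ 0)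
    (hT : ∀ j, IsResidueSystem (ϖ ^ j) (T j)) (hd : d₁ ≤ d₂) {b : ℕ}
    (hb : 2 * b < d₁ + d₂) (heven : Even d₁) (hdb : d₁ ≤ 2 * b) :
    signedIntegral ϖ v₁ v₂ T d₁ d₂ b = quadraticChar (ResidueField O) (residue O v₁) *
      (if 2 * b < d₂ then (Nat.card (ResidueField O) : ℤ) ^ (d₁ / 2)
      else if Even d₂ then 0
      else (Nat.card (ResidueField O) : ℤ) ^ ((d₁ + d₂ - 1) / 2 - b)) := by
  rw [signedIntegral, sum_congr rfl fun j hj => signedSum_of_even hϖ h2 hT hd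
    (Nat.lt_succ_iff.1 (mem_range.1 hj)) hb heven hdb, ← mul_sum]
  congr 1
  obtain ⟨e, he⟩ := heven
  set f : ℤ := (Nat.card (ResidueField O) : ℤ)
  set m := b - d₁ / 2 with hm
  -- the terms with `2 j < d₂` telescope; there is at most one other nonzero term, `2 j = d₂`
  have hsplit : ∀ j ∈ range (b + 1), (if j = m then 1 else if m < j ∧ 2 * j < d₂ then
        (f - 1) * f ^ (j - m - 1) else if 2 * j = d₂ then -f ^ (j - m - 1) else 0) =
      (if 2 * j < d₂ then (if j = m then 1 else if m < j then (f - 1) * f ^ (j - m - 1) else 0)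
        else 0) + if 2 * j = d₂ then -f ^ (j - m - 1) else 0 := by
    intro j hj
    by_cases h1 : j = m
    · rw [if_pos h1, if_pos (by omega), if_pos h1, if_neg (by omega), add_zero]
    · by_cases h2 : 2 * j < d₂
      · simp [h1, h2, h2.ne]
      · simp [h1, h2]
  rw [sum_congr rfl hsplit, sum_add_distrib, ← sum_filter]
  have hr : (range (b + 1)).filter (fun j => 2 * j < d₂) = range (min (b + 1) ((d₂ + 1) / 2)) := by
    ext j; simp only [mem_filter, mem_range]; omega
  rw [hr, sum_range_geometric_step, if_pos (by omega)]
  by_cases h1 : 2 * b < d₂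
  · rw [if_pos h1, sum_eq_zero, add_zero]
    · congr 1; omega
    · intro j hj; simp only [mem_range] at hj; rw [if_neg (by omega)]
  · rw [if_neg h1]
    by_cases h2 : Even d₂
    · obtain ⟨t, ht⟩ := h2
      rw [if_pos ⟨t, ht⟩, sum_eq_single t, if_pos (by omega)]
      · rw [show min (b + 1) ((d₂ + 1) / 2) - 1 - m = t - m - 1 by omega]; ring
      · intro j _ hj; rw [if_neg (by omega)]
      · intro hn; simp only [mem_range] at hn; omega
    · rw [if_neg h2, sum_eq_zero, add_zero]
      · congr 1
        rw [Nat.not_even_iff_odd] at h2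
        obtain ⟨t, ht⟩ := h2
        omega
      · intro j _
        exact if_neg fun hj => h2 ⟨j, by omega⟩

end Signed

end Counting

/-! ### Existence of the Gross-Keating invariant -/

section GrossKeatingExistence

open IsLocalRing

variable {O F V : Type*} [CommRing O] [IsDomain O] [IsDiscreteValuationRing O]
  [Field F] [Algebra O F] [IsFractionRing O F]
  [AddCommGroup V] [Module O V] [Module F V] [IsScalarTower O F V] {ϖ : O}

lemma ordGE_iff (hϖ : Irreducible ϖ) (k : ℕ) (x : F) :
    OrdGE O k x ↔ ∃ c, algebraMap O F (ϖ ^ k * c) = x := by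
  rw [OrdGE, hϖ.maximalIdeal_eq, Ideal.span_singleton_pow]
  simp only [Ideal.mem_span_singleton]
  exact ⟨fun ⟨_, ⟨c, hc⟩, h⟩ => ⟨c, hc ▸ h⟩, fun ⟨c, h⟩ => ⟨_, ⟨c, rfl⟩, h⟩⟩

lemma exists_of_ordGE_sq (hϖ : Irreducible ϖ) {k l : ℕ} (hl : 2 * l ≤ k) {x : F}
    (h : OrdGE O k (x ^ 2)) : ∃ r, ϖ ^ l ∣ r ∧ algebraMap O F r = x := by
  obtain ⟨c, hc⟩ := (ordGE_iff hϖ k _).1 h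
  obtain ⟨r, rfl⟩ := IsIntegrallyClosed.exists_algebraMap_eq_of_isIntegral_pow (R := O)
    (x := x) (n := 2) (by norm_num) (hc ▸ isIntegral_algebraMap)
  refine ⟨r, pow_dvd_of_pow_dvd_sq hϖ (a := k) (by omega) ?_, rfl⟩
  exact ⟨c, IsFractionRing.injective O F (by rw [map_pow, hc])⟩

lemma act_one {n : ℕ} (B : Matrix (Fin n) (Fin n) F) : act O B 1 = B := by
  simp [act]

lemma det_act {n : ℕ} (B : Matrix (Fin n) (Fin n) F) (U : GL (Fin n) O) :
    (act O B U).det = algebraMap O F (U : Matrix (Fin n) (Fin n) O).det ^ 2 * B.det := by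
  rw [act, Matrix.det_mul, Matrix.det_mul, Matrix.det_transpose]
  have : ((U : Matrix (Fin n) (Fin n) O).map (algebraMap O F)).det =
      algebraMap O F (U : Matrix (Fin n) (Fin n) O).det := by
    rw [RingHom.map_det]; rfl
  rw [this]; ring

lemma isSymm_act {n : ℕ} {B : Matrix (Fin n) (Fin n) F} (hB : B.IsSymm) (U : GL (Fin n) O) :
    (act O B U).IsSymm := by
  rw [Matrix.IsSymm, act]
  simp [Matrix.transpose_mul, hB.eq, Matrix.mul_assoc]

/-- If `a ∈ S(B)`, then the `i`-th row of `2 B` is divisible by `ϖ ^ ⌊a_i / 2⌋`, hence so is its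
determinant. -/
lemma exists_det_of_mem_gkSet (hϖ : Irreducible ϖ) {n : ℕ} {B : Matrix (Fin n) (Fin n) F}
    (hB : B.IsSymm) {a : Fin n → ℕ} (ha : a ∈ gkSet O B) :
    ∃ r : O, algebraMap O F r = ((2 : F) • B).det ∧ ∀ i, ϖ ^ (a i / 2) ∣ r := by
  have h : ∀ i j, ∃ r, ϖ ^ (a i / 2) ∣ r ∧ algebraMap O F r = 2 * B i j := by
    intro i j
    rcases le_total i j with hij | hij
    · exact exists_of_ordGE_sq hϖ (by omega) (ha.2.2 i j hij)
    · have := ha.2.2 j i hij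
      rw [hB.apply] at this
      exact exists_of_ordGE_sq hϖ (by omega) this
  choose R hR hR' using h
  refine ⟨(Matrix.of R).det, ?_, fun i => ?_⟩
  · rw [RingHom.map_det]
    congr 1
    ext i j
    simp [hR']
  · rw [Matrix.det_apply]
    refine Finset.dvd_sum fun σ _ => ?_
    rw [Units.smul_def, zsmul_eq_mul]
    refine Dvd.dvd.mul_left ?_ _
    refine dvd_trans ?_ (Finset.dvd_prod_of_mem _ (Finset.mem_univ (σ⁻¹ i)))
    simpa using hR i _

lemma isSymm_gram {ι : Type*} (Q : QuadraticForm F V) (x : ι → V) : (gram Q x).IsSymm := by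
  ext i j
  simp [gram, QuadraticMap.polar_comm]

lemma gram_apply_self (h2 : (2 : F) ≠ 0) {ι : Type*} (Q : QuadraticForm F V) (x : ι → V) (i : ι) :
    gram Q x i i = Q (x i) := by
  simp [gram, QuadraticMap.polar_self, h2]

/-- An integral nondegenerate quadratic lattice has a Gross-Keating invariant. -/
lemma exists_latticeGK (hϖ : Irreducible ϖ) (h2 : (2 : F) ≠ 0) (Q : QuadraticForm F V)
    (M : Submodule O V) {n : ℕ} (e : Module.Basis (Fin n) O M)
    (hint : ∀ x ∈ M, ∃ c, algebraMap O F c = Q x)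
    (hdet : (gram Q (fun i => (e i : V))).det ≠ 0) : ∃ g : Fin n → ℕ, LatticeGK Q M g := by
  set B := gram Q (fun i => (e i : V)) with hBdef
  have hB : B.IsSymm := isSymm_gram _ _
  have hzero : (0 : Fin n → ℕ) ∈ gkSet O B := by
    refine ⟨monotone_const, fun i => ?_, fun i j _ => ?_⟩
    · obtain ⟨c, hc⟩ := hint _ (e i).2
      exact ⟨c, by simp, by rw [hc, hBdef, gram_apply_self h2]⟩
    · obtain ⟨c₁, hc₁⟩ := hint _ (e i).2
      obtain ⟨c₂, hc₂⟩ := hint _ (e j).2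
      obtain ⟨c₃, hc₃⟩ := hint _ (e i + e j).2
      refine ⟨(c₃ - c₁ - c₂) ^ 2, by simp, ?_⟩
      simp only [map_pow, map_sub, hc₁, hc₂, hc₃, hBdef, gram, Matrix.of_apply,
        QuadraticMap.polar, Submodule.coe_add]
      field_simp
  obtain ⟨D, hD, -⟩ := exists_det_of_mem_gkSet hϖ hB hzero
  have hD0 : D ≠ 0 := by
    rintro rfl
    rw [map_zero, Matrix.det_smul] at hD
    exact mul_ne_zero (pow_ne_zero _ h2) hdet hD.symm
  obtain ⟨N, w, rfl⟩ := IsDiscreteValuationRing.eq_unit_mul_pow_irreducible hD0 hϖ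
  set G : Set (Lex (Fin n → ℕ)) := {c | ∃ U : GL (Fin n) O, ofLex c ∈ gkSet O (act O B U)}
  have hfin : G.Finite := by
    refine ((Set.finite_Iic (fun _ : Fin n => 2 * N + 1)).image toLex).subset ?_
    rintro c ⟨U, hU⟩
    refine ⟨ofLex c, fun i => ?_, rfl⟩
    obtain ⟨r, hr, hdvd⟩ := exists_det_of_mem_gkSet hϖ (isSymm_act hB U) hU
    rw [Matrix.det_smul, det_act, mul_left_comm, ← Matrix.det_smul, ← hD, ← map_pow,
      ← map_mul] at hr
    have hr' := IsFractionRing.injective O F hr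
    obtain ⟨d, hd⟩ := (Matrix.isUnit_iff_isUnit_det _).1 U.isUnit
    have h3 := hdvd i
    rw [hr', ← hd, ← mul_assoc, ← Units.val_pow_eq_pow_val, ← Units.val_mul,
      pow_dvd_unit_mul_pow_iff hϖ] at h3
    have : ofLex c i ≤ 2 * N + 1 := by omega
    exact this
  obtain ⟨g, hg, hmax⟩ := Set.exists_max_image G id hfin
    ⟨toLex 0, 1, by rw [act_one]; exact hzero⟩
  exact ⟨ofLex g, e, hg, fun c hc => hmax c hc⟩

lemma det_gram_ne_zero (h2 : (2 : F) ≠ 0) {ι : Type*} [Fintype ι] [DecidableEq ι]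
    (Q : QuadraticForm F V) (e : Module.Basis ι F V)
    (hnd : ∀ x, (∀ z, QuadraticMap.polar Q z x = 0) → x = 0) : (gram Q e).det ≠ 0 := by
  intro h0
  obtain ⟨v, hv, hv0⟩ := Matrix.exists_mulVec_eq_zero_iff.2 h0
  refine hv ?_
  have hx : ∑ j, v j • e j = 0 := by
    refine hnd _ fun z => ?_
    have h1 : ∀ i, Q.polarBilin (e i) (∑ j, v j • e j) = 0 := by
      intro i
      have := congrFun hv0 i
      simp only [Matrix.mulVec, dotProduct, gram, Matrix.of_apply, Pi.zero_apply] at this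
      simp only [map_sum, map_smul, QuadraticMap.polarBilin_apply_apply, smul_eq_mul]
      have h3 : ∑ j, v j * QuadraticMap.polar Q (e i) (e j) =
          2 * ∑ j, QuadraticMap.polar Q (e i) (e j) / 2 * v j := by
        rw [Finset.mul_sum]
        exact Finset.sum_congr rfl fun j _ => by field_simp
      rw [h3, this, mul_zero]
    have h3 : Q.polarBilin.flip (∑ j, v j • e j) = 0 := e.ext fun i => h1 i
    exact LinearMap.congr_fun h3 z
  funext i
  exact (Fintype.linearIndependent_iff.1 e.linearIndependent) v hx i

end GrossKeatingExistence

/-! ### Parametrization of the overlattices -/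

section Overlattices

open IsLocalRing

variable {O F V : Type*} [CommRing O] [IsDomain O] [IsDiscreteValuationRing O]
  [Field F] [Algebra O F] [IsFractionRing O F]
  [AddCommGroup V] [Module O V] [Module F V] [IsScalarTower O F V] {ϖ : O}

lemma algebraMap_pow_ne_zero (hϖ : Irreducible ϖ) (k : ℕ) : algebraMap O F ϖ ^ k ≠ 0 :=
  pow_ne_zero _ (by simpa using hϖ.ne_zero)

variable {ι : Type*} [Fintype ι] (E : Module.Basis (ι ⊕ Fin 2) F V)

/-- The coordinate change `(x, x₀, x₁) ↦ (x, ϖ^i x₀ - s x₁, ϖ^j x₁)`. -/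
noncomputable def coordChange (ι : Type*) (F : Type*) [Field F] [Algebra O F] [IsFractionRing O F]
    (hϖ : Irreducible ϖ) (i j : ℕ) (s : O) :
    (ι ⊕ Fin 2 → F) ≃ₗ[F] (ι ⊕ Fin 2 → F) where
  toFun x := Sum.elim (fun k => x (.inl k))
    ![algebraMap O F ϖ ^ i * x (.inr 0) - algebraMap O F s * x (.inr 1),
      algebraMap O F ϖ ^ j * x (.inr 1)]
  map_add' x y := by
    ext (k | k)
    · simp
    · fin_cases k <;> simp <;> ring
  map_smul' r x := by
    ext (k | k)
    · simp
    · fin_cases k <;> simp <;> ring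
  invFun y := Sum.elim (fun k => y (.inl k))
    ![(y (.inr 0) + algebraMap O F s * (y (.inr 1) / algebraMap O F ϖ ^ j)) /
        algebraMap O F ϖ ^ i, y (.inr 1) / algebraMap O F ϖ ^ j]
  left_inv x := by
    have h1 := algebraMap_pow_ne_zero (F := F) hϖ i
    have h2 := algebraMap_pow_ne_zero (F := F) hϖ j
    ext (k | k)
    · simp
    · fin_cases k <;> (simp; field_simp; try ring)
  right_inv x := by
    have h1 := algebraMap_pow_ne_zero (F := F) hϖ i
    have h2 := algebraMap_pow_ne_zero (F := F) hϖ j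
    ext (k | k)
    · simp
    · fin_cases k <;> (simp; field_simp; try ring)

/-- The basis obtained from `E` by replacing its last two vectors `x₀`, `x₁` by `ϖ^(-i) x₀` and
`ϖ^(-j) (x₁ + s ϖ^(-i) x₀)`. -/
noncomputable def overBasis (hϖ : Irreducible ϖ) (i j : ℕ) (s : O) :
    Module.Basis (ι ⊕ Fin 2) F V :=
  Module.Basis.ofEquivFun (E.equivFun.trans (coordChange ι F hϖ i j s))

/-- The `O`-lattice spanned by `overBasis E hϖ i j s`. -/
noncomputable def overLattice (hϖ : Irreducible ϖ) (i j : ℕ) (s : O) : Submodule O V :=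
  Submodule.span O (Set.range (overBasis E hϖ i j s))

lemma overBasis_repr_inl (hϖ : Irreducible ϖ) (i j : ℕ) (s : O) (x : V) (k : ι) :
    (overBasis E hϖ i j s).repr x (.inl k) = E.repr x (.inl k) := rfl

lemma overBasis_repr_zero (hϖ : Irreducible ϖ) (i j : ℕ) (s : O) (x : V) :
    (overBasis E hϖ i j s).repr x (.inr 0) =
      algebraMap O F ϖ ^ i * E.repr x (.inr 0) - algebraMap O F s * E.repr x (.inr 1) := rfl

lemma overBasis_repr_one (hϖ : Irreducible ϖ) (i j : ℕ) (s : O) (x : V) :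
    (overBasis E hϖ i j s).repr x (.inr 1) = algebraMap O F ϖ ^ j * E.repr x (.inr 1) := rfl

lemma mem_overLattice (hϖ : Irreducible ϖ) (i j : ℕ) (s : O) (x : V) :
    x ∈ overLattice E hϖ i j s ↔ (∀ k, E.repr x (.inl k) ∈ (algebraMap O F).range) ∧
      algebraMap O F ϖ ^ i * E.repr x (.inr 0) - algebraMap O F s * E.repr x (.inr 1) ∈
        (algebraMap O F).range ∧
      algebraMap O F ϖ ^ j * E.repr x (.inr 1) ∈ (algebraMap O F).range := by
  rw [overLattice, Module.Basis.mem_span_iff_repr_mem, Sum.forall, Fin.forall_fin_two,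
    overBasis_repr_zero, overBasis_repr_one]
  rfl

lemma mem_span_basis (x : V) : x ∈ Submodule.span O (Set.range E) ↔
    ∀ k, E.repr x k ∈ (algebraMap O F).range := by
  rw [Module.Basis.mem_span_iff_repr_mem]; rfl

lemma algebraMap_mem_range (c : O) : algebraMap O F c ∈ (algebraMap O F).range := ⟨c, rfl⟩

lemma algebraMap_pow_mem_range (c : O) (k : ℕ) : algebraMap O F c ^ k ∈ (algebraMap O F).range :=
  pow_mem (algebraMap_mem_range c) k

lemma span_le_overLattice (hϖ : Irreducible ϖ) (i j : ℕ) (s : O) :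
    Submodule.span O (Set.range E) ≤ overLattice E hϖ i j s := by
  intro x hx
  rw [mem_span_basis] at hx
  rw [mem_overLattice]
  exact ⟨fun k => hx _, sub_mem (mul_mem (algebraMap_pow_mem_range _ _) (hx _))
    (mul_mem (algebraMap_mem_range _) (hx _)), mul_mem (algebraMap_pow_mem_range _ _) (hx _)⟩

lemma isLattice_overLattice (hϖ : Irreducible ϖ) (i j : ℕ) (s : O) :
    (overLattice E hϖ i j s).IsLattice F where
  fg := Submodule.fg_span (Set.finite_range _)
  span_eq_top := by
    rw [overLattice, Submodule.span_span_of_tower]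
    exact (overBasis E hϖ i j s).span_eq

lemma overLattice_congr (hϖ : Irreducible ϖ) (i j : ℕ) {s t : O} (h : ϖ ^ j ∣ s - t) :
    overLattice E hϖ i j s = overLattice E hϖ i j t := by
  obtain ⟨r, hr⟩ := h
  ext x
  rw [mem_overLattice, mem_overLattice]
  refine and_congr_right fun _ => and_congr_left fun hj => ?_
  have h1 : algebraMap O F s - algebraMap O F t = algebraMap O F ϖ ^ j * algebraMap O F r := by
    rw [← map_sub, hr, map_mul, map_pow]
  have h2 : algebraMap O F r * (algebraMap O F ϖ ^ j * E.repr x (.inr 1)) ∈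
      (algebraMap O F).range := mul_mem (algebraMap_mem_range _) hj
  constructor <;> intro h
  · convert add_mem h h2 using 1
    linear_combination E.repr x (.inr 1) * h1
  · convert sub_mem h h2 using 1
    linear_combination (-E.repr x (.inr 1)) * h1

lemma overBasis_mem (hϖ : Irreducible ϖ) (i j : ℕ) (s : O) (k : ι ⊕ Fin 2) :
    overBasis E hϖ i j s k ∈ overLattice E hϖ i j s :=
  Submodule.subset_span ⟨k, rfl⟩

lemma repr_overBasis_zero (hϖ : Irreducible ϖ) (i j : ℕ) (s : O) :
    E.repr (overBasis E hϖ i j s (.inr 0)) (.inr 0) = (algebraMap O F ϖ ^ i)⁻¹ ∧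
    E.repr (overBasis E hϖ i j s (.inr 0)) (.inr 1) = 0 := by
  have h1 := algebraMap_pow_ne_zero (F := F) hϖ i
  have h2 := algebraMap_pow_ne_zero (F := F) hϖ j
  have e0 := overBasis_repr_zero E hϖ i j s (overBasis E hϖ i j s (.inr 0))
  have e1 := overBasis_repr_one E hϖ i j s (overBasis E hϖ i j s (.inr 0))
  rw [Module.Basis.repr_self] at e0 e1
  simp only [Finsupp.single_eq_same, ne_eq, Sum.inr.injEq, one_ne_zero, not_false_eq_true,
    Finsupp.single_eq_of_ne] at e0 e1
  have h3 : E.repr (overBasis E hϖ i j s (.inr 0)) (.inr 1) = 0 := by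
    rcases mul_eq_zero.1 e1.symm with h | h
    · exact absurd h h2
    · exact h
  rw [h3, mul_zero, sub_zero] at e0
  exact ⟨eq_inv_of_mul_eq_one_right e0.symm, h3⟩

lemma repr_overBasis_one (hϖ : Irreducible ϖ) (i j : ℕ) (s : O) :
    E.repr (overBasis E hϖ i j s (.inr 1)) (.inr 0) =
      algebraMap O F s / (algebraMap O F ϖ ^ i * algebraMap O F ϖ ^ j) ∧
    E.repr (overBasis E hϖ i j s (.inr 1)) (.inr 1) = (algebraMap O F ϖ ^ j)⁻¹ := by
  have h1 := algebraMap_pow_ne_zero (F := F) hϖ i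
  have h2 := algebraMap_pow_ne_zero (F := F) hϖ j
  have e0 := overBasis_repr_zero E hϖ i j s (overBasis E hϖ i j s (.inr 1))
  have e1 := overBasis_repr_one E hϖ i j s (overBasis E hϖ i j s (.inr 1))
  rw [Module.Basis.repr_self] at e0 e1
  simp only [Finsupp.single_eq_same, ne_eq, Sum.inr.injEq, zero_ne_one, not_false_eq_true,
    Finsupp.single_eq_of_ne] at e0 e1
  have h3 := eq_inv_of_mul_eq_one_right e1.symm
  refine ⟨?_, h3⟩
  rw [h3] at e0
  field_simp
  field_simp at e0
  linear_combination -e0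

lemma dvd_of_mul_inv_mem_range (hϖ : Irreducible ϖ) {i : ℕ} {a : O}
    (h : algebraMap O F a * (algebraMap O F ϖ ^ i)⁻¹ ∈ (algebraMap O F).range) : ϖ ^ i ∣ a := by
  obtain ⟨c, hc⟩ := h
  have h1 := algebraMap_pow_ne_zero (F := F) hϖ i
  rw [eq_mul_inv_iff_mul_eq₀ h1, ← map_pow, ← map_mul] at hc
  exact ⟨c, by rw [← IsFractionRing.injective O F hc, mul_comm]⟩

lemma overLattice_le (hϖ : Irreducible ϖ) {i j i' j' : ℕ} {s s' : O}
    (h : overLattice E hϖ i j s ≤ overLattice E hϖ i' j' s') : i ≤ i' ∧ j ≤ j' := by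
  constructor
  · have h1 := ((mem_overLattice E hϖ i' j' s' _).1 (h (overBasis_mem E hϖ i j s (.inr 0)))).2.1
    rw [(repr_overBasis_zero E hϖ i j s).1, (repr_overBasis_zero E hϖ i j s).2, mul_zero, sub_zero,
      ← map_pow] at h1
    have := dvd_of_mul_inv_mem_range hϖ h1
    rwa [pow_dvd_pow_iff hϖ.ne_zero hϖ.not_isUnit] at this
  · have h1 := ((mem_overLattice E hϖ i' j' s' _).1 (h (overBasis_mem E hϖ i j s (.inr 1)))).2.2
    rw [(repr_overBasis_one E hϖ i j s).2, ← map_pow] at h1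
    have := dvd_of_mul_inv_mem_range hϖ h1
    rwa [pow_dvd_pow_iff hϖ.ne_zero hϖ.not_isUnit] at this

lemma overLattice_injective (hϖ : Irreducible ϖ) {i j i' j' : ℕ} {s s' : O}
    (h : overLattice E hϖ i j s = overLattice E hϖ i' j' s') : i = i' ∧ j = j' ∧ ϖ ^ j ∣ s - s' := by
  obtain ⟨h1, h2⟩ := overLattice_le E hϖ h.le
  obtain ⟨h3, h4⟩ := overLattice_le E hϖ h.ge
  obtain rfl := h1.antisymm h3
  obtain rfl := h2.antisymm h4
  refine ⟨rfl, rfl, ?_⟩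
  have h5 := ((mem_overLattice E hϖ i j s' _).1 (h ▸ overBasis_mem E hϖ i j s (.inr 1))).2.1
  rw [(repr_overBasis_one E hϖ i j s).1, (repr_overBasis_one E hϖ i j s).2] at h5
  refine dvd_of_mul_inv_mem_range (F := F) hϖ ?_
  convert h5 using 1
  have h1 := algebraMap_pow_ne_zero (F := F) hϖ i
  have h2 := algebraMap_pow_ne_zero (F := F) hϖ j
  rw [map_sub]
  field_simp

/-- The values of a linear form on a submodule, if bounded and containing `1`, form a fractional
ideal generated by some `ϖ ^ (-j)`. -/
lemma exists_exponent (hϖ : Irreducible ϖ) (N : Submodule O V) (l : V →ₗ[F] F)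
    (hd : ∃ d, ∀ z ∈ N, algebraMap O F ϖ ^ d * l z ∈ (algebraMap O F).range)
    (h1 : ∃ z ∈ N, l z = 1) :
    ∃ j, (∀ z ∈ N, algebraMap O F ϖ ^ j * l z ∈ (algebraMap O F).range) ∧
      ∃ z ∈ N, algebraMap O F ϖ ^ j * l z = 1 := by
  classical
  refine ⟨Nat.find hd, Nat.find_spec hd, ?_⟩
  rcases Nat.eq_zero_or_pos (Nat.find hd) with h0 | hpos
  · obtain ⟨z, hz, hlz⟩ := h1
    exact ⟨z, hz, by rw [h0, hlz]; simp⟩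
  · have hmin := Nat.find_min hd (Nat.sub_lt hpos one_pos)
    push Not at hmin
    obtain ⟨z, hz, hlz⟩ := hmin
    obtain ⟨c, hc⟩ := Nat.find_spec hd z hz
    have hc' : IsUnit c := by
      by_contra hcu
      obtain ⟨r, rfl⟩ : ϖ ∣ c := by
        rw [← Ideal.mem_span_singleton, ← hϖ.maximalIdeal_eq]; exact hcu
      refine hlz ⟨r, ?_⟩
      have hpi : algebraMap O F ϖ ≠ 0 := by simpa using hϖ.ne_zero
      apply mul_left_cancel₀ hpi
      rw [← map_mul, hc, ← mul_assoc, ← pow_succ',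
        Nat.sub_add_cancel (show 1 ≤ Nat.find hd from hpos)]
    obtain ⟨c, rfl⟩ := hc'
    refine ⟨((c⁻¹ : Oˣ) : O) • z, N.smul_mem _ hz, ?_⟩
    rw [← algebraMap_smul F, map_smul, smul_eq_mul, mul_left_comm, ← hc, ← map_mul]
    simp

variable {Q : QuadraticForm F V} {u : ι → Oˣ} {v₁ v₂ : Oˣ} {d₁ d₂ : ℕ}

/-- `Q` is diagonal in the basis `E`, with coefficients `u`, `ϖ^d₁ v₁` and `ϖ^d₂ v₂`. -/
def IsDiagonalIn (E : Module.Basis (ι ⊕ Fin 2) F V) (Q : QuadraticForm F V) (ϖ : O) (u : ι → Oˣ)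
    (v₁ v₂ : Oˣ) (d₁ d₂ : ℕ) : Prop :=
  ∀ x, Q x = ∑ k, algebraMap O F (u k) * E.repr x (.inl k) ^ 2 +
    algebraMap O F (ϖ ^ d₁ * v₁) * E.repr x (.inr 0) ^ 2 +
    algebraMap O F (ϖ ^ d₂ * v₂) * E.repr x (.inr 1) ^ 2

lemma IsDiagonalIn.polar (hQ : IsDiagonalIn E Q ϖ u v₁ v₂ d₁ d₂) (x y : V) :
    QuadraticMap.polar Q x y =
      2 * (∑ k, algebraMap O F (u k) * (E.repr x (.inl k) * E.repr y (.inl k)) +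
      algebraMap O F (ϖ ^ d₁ * v₁) * (E.repr x (.inr 0) * E.repr y (.inr 0)) +
      algebraMap O F (ϖ ^ d₂ * v₂) * (E.repr x (.inr 1) * E.repr y (.inr 1))) := by
  rw [QuadraticMap.polar, hQ, hQ, hQ]
  have h : ∑ k, algebraMap O F (u k) * E.repr (x + y) (.inl k) ^ 2 =
      ∑ k, algebraMap O F (u k) * E.repr x (.inl k) ^ 2 +
      ∑ k, algebraMap O F (u k) * E.repr y (.inl k) ^ 2 +
      2 * ∑ k, algebraMap O F (u k) * (E.repr x (.inl k) * E.repr y (.inl k)) := by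
    rw [Finset.mul_sum, ← Finset.sum_add_distrib, ← Finset.sum_add_distrib]
    refine Finset.sum_congr rfl fun k _ => ?_
    simp only [map_add, Finsupp.add_apply]
    ring
  rw [h]
  simp only [map_add, Finsupp.add_apply]
  ring

lemma polar_mem_range {M : Submodule O V} (hint : ∀ x ∈ M, ∃ c, algebraMap O F c = Q x) {x y : V}
    (hx : x ∈ M) (hy : y ∈ M) : QuadraticMap.polar Q x y ∈ (algebraMap O F).range :=
  sub_mem (sub_mem (hint _ (M.add_mem hx hy)) (hint _ hx)) (hint _ hy)

lemma mem_range_of_unit_mul {c : F} (w : Oˣ) (h : algebraMap O F w * c ∈ (algebraMap O F).range) :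
    c ∈ (algebraMap O F).range := by
  have := mul_mem (algebraMap_mem_range ((w⁻¹ : Oˣ) : O)) h
  rw [← mul_assoc, ← map_mul] at this
  simpa using this

lemma mem_range_of_two_mul (h2 : (2 : ResidueField O) ≠ 0) {c : F} (w : Oˣ)
    (h : 2 * (algebraMap O F w * c) ∈ (algebraMap O F).range) : c ∈ (algebraMap O F).range := by
  refine mem_range_of_unit_mul w (mem_range_of_unit_mul (isUnit_two h2).unit ?_)
  rw [IsUnit.unit_spec, map_ofNat]
  exact h

/-- Every integral overlattice of the span of `E` is one of the lattices `overLattice`. -/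
lemma exists_eq_overLattice (h2 : (2 : ResidueField O) ≠ 0) (hϖ : Irreducible ϖ)
    (hQ : IsDiagonalIn E Q ϖ u v₁ v₂ d₁ d₂) {M : Submodule O V}
    (hLM : Submodule.span O (Set.range E) ≤ M) (hint : ∀ x ∈ M, ∃ c, algebraMap O F c = Q x) :
    ∃ i j s, M = overLattice E hϖ i j s := by
  classical
  have hE : ∀ k, E k ∈ M := fun k => hLM (Submodule.subset_span ⟨k, rfl⟩)
  have hinl : ∀ z ∈ M, ∀ k, E.repr z (.inl k) ∈ (algebraMap O F).range := by
    intro z hz k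
    have := polar_mem_range hint hz (hE (.inl k))
    rw [hQ.polar, Finset.sum_eq_single k] at this
    · refine mem_range_of_two_mul h2 (u k) ?_
      simpa using this
    · intro l _ hl; simp [hl]
    · simp
  have hpi : algebraMap O F ϖ ≠ 0 := by simpa using hϖ.ne_zero
  have hb : ∀ z ∈ M, algebraMap O F ϖ ^ d₁ * E.repr z (.inr 0) ∈ (algebraMap O F).range ∧
      algebraMap O F ϖ ^ d₂ * E.repr z (.inr 1) ∈ (algebraMap O F).range := by
    intro z hz
    have h0 := polar_mem_range hint hz (hE (.inr 0))
    have h1 := polar_mem_range hint hz (hE (.inr 1))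
    rw [hQ.polar] at h0 h1
    constructor
    · refine mem_range_of_two_mul h2 v₁ ?_
      convert h0 using 2
      simp
      ring
    · refine mem_range_of_two_mul h2 v₂ ?_
      convert h1 using 2
      simp
      ring
  obtain ⟨j, hj, z₂, hz₂, hz₂'⟩ := exists_exponent hϖ M (E.coord (.inr 1))
    ⟨d₂, fun z hz => (hb z hz).2⟩ ⟨E (.inr 1), hE _, by simp⟩
  obtain ⟨i, hi, z₁, ⟨hz₁, hz₁0⟩, hz₁'⟩ := exists_exponent hϖ
    (M ⊓ (LinearMap.ker (E.coord (.inr 1))).restrictScalars O) (E.coord (.inr 0))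
    ⟨d₁, fun z hz => (hb z hz.1).1⟩ ⟨E (.inr 0), ⟨hE _, by simp⟩, by simp⟩
  have hi' : ∀ z ∈ M, E.repr z (.inr 1) = 0 →
      algebraMap O F ϖ ^ i * E.repr z (.inr 0) ∈ (algebraMap O F).range :=
    fun z hz h0 => hi z ⟨hz, h0⟩
  have hz₁0 : E.repr z₁ (.inr 1) = 0 := hz₁0
  simp only [Module.Basis.coord_apply] at hj hz₂' hz₁'
  have hrs : ∀ (c : O) (z : V) k, E.repr (c • z) k = algebraMap O F c * E.repr z k := by
    intro c z k
    rw [← algebraMap_smul F, map_smul]; rfl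
  obtain ⟨s, hs⟩ : algebraMap O F ϖ ^ i * (algebraMap O F ϖ ^ j * E.repr z₂ (.inr 0)) ∈
      (algebraMap O F).range := by
    have := hi' (ϖ ^ j • z₂ - E (.inr 1)) (sub_mem (M.smul_mem _ hz₂) (hE _))
      (by rw [map_sub, Finsupp.sub_apply, hrs, map_pow, hz₂']; simp)
    rw [map_sub, Finsupp.sub_apply, hrs, map_pow] at this
    simpa using this
  have hi0 := algebraMap_pow_ne_zero (F := F) hϖ i
  have hj0 := algebraMap_pow_ne_zero (F := F) hϖ j
  refine ⟨i, j, s, le_antisymm (fun z hz => ?_) (fun x hx => ?_)⟩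
  · rw [mem_overLattice]
    refine ⟨hinl z hz, ?_, hj z hz⟩
    obtain ⟨c, hc⟩ := hj z hz
    have := hi' (z - c • z₂) (sub_mem hz (M.smul_mem _ hz₂)) (by
      rw [map_sub, Finsupp.sub_apply, hrs, hc]
      linear_combination -E.repr z (.inr 1) * hz₂')
    rw [map_sub, Finsupp.sub_apply, hrs] at this
    convert this using 1
    rw [hs, hc]
    ring
  · rw [mem_overLattice] at hx
    obtain ⟨h0, ⟨a, ha⟩, ⟨c, hc⟩⟩ := hx
    have hsub : x - c • z₂ - a • z₁ ∈ M := by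
      have hmem : ∀ k, E.repr (x - c • z₂ - a • z₁) (.inl k) ∈ (algebraMap O F).range := by
        intro k
        rw [map_sub, map_sub, Finsupp.sub_apply, Finsupp.sub_apply, hrs, hrs]
        exact sub_mem (sub_mem (h0 k) (mul_mem (algebraMap_mem_range _) (hinl _ hz₂ k)))
          (mul_mem (algebraMap_mem_range _) (hinl _ hz₁ k))
      refine hLM ((mem_span_basis E _).2 ?_)
      rw [Sum.forall, Fin.forall_fin_two]
      have h1 : E.repr (x - c • z₂ - a • z₁) (.inr 1) = 0 := by
        rw [map_sub, map_sub, Finsupp.sub_apply, Finsupp.sub_apply, hrs, hrs, hz₁0, hc]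
        linear_combination -E.repr x (.inr 1) * hz₂'
      have h2 : E.repr (x - c • z₂ - a • z₁) (.inr 0) = 0 := by
        rw [map_sub, map_sub, Finsupp.sub_apply, Finsupp.sub_apply, hrs, hrs, hc, ha, hs]
        apply mul_left_cancel₀ hi0
        linear_combination (-algebraMap O F ϖ ^ i * E.repr x (.inr 0) + algebraMap O F ϖ ^ i *
          algebraMap O F ϖ ^ j * E.repr z₂ (.inr 0) * E.repr x (.inr 1)) * hz₁'
      exact ⟨hmem, by rw [h2]; exact zero_mem _, by rw [h1]; exact zero_mem _⟩
    have := add_mem (add_mem hsub (M.smul_mem a hz₁)) (M.smul_mem c hz₂)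
    simpa using this

/-- The length of `overLattice E hϖ i j s` over the span of `E`. -/
lemma length_overLattice (hϖ : Irreducible ϖ) (i j : ℕ) (s : O) :
    Module.length O (overLattice E hϖ i j s ⧸
      (Submodule.span O (Set.range E)).submoduleOf (overLattice E hϖ i j s)) = (i + j : ℕ) := by
  set M := overLattice E hϖ i j s with hM
  set L := (Submodule.span O (Set.range E)).submoduleOf M with hL
  have hi0 := algebraMap_pow_ne_zero (F := F) hϖ i
  have hj0 := algebraMap_pow_ne_zero (F := F) hϖ j
  have hord : ∀ k, Module.length O (O ⧸ Ideal.span {ϖ ^ k}) = (k : ℕ) := by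
    intro k
    have := Ring.ord_pow (R := O) (mem_nonZeroDivisors_of_ne_zero hϖ.ne_zero) k
    rw [Ring.ord_of_irreducible hϖ, Ring.ord] at this
    simpa using this
  have hrs : ∀ (c : O) (z : V) k, E.repr (c • z) k = algebraMap O F c * E.repr z k := by
    intro c z k
    rw [← algebraMap_smul F, map_smul]; rfl
  have hmemL : ∀ x : M, x ∈ L ↔ ∀ k, E.repr (x : V) k ∈ (algebraMap O F).range := fun x => by
    rw [hL, Submodule.submoduleOf, Submodule.mem_comap, Submodule.subtype_apply, mem_span_basis]
  let B : Module.Basis (ι ⊕ Fin 2) O M := (overBasis E hϖ i j s).restrictScalars O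
  have hB : ∀ (x : M) k, algebraMap O F (B.repr x k) = (overBasis E hϖ i j s).repr x k :=
    fun x k => Module.Basis.restrictScalars_repr_apply O _ x k
  let z₁ : M := ⟨_, overBasis_mem E hϖ i j s (.inr 0)⟩
  have hz₁ : ∀ c : O, c • z₁ ∈ L ↔ ϖ ^ i ∣ c := by
    intro c
    rw [hmemL, Sum.forall, Fin.forall_fin_two]
    simp only [Submodule.coe_smul_of_tower, hrs, z₁, (repr_overBasis_zero E hϖ i j s).1,
      (repr_overBasis_zero E hϖ i j s).2]
    constructor
    · exact fun h => dvd_of_mul_inv_mem_range hϖ h.2.1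
    · rintro ⟨r, rfl⟩
      refine ⟨fun k => ?_, ⟨r, ?_⟩, by simp⟩
      · have : E.repr (overBasis E hϖ i j s (.inr 0)) (.inl k) = 0 := by
          rw [← overBasis_repr_inl E hϖ i j s, Module.Basis.repr_self]; simp
        rw [this, mul_zero]; exact zero_mem _
      · rw [map_mul, map_pow]; field_simp
  have hf : Ideal.span {ϖ ^ i} ≤ LinearMap.ker (L.mkQ ∘ₗ LinearMap.toSpanSingleton O M z₁) := by
    intro c hc
    rw [LinearMap.mem_ker, LinearMap.comp_apply, LinearMap.toSpanSingleton_apply,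
      Submodule.mkQ_apply, Submodule.Quotient.mk_eq_zero, hz₁]
    exact Ideal.mem_span_singleton.1 hc
  have hg : L ≤ LinearMap.ker ((Ideal.span {ϖ ^ j}).mkQ ∘ₗ B.coord (.inr 1)) := by
    intro x hx
    rw [LinearMap.mem_ker, LinearMap.comp_apply, Submodule.mkQ_apply,
      Submodule.Quotient.mk_eq_zero, Ideal.mem_span_singleton, Module.Basis.coord_apply]
    obtain ⟨c, hc⟩ := (hmemL x).1 hx (.inr 1)
    refine ⟨c, IsFractionRing.injective O F ?_⟩
    rw [hB, overBasis_repr_one, ← hc, map_mul, map_pow]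
  rw [Module.length_eq_add_of_exact ((Ideal.span {ϖ ^ i}).liftQ _ hf) (L.liftQ _ hg), hord, hord]
  · push_cast; rfl
  · rw [← LinearMap.ker_eq_bot, Submodule.ker_liftQ_eq_bot']
    refine le_antisymm hf fun c hc => ?_
    rw [LinearMap.mem_ker, LinearMap.comp_apply, LinearMap.toSpanSingleton_apply,
      Submodule.mkQ_apply, Submodule.Quotient.mk_eq_zero, hz₁] at hc
    exact Ideal.mem_span_singleton.2 hc
  · intro y
    obtain ⟨c, rfl⟩ := Submodule.mkQ_surjective _ y
    refine ⟨L.mkQ (c • B (.inr 1)), ?_⟩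
    rw [Submodule.mkQ_apply, Submodule.liftQ_apply, LinearMap.comp_apply, map_smul,
      Module.Basis.coord_apply, Module.Basis.repr_self, Finsupp.single_eq_same, smul_eq_mul, mul_one]
  · intro y
    obtain ⟨x, rfl⟩ := Submodule.mkQ_surjective _ y
    simp only [Submodule.mkQ_apply, Submodule.liftQ_apply, LinearMap.comp_apply,
      Submodule.Quotient.mk_eq_zero, Set.mem_range, Ideal.mem_span_singleton,
      Module.Basis.coord_apply]
    constructor
    · rintro ⟨r, hr⟩
      -- `x₁ = r` is integral, so `ϖ^i x₀` is integral as well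
      have h1 := hB x (.inr 1)
      have h0 := hB x (.inr 0)
      rw [hr, overBasis_repr_one, map_mul, map_pow] at h1
      have h1' := mul_left_cancel₀ hj0 h1
      rw [overBasis_repr_zero, ← h1'] at h0
      refine ⟨Submodule.Quotient.mk (B.repr x (.inr 0) + s * r), ?_⟩
      rw [Submodule.liftQ_apply, LinearMap.comp_apply, LinearMap.toSpanSingleton_apply,
        Submodule.mkQ_apply, Submodule.Quotient.eq, hmemL, Sum.forall, Fin.forall_fin_two]
      simp only [Submodule.coe_sub, Submodule.coe_smul_of_tower, map_sub, Finsupp.sub_apply, hrs,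
        z₁, (repr_overBasis_zero E hϖ i j s).1, (repr_overBasis_zero E hϖ i j s).2, map_add,
        map_mul, h0]
      refine ⟨fun k => ?_, ?_, ?_⟩
      · have : E.repr (overBasis E hϖ i j s (.inr 0)) (.inl k) = 0 := by
          rw [← overBasis_repr_inl E hϖ i j s, Module.Basis.repr_self]; simp
        rw [this, mul_zero, zero_sub]
        exact neg_mem (((mem_overLattice E hϖ i j s _).1 x.2).1 k)
      · convert (algebraMap O F).range.zero_mem using 1
        field_simp
        ring
      · rw [mul_zero, zero_sub, ← h1']
        exact neg_mem (algebraMap_mem_range r)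
    · rintro ⟨c, hc⟩
      obtain ⟨c, rfl⟩ := Submodule.mkQ_surjective _ c
      rw [Submodule.mkQ_apply, Submodule.liftQ_apply, LinearMap.comp_apply,
        LinearMap.toSpanSingleton_apply, Submodule.mkQ_apply, Submodule.Quotient.eq, hmemL] at hc
      have h1 := hc (.inr 1)
      simp only [Submodule.coe_sub, Submodule.coe_smul_of_tower, map_sub, Finsupp.sub_apply, hrs,
        z₁, (repr_overBasis_zero E hϖ i j s).2, mul_zero, zero_sub] at h1
      obtain ⟨r, hr⟩ := neg_mem h1
      refine ⟨r, IsFractionRing.injective O F ?_⟩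
      rw [hB, overBasis_repr_one, map_mul, map_pow, hr, neg_neg]

end Overlattices

/-! ### Reduction and types of the overlattices -/

section Reduction

open IsLocalRing

/-- A binary form over a field of odd characteristic is diagonalizable, with explicit coefficients
if it is degenerate. -/
lemma exists_diagonalization_binary {κ : Type*} [Field κ] (h2 : (2 : κ) ≠ 0) (A B C : κ) :
    ∃ α β γ δ w₀ w₁ : κ, α * δ - β * γ ≠ 0 ∧
      (∀ x y, w₀ * (α * x + β * y) ^ 2 + w₁ * (γ * x + δ * y) ^ 2 =
        A * x ^ 2 + 2 * B * x * y + C * y ^ 2) ∧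
      (A * C - B ^ 2 ≠ 0 → w₀ ≠ 0 ∧ w₁ ≠ 0) ∧
      (A * C - B ^ 2 = 0 → A ≠ 0 → w₀ = A ∧ w₁ = 0) ∧
      (A * C - B ^ 2 = 0 → A = 0 → w₀ = 0 ∧ w₁ = C) := by
  by_cases hA : A = 0
  · by_cases hC : C = 0
    · refine ⟨1, 1, 1, -1, B / 2, -(B / 2), ?_, ?_, ?_, fun _ h => absurd hA h, ?_⟩
      · intro h; apply h2; linear_combination -h
      · intro x y; rw [hA, hC]; field_simp; ring
      · intro h
        have hB : B ≠ 0 := by rintro rfl; apply h; rw [hA]; ring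
        exact ⟨div_ne_zero hB h2, neg_ne_zero.2 (div_ne_zero hB h2)⟩
      · intro h _
        have hB : B = 0 := by
          rw [hA, zero_mul, zero_sub, neg_eq_zero] at h; exact pow_eq_zero_iff (two_ne_zero) |>.1 h
        simp [hB, hC]
    · refine ⟨1, 0, B / C, 1, (A * C - B ^ 2) / C, C, by simp, ?_, ?_, fun _ h => absurd hA h, ?_⟩
      · intro x y; field_simp; ring
      · exact fun h => ⟨div_ne_zero h hC, hC⟩
      · intro h _; simp [h]
  · refine ⟨1, B / A, 0, 1, A, (A * C - B ^ 2) / A, by simp, ?_, ?_, ?_, fun _ h => absurd h hA⟩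
    · intro x y; field_simp; ring
    · exact fun h => ⟨hA, div_ne_zero h hA⟩
    · intro h _; simp [h]

variable {O F V : Type*} [CommRing O] [IsDomain O] [IsDiscreteValuationRing O]
  [Field F] [Algebra O F] [IsFractionRing O F]
  [AddCommGroup V] [Module O V] [Module F V] [IsScalarTower O F V] {ϖ : O}

variable {ι : Type*} [Fintype ι]

lemma exists_one_tmul {M : Type*} [AddCommGroup M] [Module O M] (z : ResidueField O ⊗[O] M) :
    ∃ x : M, (1 : ResidueField O) ⊗ₜ[O] x = z := by
  induction z with
  | zero => exact ⟨0, by simp⟩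
  | tmul a m =>
    obtain ⟨r, rfl⟩ := residue_surjective a
    refine ⟨r • m, ?_⟩
    rw [TensorProduct.tmul_smul, TensorProduct.smul_tmul', Algebra.smul_def, mul_one]
    rfl
  | add x y hx hy =>
    obtain ⟨a, rfl⟩ := hx
    obtain ⟨b, rfl⟩ := hy
    exact ⟨a + b, TensorProduct.tmul_add _ _ _⟩

/-- If `Q` is given on `M` by `∑ u_k x_k² + a x₀² + 2 b x₀ x₁ + c x₁²`, then the reduction of `M`
exists and is unique; it is diagonalized by diagonalizing the binary form over the residue field. -/
lemma exists_reduction (h2 : (2 : ResidueField O) ≠ 0) (Q : QuadraticForm F V) (M : Submodule O V)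
    (e : Module.Basis (ι ⊕ Fin 2) O M) (u : ι → O) (a b c : O)
    (hQ : ∀ x : M, Q (x : V) = algebraMap O F (∑ k, u k * e.repr x (.inl k) ^ 2 +
      (a * e.repr x (.inr 0) ^ 2 + 2 * b * e.repr x (.inr 0) * e.repr x (.inr 1) +
        c * e.repr x (.inr 1) ^ 2))) :
    ∃ w : ι ⊕ Fin 2 → ResidueField O, (∀ k, w (.inl k) = residue O (u k)) ∧
      (residue O (a * c - b ^ 2) ≠ 0 → w (.inr 0) ≠ 0 ∧ w (.inr 1) ≠ 0) ∧
      (residue O (a * c - b ^ 2) = 0 → residue O a ≠ 0 →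
        w (.inr 0) = residue O a ∧ w (.inr 1) = 0) ∧
      (residue O (a * c - b ^ 2) = 0 → residue O a = 0 →
        w (.inr 0) = 0 ∧ w (.inr 1) = residue O c) ∧
      (∃ q, IsReduction Q M q) ∧
      ∀ q, IsReduction Q M q →
        q.Equivalent (QuadraticMap.weightedSumSquares (ResidueField O) w) := by
  obtain ⟨α, β, γ, δ, w₀, w₁, hdet, hform, hp1, hp2, hp3⟩ :=
    exists_diagonalization_binary h2 (residue O a) (residue O b) (residue O c)
  let w : ι ⊕ Fin 2 → ResidueField O := Sum.elim (fun k => residue O (u k)) ![w₀, w₁]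
  let g₀ : (ι ⊕ Fin 2 → ResidueField O) →ₗ[ResidueField O] (ι ⊕ Fin 2 → ResidueField O) :=
    { toFun := fun y => Sum.elim (fun k => y (.inl k))
        ![α * y (.inr 0) + β * y (.inr 1), γ * y (.inr 0) + δ * y (.inr 1)]
      map_add' := fun x y => by
        ext (k | k)
        · simp
        · fin_cases k <;> simp <;> ring
      map_smul' := fun r x => by
        ext (k | k)
        · simp
        · fin_cases k <;> simp <;> ring }
  have hg₀ : Function.Injective g₀ := by
    rw [injective_iff_map_eq_zero]
    intro y hy
    have h0 : α * y (.inr 0) + β * y (.inr 1) = 0 := congrFun hy (.inr 0)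
    have h1 : γ * y (.inr 0) + δ * y (.inr 1) = 0 := congrFun hy (.inr 1)
    have e0 : y (.inr 0) = 0 := by
      apply (mul_eq_zero.1 (_ : (α * δ - β * γ) * y (.inr 0) = 0)).resolve_left hdet
      linear_combination δ * h0 - β * h1
    have e1 : y (.inr 1) = 0 := by
      apply (mul_eq_zero.1 (_ : (α * δ - β * γ) * y (.inr 1) = 0)).resolve_left hdet
      linear_combination α * h1 - γ * h0
    ext (k | k)
    · exact congrFun hy (.inl k)
    · fin_cases k
      · exact e0
      · exact e1
  let bκ := Algebra.TensorProduct.basis (ResidueField O) e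
  let g := bκ.equivFun.trans (LinearEquiv.ofInjectiveEndo g₀ hg₀)
  have hg : ∀ x : M, QuadraticMap.weightedSumSquares (ResidueField O) w (g (1 ⊗ₜ[O] x)) =
      residue O (∑ k, u k * e.repr x (.inl k) ^ 2 +
      (a * e.repr x (.inr 0) ^ 2 + 2 * b * e.repr x (.inr 0) * e.repr x (.inr 1) +
        c * e.repr x (.inr 1) ^ 2)) := by
    intro x
    have hr : ∀ k, bκ.equivFun (1 ⊗ₜ[O] x) k = residue O (e.repr x k) := by
      intro k
      rw [Module.Basis.equivFun_apply, Algebra.TensorProduct.basis_repr_tmul, one_smul]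
      rfl
    have hgl : ∀ k, g (1 ⊗ₜ[O] x) (.inl k) = residue O (e.repr x (.inl k)) := fun k => hr _
    have hg0 : g (1 ⊗ₜ[O] x) (.inr 0) = α * residue O (e.repr x (.inr 0)) +
        β * residue O (e.repr x (.inr 1)) := by rw [← hr, ← hr]; rfl
    have hg1 : g (1 ⊗ₜ[O] x) (.inr 1) = γ * residue O (e.repr x (.inr 0)) +
        δ * residue O (e.repr x (.inr 1)) := by rw [← hr, ← hr]; rfl
    have hw0 : w (.inr 0) = w₀ := rfl
    have hw1 : w (.inr 1) = w₁ := rfl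
    have hwl : ∀ k, w (.inl k) = residue O (u k) := fun k => rfl
    have := hform (residue O (e.repr x (.inr 0))) (residue O (e.repr x (.inr 1)))
    rw [QuadraticMap.weightedSumSquares_apply, Fintype.sum_sum_type, Fin.sum_univ_two, hg0, hg1,
      hw0, hw1]
    simp only [hgl, hwl, smul_eq_mul, map_add, map_mul, map_sum, map_pow, map_ofNat]
    rw [← this]
    simp only [pow_two]
  refine ⟨w, fun k => rfl, ?_, ?_, ?_,
    ⟨(QuadraticMap.weightedSumSquares (ResidueField O) w).comp g.toLinearMap, fun x =>
      ⟨_, (hQ x).symm, hg x⟩⟩, fun q hq => ⟨⟨g, fun z => ?_⟩⟩⟩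
  · rw [map_sub, map_mul, map_pow]; exact hp1
  · rw [map_sub, map_mul, map_pow]; exact hp2
  · rw [map_sub, map_mul, map_pow]; exact hp3
  · obtain ⟨x, rfl⟩ := exists_one_tmul z
    obtain ⟨r, hr, hr'⟩ := hq x
    rw [hr', ← IsFractionRing.injective O F (hr.trans (hQ x)).symm]
    exact hg x

variable (E : Module.Basis (ι ⊕ Fin 2) F V) {Q : QuadraticForm F V} {u : ι → Oˣ} {v₁ v₂ : Oˣ}
  {d₁ d₂ : ℕ}

/-- The form on `overLattice E hϖ i j s` in the basis `overBasis E hϖ i j s`. -/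
lemma apply_overBasis (hϖ : Irreducible ϖ) (hQ : IsDiagonalIn E Q ϖ u v₁ v₂ d₁ d₂) {i j : ℕ}
    {s a b c : O} (ha : ϖ ^ (2 * i) * a = ϖ ^ d₁ * v₁) (hb : ϖ ^ (2 * i + j) * b = ϖ ^ d₁ * s * v₁)
    (hc : ϖ ^ (2 * (i + j)) * c = ϖ ^ (d₂ + 2 * i) * v₂ + ϖ ^ d₁ * s ^ 2 * v₁)
    (x : overLattice E hϖ i j s) :
    let e := (overBasis E hϖ i j s).restrictScalars O
    Q (x : V) = algebraMap O F (∑ k, (u k : O) * e.repr x (.inl k) ^ 2 +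
      (a * e.repr x (.inr 0) ^ 2 + 2 * b * e.repr x (.inr 0) * e.repr x (.inr 1) +
        c * e.repr x (.inr 1) ^ 2)) := by
  intro e
  have he : ∀ k, algebraMap O F (e.repr x k) = (overBasis E hϖ i j s).repr x k :=
    fun k => Module.Basis.restrictScalars_repr_apply O _ x k
  have hi0 := algebraMap_pow_ne_zero (F := F) hϖ i
  simp only [map_add, map_mul, map_sum, map_pow, map_ofNat, he, overBasis_repr_inl,
    overBasis_repr_zero, overBasis_repr_one]
  have ha' := congrArg (algebraMap O F) ha
  have hb' := congrArg (algebraMap O F) hb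
  have hc' := congrArg (algebraMap O F) hc
  simp only [map_add, map_mul, map_pow, pow_add, pow_mul', mul_pow] at ha' hb' hc'
  rw [hQ, add_assoc]
  congr 1
  apply mul_left_cancel₀ (pow_ne_zero 2 hi0)
  simp only [map_mul, map_pow]
  set X := E.repr (x : V) (.inr 0)
  set Y := E.repr (x : V) (.inr 1)
  linear_combination -(algebraMap O F ϖ ^ i * X - algebraMap O F s * Y) ^ 2 * ha' -
    2 * (algebraMap O F ϖ ^ i * X - algebraMap O F s * Y) * Y * hb' - Y ^ 2 * hc'

/-- The Gram entries `a`, `b`, `c` of an integral parameter, and their determinant. -/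
lemma IntegralParam.exists_gram {i j : ℕ} {s : O}
    (h : IntegralParam ϖ v₁ v₂ d₁ d₂ i j s) (hϖ : Irreducible ϖ) : ∃ a b c : O,
      ϖ ^ (2 * i) * a = ϖ ^ d₁ * v₁ ∧ ϖ ^ (2 * i + j) * b = ϖ ^ d₁ * s * v₁ ∧
      ϖ ^ (2 * (i + j)) * c = ϖ ^ (d₂ + 2 * i) * v₂ + ϖ ^ d₁ * s ^ 2 * v₁ ∧
      a * c - b ^ 2 = ϖ ^ (d₁ + d₂ - 2 * (i + j)) * (v₁ * v₂) := by
  have hle := h.le hϖ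
  obtain ⟨h1, ⟨b, hb⟩, ⟨c, hc⟩⟩ := h
  have ha : ϖ ^ (2 * i) * (ϖ ^ (d₁ - 2 * i) * v₁) = ϖ ^ d₁ * v₁ := by
    rw [← mul_assoc, ← pow_add, Nat.add_sub_cancel' h1]
  have hb' : ϖ ^ (2 * i + j) * (b * v₁) = ϖ ^ d₁ * s * v₁ := by rw [hb]; ring
  refine ⟨ϖ ^ (d₁ - 2 * i) * v₁, b * v₁, c, ha, hb', hc.symm, ?_⟩
  apply mul_left_cancel₀ (pow_ne_zero (2 * i + 2 * (i + j)) hϖ.ne_zero)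
  rw [← mul_assoc, ← pow_add, show 2 * i + 2 * (i + j) + (d₁ + d₂ - 2 * (i + j)) =
    d₁ + (d₂ + 2 * i) by omega]
  have e1 : ϖ ^ (2 * i + 2 * (i + j)) * (ϖ ^ (d₁ - 2 * i) * v₁ * c - (b * v₁) ^ 2) =
      ϖ ^ (2 * i) * (ϖ ^ (d₁ - 2 * i) * v₁) * (ϖ ^ (2 * (i + j)) * c) -
        (ϖ ^ (2 * i + j) * (b * v₁)) ^ 2 := by ring
  rw [e1, ha, hb', ← hc]
  ring

lemma IntegralParam.integral (hϖ : Irreducible ϖ) (hQ : IsDiagonalIn E Q ϖ u v₁ v₂ d₁ d₂) {i j : ℕ}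
    {s : O} (h : IntegralParam ϖ v₁ v₂ d₁ d₂ i j s) :
    ∀ x ∈ overLattice E hϖ i j s, ∃ c, algebraMap O F c = Q x := by
  obtain ⟨a, b, c, ha, hb, hc, -⟩ := h.exists_gram hϖ
  exact fun x hx => ⟨_, (apply_overBasis E hϖ hQ ha hb hc ⟨x, hx⟩).symm⟩

lemma integralParam_of_integral (h2 : (2 : ResidueField O) ≠ 0) (hϖ : Irreducible ϖ)
    (hQ : IsDiagonalIn E Q ϖ u v₁ v₂ d₁ d₂) {i j : ℕ} {s : O}
    (h : ∀ x ∈ overLattice E hϖ i j s, ∃ c, algebraMap O F c = Q x) :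
    IntegralParam ϖ v₁ v₂ d₁ d₂ i j s := by
  have hi0 := algebraMap_pow_ne_zero (F := F) hϖ i
  have hj0 := algebraMap_pow_ne_zero (F := F) hϖ j
  have hl : ∀ (m : Fin 2) k, E.repr (overBasis E hϖ i j s (.inr m)) (.inl k) = 0 := by
    intro m k
    rw [← overBasis_repr_inl E hϖ i j s, Module.Basis.repr_self]; simp
  have hz₁ := overBasis_mem E hϖ i j s (.inr 0)
  have hz₂ := overBasis_mem E hϖ i j s (.inr 1)
  refine ⟨?_, ?_, ?_⟩
  · obtain ⟨c, hc⟩ := h _ hz₁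
    rw [hQ, (repr_overBasis_zero E hϖ i j s).1, (repr_overBasis_zero E hϖ i j s).2] at hc
    simp only [hl, ne_eq, OfNat.ofNat_ne_zero, not_false_eq_true, zero_pow, mul_zero,
      Finset.sum_const_zero, zero_add, add_zero] at hc
    have : ϖ ^ (2 * i) ∣ v₁ * ϖ ^ d₁ := by
      refine dvd_of_mul_inv_mem_range (F := F) hϖ ⟨c, ?_⟩
      rw [hc, mul_comm (v₁ : O), pow_mul']
      field_simp
    rwa [pow_dvd_unit_mul_pow_iff hϖ] at this
  · have hp := polar_mem_range h hz₁ hz₂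
    rw [hQ.polar, (repr_overBasis_zero E hϖ i j s).1, (repr_overBasis_zero E hϖ i j s).2,
      (repr_overBasis_one E hϖ i j s).1] at hp
    simp only [hl, mul_zero, zero_mul, Finset.sum_const_zero, zero_add, add_zero] at hp
    refine dvd_of_mul_inv_mem_range (F := F) hϖ (mem_range_of_two_mul h2 v₁ ?_)
    convert hp using 2
    simp only [map_mul, map_pow, pow_add, pow_mul']
    field_simp
  · obtain ⟨c, hc⟩ := h _ hz₂
    rw [hQ, (repr_overBasis_one E hϖ i j s).1, (repr_overBasis_one E hϖ i j s).2] at hc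
    simp only [hl, ne_eq, OfNat.ofNat_ne_zero, not_false_eq_true, zero_pow, mul_zero,
      Finset.sum_const_zero, zero_add] at hc
    refine dvd_of_mul_inv_mem_range (F := F) hϖ ⟨c, ?_⟩
    rw [hc]
    simp only [map_mul, map_pow, map_add, pow_add, pow_mul', mul_pow]
    field_simp
    ring

/-- A diagonalization of the reduction of an integral overlattice. The reduced binary form has full
rank if `2 (i + j) = d₁ + d₂`. Otherwise it is degenerate, and its first diagonal entry vanishes
unless `2 i = d₁`. -/
lemma IntegralParam.exists_weights (h2 : (2 : ResidueField O) ≠ 0) (hϖ : Irreducible ϖ)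
    (hQ : IsDiagonalIn E Q ϖ u v₁ v₂ d₁ d₂) {i j : ℕ} {s : O}
    (h : IntegralParam ϖ v₁ v₂ d₁ d₂ i j s) :
    ∃ w : ι ⊕ Fin 2 → ResidueField O, (∀ k, w (.inl k) = residue O (u k : O)) ∧
      (2 * (i + j) = d₁ + d₂ → w (.inr 0) ≠ 0 ∧ w (.inr 1) ≠ 0) ∧
      (2 * (i + j) < d₁ + d₂ → 2 * i = d₁ → w (.inr 0) = residue O (v₁ : O) ∧ w (.inr 1) = 0) ∧
      (2 * (i + j) < d₁ + d₂ → 2 * i ≠ d₁ → w (.inr 0) = 0 ∧ w (.inr 1) =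
        leadCoeff ϖ (2 * (i + j)) (ϖ ^ (d₂ + 2 * i) * v₂ + ϖ ^ d₁ * s ^ 2 * v₁)) ∧
      (∃ q, IsReduction Q (overLattice E hϖ i j s) q) ∧
      ∀ q, IsReduction Q (overLattice E hϖ i j s) q →
        q.Equivalent (QuadraticMap.weightedSumSquares (ResidueField O) w) := by
  obtain ⟨a, b, c, ha, hb, hc, hdisc⟩ := h.exists_gram hϖ
  obtain ⟨w, hw, h₁, h₂, h₃, hex, hall⟩ := exists_reduction h2 Q _ _ (fun k => (u k : O)) a b c
    (apply_overBasis E hϖ hQ ha hb hc)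
  have hv₁ : residue O (v₁ : O) ≠ 0 := (residue_ne_zero_iff_isUnit _).2 v₁.isUnit
  have hd0 : 2 * (i + j) < d₁ + d₂ → residue O (a * c - b ^ 2) = 0 := fun hlt => by
    rw [hdisc, residue_eq_zero_iff_dvd hϖ]
    exact dvd_mul_of_dvd_left (dvd_pow_self _ (by omega)) _
  refine ⟨w, hw, fun heq => h₁ ?_, fun hlt hi => ?_, fun hlt hi => ?_, hex, hall⟩
  · rw [hdisc, heq, Nat.sub_self, pow_zero, one_mul, residue_ne_zero_iff_isUnit]
    exact v₁.isUnit.mul v₂.isUnit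
  · have : a = v₁ := by
      rw [hi] at ha; exact mul_left_cancel₀ (pow_ne_zero _ hϖ.ne_zero) ha
    rw [this] at h₂ hd0
    exact h₂ (hd0 hlt) hv₁
  · have hi' : 2 * i < d₁ := lt_of_le_of_ne h.1 hi
    have : a = ϖ ^ (d₁ - 2 * i) * v₁ := by
      apply mul_left_cancel₀ (pow_ne_zero (2 * i) hϖ.ne_zero)
      rw [ha, ← mul_assoc, ← pow_add, Nat.add_sub_cancel' hi'.le]
    rw [← hc, leadCoeff_mul hϖ]
    refine h₃ (hd0 hlt) ?_
    rw [residue_eq_zero_iff_dvd hϖ, this]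
    exact dvd_mul_of_dvd_left (dvd_pow_self _ (by omega)) _

variable [Fintype (ResidueField O)] [DecidableEq (ResidueField O)]

/-- The type of a lattice in terms of a diagonalization of its reduction, where `emb` enumerates the
nonzero coefficients. -/
lemma assigned_iff_of_equivalent (h2 : (2 : ResidueField O) ≠ 0) {M : Submodule O V}
    {ι₀ : Type*} [Fintype ι₀] {w : ι₀ → ResidueField O} (hex : ∃ q, IsReduction Q M q)
    (hall : ∀ q, IsReduction Q M q →
      q.Equivalent (QuadraticMap.weightedSumSquares (ResidueField O) w))
    {ι' : Type*} [Fintype ι'] (emb : ι' → ι₀) (hemb : Function.Injective emb)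
    (hrange : ∀ i, w i ≠ 0 ↔ i ∈ Set.range emb) (a : ℕ) (ε : ℤˣ) :
    Assigned Q M a ε ↔ a = Fintype.card ι' ∧ (Even a → 0 < a →
      (quadraticChar (ResidueField O) ((-1) ^ (a / 2) * ∏ i, w (emb i)) = 1 ↔ ε = 1)) := by
  have hne : (-1) ^ (a / 2) * ∏ i, w (emb i) ≠ 0 := by
    refine mul_ne_zero (pow_ne_zero _ (neg_ne_zero.2 one_ne_zero)) ?_
    exact Finset.prod_ne_zero_iff.2 fun i _ => (hrange _).2 ⟨i, rfl⟩
  rw [quadraticChar_one_iff_isSquare hne]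
  constructor
  · rintro ⟨q, hq, ht⟩
    exact (hasType_iff_of_equivalent h2 (hall q hq) emb hemb hrange a ε).1 ht
  · intro ht
    obtain ⟨q, hq⟩ := hex
    exact ⟨q, hq, (hasType_iff_of_equivalent h2 (hall q hq) emb hemb hrange a ε).2 ht⟩

/-- The type of an overlattice whose Gram matrix in the last two coordinates vanishes modulo
`ϖ`. -/
lemma assigned_overLattice_of_eq_zero (h2 : (2 : ResidueField O) ≠ 0) (hϖ : Irreducible ϖ)
    (hQ : IsDiagonalIn E Q ϖ u v₁ v₂ d₁ d₂) {i j : ℕ} {s : O}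
    (h : IntegralParam ϖ v₁ v₂ d₁ d₂ i j s) (hlt : 2 * (i + j) < d₁ + d₂)
    (hτ : paramSign ϖ v₁ v₂ d₁ d₂ i j s = 0) (a : ℕ) (ε : ℤˣ) :
    Assigned Q (overLattice E hϖ i j s) a ε ↔ a = Fintype.card ι ∧ (Even a → 0 < a →
      (quadraticChar (ResidueField O) ((-1) ^ (a / 2) * ∏ k, residue O (u k : O)) = 1 ↔
        ε = 1)) := by
  obtain ⟨w, hw, -, hw₁, hw₂, hex, hall⟩ := h.exists_weights E h2 hϖ hQ
  have hu : ∀ k, residue O (u k : O) ≠ 0 := fun k => (residue_ne_zero_iff_isUnit _).2 (u k).isUnit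
  have hv₁ : residue O (v₁ : O) ≠ 0 := (residue_ne_zero_iff_isUnit _).2 v₁.isUnit
  have hi : 2 * i ≠ d₁ := by
    intro hi
    rw [paramSign, if_pos hi, quadraticChar_eq_zero_iff] at hτ
    exact hv₁ hτ
  rw [paramSign, if_neg hi, quadraticChar_eq_zero_iff] at hτ
  obtain ⟨h0, h1⟩ := hw₂ hlt hi
  rw [assigned_iff_of_equivalent h2 hex hall Sum.inl Sum.inl_injective]
  · simp only [hw]
  · rw [Sum.forall, Fin.forall_fin_two, h0, h1, hτ]
    exact ⟨fun k => by simp [hw, hu], by simp, by simp⟩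

/-- The type of an overlattice whose Gram matrix in the last two coordinates has rank one modulo
`ϖ`. -/
lemma assigned_overLattice_of_ne_zero (h2 : (2 : ResidueField O) ≠ 0) (hϖ : Irreducible ϖ)
    (hQ : IsDiagonalIn E Q ϖ u v₁ v₂ d₁ d₂) {i j : ℕ} {s : O}
    (h : IntegralParam ϖ v₁ v₂ d₁ d₂ i j s) (hlt : 2 * (i + j) < d₁ + d₂)
    (hτ : paramSign ϖ v₁ v₂ d₁ d₂ i j s ≠ 0) (a : ℕ) (ε : ℤˣ) :
    Assigned Q (overLattice E hϖ i j s) a ε ↔ a = Fintype.card ι + 1 ∧ (Even a → 0 < a →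
      (quadraticChar (ResidueField O) ((-1) ^ (a / 2) * ∏ k, residue O (u k : O)) *
        paramSign ϖ v₁ v₂ d₁ d₂ i j s = 1 ↔ ε = 1)) := by
  obtain ⟨w, hw, -, hw₁, hw₂, hex, hall⟩ := h.exists_weights E h2 hϖ hQ
  have hu : ∀ k, residue O (u k : O) ≠ 0 := fun k => (residue_ne_zero_iff_isUnit _).2 (u k).isUnit
  have hv₁ : residue O (v₁ : O) ≠ 0 := (residue_ne_zero_iff_isUnit _).2 v₁.isUnit
  obtain ⟨m, m', hm, hm0, hm1⟩ : ∃ m m' : Fin 2, m ≠ m' ∧ w (.inr m') = 0 ∧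
      quadraticChar (ResidueField O) (w (.inr m)) = paramSign ϖ v₁ v₂ d₁ d₂ i j s := by
    by_cases hi : 2 * i = d₁
    · obtain ⟨h0, h1⟩ := hw₁ hlt hi
      exact ⟨0, 1, by simp, h1, by rw [h0, paramSign, if_pos hi]⟩
    · obtain ⟨h0, h1⟩ := hw₂ hlt hi
      exact ⟨1, 0, by simp, h0, by rw [h1, paramSign, if_neg hi]⟩
  have hm2 : w (.inr m) ≠ 0 := by
    intro h0; rw [h0, MulChar.map_zero] at hm1; exact hτ hm1.symm
  have hfin : ∀ k : Fin 2, k = m ∨ k = m' := by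
    intro k; fin_cases k <;> fin_cases m <;> fin_cases m' <;> simp_all
  rw [assigned_iff_of_equivalent h2 hex hall (fun o : Option ι => o.elim (.inr m) .inl)]
  · rw [Fintype.card_option, Fintype.prod_option]
    simp only [Option.elim_none, Option.elim_some, hw]
    rw [← hm1, ← map_mul, mul_assoc, mul_comm (w _)]
  · rintro (_ | k) (_ | l) h <;> simp_all
  · rintro (k | k)
    · simp only [hw, ne_eq, hu, not_false_eq_true, true_iff]
      exact ⟨some k, rfl⟩
    · rcases hfin k with rfl | rfl
      · exact ⟨fun _ => ⟨none, rfl⟩, fun _ => hm2⟩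
      · refine ⟨fun h => absurd hm0 h, ?_⟩
        rintro ⟨_ | l, h⟩
        · simp only [Option.elim_none, Sum.inr.injEq] at h; exact absurd h hm
        · simp at h

/-- A unimodular overlattice has full rank modulo `ϖ`. -/
lemma assigned_overLattice_of_eq (h2 : (2 : ResidueField O) ≠ 0) (hϖ : Irreducible ϖ)
    (hQ : IsDiagonalIn E Q ϖ u v₁ v₂ d₁ d₂) {i j : ℕ} {s : O}
    (h : IntegralParam ϖ v₁ v₂ d₁ d₂ i j s) (heq : 2 * (i + j) = d₁ + d₂) (a : ℕ) :
    ∃ c : Prop, ∀ ε : ℤˣ, Assigned Q (overLattice E hϖ i j s) a ε ↔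
      a = Fintype.card ι + 2 ∧ (Even a → 0 < a → (c ↔ ε = 1)) := by
  obtain ⟨w, hw, hw₀, -, -, hex, hall⟩ := h.exists_weights E h2 hϖ hQ
  have hu : ∀ k, residue O (u k : O) ≠ 0 := fun k => (residue_ne_zero_iff_isUnit _).2 (u k).isUnit
  refine ⟨quadraticChar (ResidueField O) ((-1) ^ (a / 2) * ∏ i, w (id i)) = 1, fun ε => ?_⟩
  rw [assigned_iff_of_equivalent h2 hex hall id Function.injective_id, Fintype.card_sum,
    Fintype.card_fin]
  rw [Sum.forall, Fin.forall_fin_two]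
  exact ⟨fun k => by simp [hw, hu], by simp [(hw₀ heq).1], by simp [(hw₀ heq).2]⟩

lemma exists_latticeGK_overLattice (h2 : (2 : ResidueField O) ≠ 0) (hϖ : Irreducible ϖ)
    (hQ : IsDiagonalIn E Q ϖ u v₁ v₂ d₁ d₂) {i j : ℕ} {s : O}
    (h : IntegralParam ϖ v₁ v₂ d₁ d₂ i j s) :
    ∃ (n : ℕ) (g : Fin n → ℕ), LatticeGK Q (overLattice E hϖ i j s) g := by
  classical
  have h2F := two_ne_zero_of_residue h2 F
  let σ := Fintype.equivFin (ι ⊕ Fin 2)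
  let B : Module.Basis (ι ⊕ Fin 2) O (overLattice E hϖ i j s) :=
    (overBasis E hϖ i j s).restrictScalars O
  refine ⟨_, exists_latticeGK hϖ h2F Q _ (B.reindex σ) (h.integral E hϖ hQ) ?_⟩
  have hb : (fun k => ((B.reindex σ k : overLattice E hϖ i j s) : V)) =
      (overBasis E hϖ i j s).reindex σ := by
    ext k
    rw [Module.Basis.reindex_apply, Module.Basis.reindex_apply]
    exact Module.Basis.restrictScalars_apply O _ _
  rw [hb]
  refine det_gram_ne_zero h2F Q _ fun x hx => ?_
  have hmul : ∀ (w y : F), w ≠ 0 → 2 * (w * y) = 0 → y = 0 := by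
    intro w y hw h
    simpa [h2F, hw] using h
  have hpi : algebraMap O F ϖ ≠ 0 := by simpa using hϖ.ne_zero
  apply E.repr.injective
  rw [map_zero]
  ext k
  rw [Finsupp.zero_apply]
  have hk := hx (E k)
  rw [hQ.polar] at hk
  rcases k with k | k
  · refine hmul (algebraMap O F (u k)) _ (by simp) ?_
    rw [← hk, Finset.sum_eq_single k]
    · simp
    · intro l _ hl; simp [hl.symm]
    · simp
  · fin_cases k
    · refine hmul (algebraMap O F (ϖ ^ d₁ * v₁)) _ (by simp [hpi]) ?_
      rw [← hk]; simp
    · refine hmul (algebraMap O F (ϖ ^ d₂ * v₂)) _ (by simp [hpi]) ?_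
      rw [← hk]; simp

/-- The Gram matrix in the last two coordinates vanishes modulo `ϖ` if and only if it is integral
for the form `ϖ⁻¹ Q`. -/
lemma integralParam_and_paramSign_eq_zero_iff (hϖ : Irreducible ϖ) {i j : ℕ} {s : O}
    (hd : d₁ ≤ d₂) (hlt : 2 * (i + j) < d₁ + d₂) :
    IntegralParam ϖ v₁ v₂ d₁ d₂ i j s ∧ paramSign ϖ v₁ v₂ d₁ d₂ i j s = 0 ↔
      0 < d₁ ∧ IntegralParam ϖ v₁ v₂ (d₁ - 1) (d₂ - 1) i j s := by
  have hv₁ : residue O (v₁ : O) ≠ 0 := (residue_ne_zero_iff_isUnit _).2 v₁.isUnit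
  constructor
  · rintro ⟨⟨h1, -, h3⟩, hτ⟩
    have hi : 2 * i ≠ d₁ := by
      intro hi
      rw [paramSign, if_pos hi, quadraticChar_eq_zero_iff] at hτ
      exact hv₁ hτ
    rw [paramSign, if_neg hi, quadraticChar_eq_zero_iff, leadCoeff_eq_zero_iff hϖ h3] at hτ
    obtain ⟨e₁, rfl⟩ : ∃ e, d₁ = e + 1 := ⟨d₁ - 1, by omega⟩
    obtain ⟨e₂, rfl⟩ : ∃ e, d₂ = e + 1 := ⟨d₂ - 1, by omega⟩
    refine ⟨by omega, by omega, ?_, ?_⟩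
    · have h4 : ϖ ^ (2 * (2 * i + j) + 1) ∣ (ϖ ^ (e₁ + 1) * s) ^ 2 := by
        rw [← Units.dvd_mul_right (u := v₁)]
        have h5 : (ϖ ^ (e₁ + 1) * s) ^ 2 * (v₁ : O) =
            ϖ ^ (e₁ + 1) * (ϖ ^ (e₂ + 1 + 2 * i) * v₂ + ϖ ^ (e₁ + 1) * s ^ 2 * v₁) -
            ϖ ^ (e₁ + 1 + (e₂ + 1) + 2 * i) * v₂ := by ring
        rw [h5]
        refine dvd_sub ?_ (dvd_mul_of_dvd_left (pow_dvd_pow ϖ (by omega)) _)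
        refine dvd_trans (pow_dvd_pow ϖ (?_ : _ ≤ e₁ + 1 + (2 * (i + j) + 1))) ?_
        · omega
        · rw [pow_add]; exact mul_dvd_mul_left _ hτ
      have h6 := pow_dvd_of_pow_dvd_sq hϖ (b := 2 * i + j + 1) (by omega) h4
      rw [pow_succ', pow_succ', mul_assoc, mul_dvd_mul_iff_left hϖ.ne_zero] at h6
      exact h6
    · have h5 : ϖ ^ (e₂ + 1 + 2 * i) * (v₂ : O) + ϖ ^ (e₁ + 1) * s ^ 2 * v₁ =
        ϖ * (ϖ ^ (e₂ + 2 * i) * v₂ + ϖ ^ e₁ * s ^ 2 * v₁) := by ring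
      rw [h5, pow_succ', mul_dvd_mul_iff_left hϖ.ne_zero] at hτ
      exact hτ
  · rintro ⟨hpos, h1, h3, h4⟩
    obtain ⟨e₁, rfl⟩ : ∃ e, d₁ = e + 1 := ⟨d₁ - 1, by omega⟩
    obtain ⟨e₂, rfl⟩ : ∃ e, d₂ = e + 1 := ⟨d₂ - 1, by omega⟩
    simp only [Nat.add_sub_cancel] at h1 h3 h4
    have h5 : ϖ ^ (e₂ + 1 + 2 * i) * (v₂ : O) + ϖ ^ (e₁ + 1) * s ^ 2 * v₁ =
        ϖ * (ϖ ^ (e₂ + 2 * i) * v₂ + ϖ ^ e₁ * s ^ 2 * v₁) := by ring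
    have h6 : ϖ ^ (2 * (i + j) + 1) ∣
        ϖ ^ (e₂ + 1 + 2 * i) * (v₂ : O) + ϖ ^ (e₁ + 1) * s ^ 2 * v₁ := by
      rw [h5, pow_succ']; exact mul_dvd_mul_left _ h4
    have h7 := (pow_dvd_pow ϖ (Nat.le_succ (2 * (i + j)))).trans h6
    refine ⟨⟨by omega, ?_, h7⟩, ?_⟩
    · rw [pow_succ', mul_assoc]; exact Dvd.dvd.mul_left h3 _
    · rw [paramSign, if_neg (by omega), (leadCoeff_eq_zero_iff hϖ h7).2 h6, MulChar.map_zero]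

end Reduction

/-! ### Overlattices as integral parameters -/

section Count

open IsLocalRing Finset

variable {O F V : Type*} [CommRing O] [IsDomain O] [IsDiscreteValuationRing O]
  [Field F] [Algebra O F] [IsFractionRing O F]
  [AddCommGroup V] [Module O V] [Module F V] [IsScalarTower O F V] {ϖ : O}

open Classical in
/-- The integral parameters `(i, j, s)` with `i + j = b` and `s` in a system `T j` of
representatives modulo `ϖ ^ j`, recorded as the pairs `⟨j, s⟩`. -/
noncomputable def integralParams (ϖ : O) (v₁ v₂ : Oˣ) (T : ℕ → Finset O) (d₁ d₂ b : ℕ) :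
    Finset (Σ _ : ℕ, O) :=
  (range (b + 1)).sigma fun j => (T j).filter (IntegralParam ϖ v₁ v₂ d₁ d₂ (b - j) j)

variable {v₁ v₂ : Oˣ} {d₁ d₂ b : ℕ} {T : ℕ → Finset O}

open Classical in
lemma mem_integralParams {p : Σ _ : ℕ, O} : p ∈ integralParams ϖ v₁ v₂ T d₁ d₂ b ↔
    p.1 ≤ b ∧ p.2 ∈ T p.1 ∧ IntegralParam ϖ v₁ v₂ d₁ d₂ (b - p.1) p.1 p.2 := by
  rw [integralParams, mem_sigma, mem_range, Nat.lt_succ_iff, mem_filter]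

lemma card_integralParams [Finite (ResidueField O)] :
    (integralParams ϖ v₁ v₂ T d₁ d₂ b).card = numIntegral ϖ v₁ v₂ T d₁ d₂ b :=
  card_sigma _ _

lemma sum_paramSign [Fintype (ResidueField O)] [DecidableEq (ResidueField O)] :
    ∑ p ∈ integralParams ϖ v₁ v₂ T d₁ d₂ b, paramSign ϖ v₁ v₂ d₁ d₂ (b - p.1) p.1 p.2 =
      signedIntegral ϖ v₁ v₂ T d₁ d₂ b :=
  sum_sigma _ _ _

variable {ι : Type*} [Fintype ι] (E : Module.Basis (ι ⊕ Fin 2) F V) {Q : QuadraticForm F V}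
  {u : ι → Oˣ}

lemma injOn_overLattice (hϖ : Irreducible ϖ) (hT : ∀ j, IsResidueSystem (ϖ ^ j) (T j)) :
    Set.InjOn (fun p : Σ _ : ℕ, O => overLattice E hϖ (b - p.1) p.1 p.2)
      (integralParams ϖ v₁ v₂ T d₁ d₂ b) := by
  rintro ⟨j, s⟩ hp ⟨j', s'⟩ hp' h
  obtain ⟨-, rfl, hs⟩ := overLattice_injective E hϖ h
  have h1 := (mem_integralParams.1 hp).2.1
  have h2 := (mem_integralParams.1 hp').2.1
  obtain rfl := (hT j s).unique ⟨h1, by simp⟩ ⟨h2, hs⟩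
  rfl

variable [Fintype (ResidueField O)] [DecidableEq (ResidueField O)]

/-- The overlattices counted by the theorem, in terms of their parameters. -/
lemma overlattices_eq_image (h2 : (2 : ResidueField O) ≠ 0) (hϖ : Irreducible ϖ)
    (hQ : IsDiagonalIn E Q ϖ u v₁ v₂ d₁ d₂) (hT : ∀ j, IsResidueSystem (ϖ ^ j) (T j)) (a : ℕ)
    (ε : ℤˣ) (b : ℕ) :
    overlattices Q (Submodule.span O (Set.range E)) a ε b =
      (fun p : Σ _ : ℕ, O => overLattice E hϖ (b - p.1) p.1 p.2) ''
        {p | p ∈ integralParams ϖ v₁ v₂ T d₁ d₂ b ∧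
          Assigned Q (overLattice E hϖ (b - p.1) p.1 p.2) a ε} := by
  ext M
  constructor
  · rintro ⟨hLM, -, -, hlen, hA⟩
    have hint : ∀ x ∈ M, ∃ c, algebraMap O F c = Q x := by
      obtain ⟨q, hq, -⟩ := hA
      exact fun x hx => (hq ⟨x, hx⟩).imp fun c hc => hc.1
    obtain ⟨i, j, s, rfl⟩ := exists_eq_overLattice E h2 hϖ hQ hLM hint
    rw [length_overLattice, Nat.cast_inj] at hlen
    obtain ⟨t, ⟨htT, hst⟩, -⟩ := hT j s
    have hi : b - j = i := by omega
    rw [overLattice_congr E hϖ i j hst] at hint hA ⊢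
    refine ⟨⟨j, t⟩, ⟨mem_integralParams.2 ⟨?_, htT, ?_⟩, ?_⟩, ?_⟩
    · change j ≤ b; omega
    all_goals dsimp only
    all_goals rw [hi]
    · exact integralParam_of_integral E h2 hϖ hQ hint
    · exact hA
  · rintro ⟨⟨j, s⟩, ⟨hp, hA⟩, rfl⟩
    obtain ⟨hj, -, hp⟩ := mem_integralParams.1 hp
    obtain ⟨n, g, hg⟩ := exists_latticeGK_overLattice E h2 hϖ hQ hp
    refine ⟨span_le_overLattice E hϖ _ _ _, isLattice_overLattice E hϖ _ _ _,
      ⟨n, g, hg, Pi.toLex_monotone fun _ => Nat.zero_le _⟩, ?_, hA⟩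
    rw [length_overLattice]
    have hj' : j ≤ b := hj
    norm_cast
    dsimp only
    omega

lemma finite_overlattices (h2 : (2 : ResidueField O) ≠ 0)
    (hϖ : Irreducible ϖ) (hQ : IsDiagonalIn E Q ϖ u v₁ v₂ d₁ d₂) (a : ℕ) (ε : ℤˣ) (b : ℕ) :
    (overlattices Q (Submodule.span O (Set.range E)) a ε b).Finite := by
  choose T hT _ using exists_isResidueSystem (O := O) hϖ
  rw [overlattices_eq_image E h2 hϖ hQ hT]
  exact ((finite_toSet (integralParams ϖ v₁ v₂ T d₁ d₂ b)).subset fun p hp => hp.1).image _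

lemma ncard_overlattices (h2 : (2 : ResidueField O) ≠ 0) (hϖ : Irreducible ϖ)
    (hQ : IsDiagonalIn E Q ϖ u v₁ v₂ d₁ d₂) (hT : ∀ j, IsResidueSystem (ϖ ^ j) (T j)) (a : ℕ)
    (ε : ℤˣ) (b : ℕ) {P : (Σ _ : ℕ, O) → Prop}
    [DecidablePred P]
    (hP : ∀ p ∈ integralParams ϖ v₁ v₂ T d₁ d₂ b,
      (Assigned Q (overLattice E hϖ (b - p.1) p.1 p.2) a ε ↔ P p)) :
    (overlattices Q (Submodule.span O (Set.range E)) a ε b).ncard =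
      ((integralParams ϖ v₁ v₂ T d₁ d₂ b).filter P).card := by
  rw [overlattices_eq_image E h2 hϖ hQ hT, Set.InjOn.ncard_image
    ((injOn_overLattice E hϖ hT).mono fun p hp => hp.1), ← Set.ncard_coe_finset]
  congr 1
  ext p
  simp only [Set.mem_ofPred_eq, coe_filter]
  exact and_congr_right (hP p)

/-- The numbers `numS` and `signedNumS`, when the type of the lattice with parameter `p` has
dimension `a` if and only if `A p`, and sign `1` if and only if `C p`. -/
lemma numS_eq_card_and_signedNumS_eq_sum (h2 : (2 : ResidueField O) ≠ 0) (hϖ : Irreducible ϖ)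
    (hQ : IsDiagonalIn E Q ϖ u v₁ v₂ d₁ d₂) (hT : ∀ j, IsResidueSystem (ϖ ^ j) (T j)) (a b : ℕ)
    {A C : (Σ _ : ℕ, O) → Prop} [DecidablePred A] [DecidablePred C]
    (hAC : ∀ p ∈ integralParams ϖ v₁ v₂ T d₁ d₂ b, ∀ ε : ℤˣ,
      (Assigned Q (overLattice E hϖ (b - p.1) p.1 p.2) a ε ↔
        A p ∧ (Even a → 0 < a → (C p ↔ ε = 1)))) :
    numS Q (Submodule.span O (Set.range E)) a b =
      (((integralParams ϖ v₁ v₂ T d₁ d₂ b).filter A).card : ℚ) ∧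
    (Even a → signedNumS Q (Submodule.span O (Set.range E)) a b =
      ((∑ p ∈ (integralParams ϖ v₁ v₂ T d₁ d₂ b).filter A,
        if a = 0 then 1 else if C p then (1 : ℤ) else -1 : ℤ) : ℚ)) := by
  by_cases ha : Odd a ∨ a = 0
  · have hn : (overlattices Q (Submodule.span O (Set.range E)) a 1 b).ncard =
        ((integralParams ϖ v₁ v₂ T d₁ d₂ b).filter A).card := by
      refine ncard_overlattices E h2 hϖ hQ hT a 1 b fun p hp => (hAC p hp 1).trans ?_
      refine and_iff_left fun he hpos => ?_
      rw [← Nat.not_odd_iff_even] at he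
      exact absurd ha (not_or.2 ⟨he, hpos.ne'⟩)
    refine ⟨by rw [numS, if_pos ha, hn], fun he => ?_⟩
    have ha0 : a = 0 := ha.resolve_left (Nat.not_odd_iff_even.2 he)
    rw [signedNumS, if_pos ha, hn]
    simp [chi, ha0]
  · obtain ⟨hodd, h0⟩ := not_or.1 ha
    have heven := Nat.not_odd_iff_even.1 hodd
    have hpos := Nat.pos_of_ne_zero h0
    have hn1 : (overlattices Q (Submodule.span O (Set.range E)) a 1 b).ncard =
        (((integralParams ϖ v₁ v₂ T d₁ d₂ b).filter A).filter C).card := by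
      rw [filter_filter]
      refine ncard_overlattices E h2 hϖ hQ hT a 1 b fun p hp => (hAC p hp 1).trans ?_
      simp [heven, hpos]
    have hn2 : (overlattices Q (Submodule.span O (Set.range E)) a (-1) b).ncard =
        (((integralParams ϖ v₁ v₂ T d₁ d₂ b).filter A).filter (¬ C ·)).card := by
      rw [filter_filter]
      refine ncard_overlattices E h2 hϖ hQ hT a (-1) b fun p hp => (hAC p hp (-1)).trans ?_
      have : (-1 : ℤˣ) ≠ 1 := by decide
      simp [heven, hpos, this]
    refine ⟨?_, fun _ => ?_⟩
    · rw [numS, if_neg ha, hn1, hn2,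
        ← card_filter_add_card_filter_not (s := filter A _) C]
      push_cast; ring
    · rw [signedNumS, if_neg ha, hn1, hn2, sum_congr rfl fun p _ => if_neg h0, sum_ite]
      simp [chi, hodd, h0]

lemma signedNumS_eq_zero {Q : QuadraticForm F V} {L : Submodule O V} {a b : ℕ}
    (h : numS Q L a b = 0) : signedNumS Q L a b = 0 := by
  rw [numS] at h
  rw [signedNumS]
  split_ifs at h ⊢
  · rw [h, mul_zero]
  · obtain ⟨h1, h2⟩ := (add_eq_zero_iff_of_nonneg (Nat.cast_nonneg _) (Nat.cast_nonneg _)).1 h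
    rw [h1, h2, mul_zero, mul_zero, add_zero]

variable [IsAdicComplete (maximalIdeal O) O]

lemma filter_paramSign_eq_zero (hϖ : Irreducible ϖ) (hd : d₁ ≤ d₂) (hb : 2 * b < d₁ + d₂) :
    (integralParams ϖ v₁ v₂ T d₁ d₂ b).filter
      (fun p => paramSign ϖ v₁ v₂ d₁ d₂ (b - p.1) p.1 p.2 = 0) =
    if 0 < d₁ then integralParams ϖ v₁ v₂ T (d₁ - 1) (d₂ - 1) b else ∅ := by
  ext p
  rw [mem_filter, mem_integralParams]
  have key : p.1 ≤ b → _ := fun hp => integralParam_and_paramSign_eq_zero_iff (v₁ := v₁) (v₂ := v₂)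
    hϖ (i := b - p.1) (j := p.1) (s := p.2) hd (by omega)
  split_ifs with h
  · rw [mem_integralParams]
    constructor
    · rintro ⟨⟨h1, h2, h3⟩, h4⟩
      exact ⟨h1, h2, ((key h1).1 ⟨h3, h4⟩).2⟩
    · rintro ⟨h1, h2, h3⟩
      obtain ⟨h3, h4⟩ := (key h1).2 ⟨h, h3⟩
      exact ⟨⟨h1, h2, h3⟩, h4⟩
  · simp only [notMem_empty, iff_false]
    rintro ⟨⟨h1, h2, h3⟩, h4⟩
    exact h ((key h1).1 ⟨h3, h4⟩).1

variable (ϖ v₁ v₂ T) in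
/-- The number of parameters whose binary Gram matrix vanishes modulo `ϖ`: those that are integral
for the form `ϖ⁻¹ Q`, with exponents `d₁ - 1` and `d₂ - 1`, of which there are none if `d₁ = 0`. -/
noncomputable def numNull (d₁ d₂ b : ℕ) : ℕ :=
  if 0 < d₁ then numIntegral ϖ v₁ v₂ T (d₁ - 1) (d₂ - 1) b else 0

lemma card_filter_paramSign_eq_zero (hϖ : Irreducible ϖ) (hd : d₁ ≤ d₂) (hb : 2 * b < d₁ + d₂) :
    ((integralParams ϖ v₁ v₂ T d₁ d₂ b).filter
      (fun p => paramSign ϖ v₁ v₂ d₁ d₂ (b - p.1) p.1 p.2 = 0)).card =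
    numNull ϖ v₁ v₂ T d₁ d₂ b := by
  rw [filter_paramSign_eq_zero hϖ hd hb, numNull]
  split_ifs
  · exact card_integralParams
  · rfl

lemma two_mul_add_eq_of_mem {p : Σ _ : ℕ, O} (hp : p ∈ integralParams ϖ v₁ v₂ T d₁ d₂ b) :
    b - p.1 + p.1 = b := by
  have := (mem_integralParams.1 hp).1
  omega

/-- The overlattices of rank `n - 2` modulo `ϖ`. -/
lemma numS_null (h2 : (2 : ResidueField O) ≠ 0) (hϖ : Irreducible ϖ)
    (hQ : IsDiagonalIn E Q ϖ u v₁ v₂ d₁ d₂) (hT : ∀ j, IsResidueSystem (ϖ ^ j) (T j))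
    (hd : d₁ ≤ d₂) (hb : 2 * b < d₁ + d₂) {a : ℕ} (ha : a = Fintype.card ι) :
    numS Q (Submodule.span O (Set.range E)) a b = numNull ϖ v₁ v₂ T d₁ d₂ b ∧
    (Even a → signedNumS Q (Submodule.span O (Set.range E)) a b =
      (quadraticChar (ResidueField O) ((-1) ^ (a / 2) * ∏ k, residue O (u k : O)) : ℚ) *
        numNull ϖ v₁ v₂ T d₁ d₂ b) := by
  classical
  set c := quadraticChar (ResidueField O) ((-1) ^ (a / 2) * ∏ k, residue O (u k : O)) with hc
  have hu : ∀ k, residue O (u k : O) ≠ 0 := fun k => (residue_ne_zero_iff_isUnit _).2 (u k).isUnit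
  obtain ⟨h3, h4⟩ := numS_eq_card_and_signedNumS_eq_sum E h2 hϖ hQ hT a b
    (A := fun p => paramSign ϖ v₁ v₂ d₁ d₂ (b - p.1) p.1 p.2 = 0) (C := fun _ => c = 1) (by
      intro p hp ε
      have hlt : 2 * (b - p.1 + p.1) < d₁ + d₂ := by rwa [two_mul_add_eq_of_mem hp]
      have hp' := (mem_integralParams.1 hp).2.2
      by_cases h0 : paramSign ϖ v₁ v₂ d₁ d₂ (b - p.1) p.1 p.2 = 0
      · rw [assigned_overLattice_of_eq_zero E h2 hϖ hQ hp' hlt h0]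
        simp only [ha, h0, hc]
      · rw [assigned_overLattice_of_ne_zero E h2 hϖ hQ hp' hlt h0]
        simp [ha, h0])
  rw [card_filter_paramSign_eq_zero hϖ hd hb] at h3
  refine ⟨h3, fun he => ?_⟩
  rw [h4 he, sum_const, card_filter_paramSign_eq_zero hϖ hd hb, nsmul_eq_mul, mul_comm]
  push_cast
  congr 1
  have hne : (-1) ^ (a / 2) * ∏ k, residue O (u k : O) ≠ 0 :=
    mul_ne_zero (pow_ne_zero _ (neg_ne_zero.2 one_ne_zero)) (prod_ne_zero_iff.2 fun k _ => hu k)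
  by_cases ha0 : a = 0
  · have : IsEmpty ι := Fintype.card_eq_zero_iff.1 (ha.symm.trans ha0)
    simp [ha0, hc]
  · rw [if_neg ha0]
    rcases quadraticChar_dichotomy hne with h | h
    · simp [hc, h]
    · rw [hc, h]; norm_num

/-- The overlattices of rank `n - 1` modulo `ϖ`. -/
lemma numS_sub_one (h2 : (2 : ResidueField O) ≠ 0) (hϖ : Irreducible ϖ)
    (hQ : IsDiagonalIn E Q ϖ u v₁ v₂ d₁ d₂) (hT : ∀ j, IsResidueSystem (ϖ ^ j) (T j))
    (hd : d₁ ≤ d₂) (hb : 2 * b < d₁ + d₂) {a : ℕ} (ha : a = Fintype.card ι + 1) :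
    numS Q (Submodule.span O (Set.range E)) a b =
      numIntegral ϖ v₁ v₂ T d₁ d₂ b - numNull ϖ v₁ v₂ T d₁ d₂ b ∧
    (Even a → signedNumS Q (Submodule.span O (Set.range E)) a b =
      (quadraticChar (ResidueField O) ((-1) ^ (a / 2) * ∏ k, residue O (u k : O)) : ℚ) *
        signedIntegral ϖ v₁ v₂ T d₁ d₂ b) := by
  classical
  set c := quadraticChar (ResidueField O) ((-1) ^ (a / 2) * ∏ k, residue O (u k : O)) with hc
  have hu : ∀ k, residue O (u k : O) ≠ 0 := fun k => (residue_ne_zero_iff_isUnit _).2 (u k).isUnit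
  obtain ⟨h3, h4⟩ := numS_eq_card_and_signedNumS_eq_sum E h2 hϖ hQ hT a b
    (A := fun p => ¬ paramSign ϖ v₁ v₂ d₁ d₂ (b - p.1) p.1 p.2 = 0)
    (C := fun p => c * paramSign ϖ v₁ v₂ d₁ d₂ (b - p.1) p.1 p.2 = 1) (by
      intro p hp ε
      have hlt : 2 * (b - p.1 + p.1) < d₁ + d₂ := by rwa [two_mul_add_eq_of_mem hp]
      have hp' := (mem_integralParams.1 hp).2.2
      by_cases h0 : paramSign ϖ v₁ v₂ d₁ d₂ (b - p.1) p.1 p.2 = 0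
      · rw [assigned_overLattice_of_eq_zero E h2 hϖ hQ hp' hlt h0]
        simp [ha, h0]
      · rw [assigned_overLattice_of_ne_zero E h2 hϖ hQ hp' hlt h0]
        simp only [ha, h0, hc, not_false_eq_true])
  constructor
  · rw [h3, eq_sub_iff_add_eq, ← card_filter_paramSign_eq_zero hϖ hd hb, ← card_integralParams,
      ← card_filter_add_card_filter_not (s := integralParams ϖ v₁ v₂ T d₁ d₂ b)
        (fun p => paramSign ϖ v₁ v₂ d₁ d₂ (b - p.1) p.1 p.2 = 0), add_comm]
    push_cast; rfl
  · intro he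
    rw [h4 he, ← Int.cast_mul, Int.cast_inj, ← sum_paramSign, mul_sum, sum_filter]
    refine sum_congr rfl fun p _ => ?_
    have hne : (-1) ^ (a / 2) * ∏ k, residue O (u k : O) ≠ 0 :=
      mul_ne_zero (pow_ne_zero _ (neg_ne_zero.2 one_ne_zero)) (prod_ne_zero_iff.2 fun k _ => hu k)
    have hτ : paramSign ϖ v₁ v₂ d₁ d₂ (b - p.1) p.1 p.2 = 0 ∨
        paramSign ϖ v₁ v₂ d₁ d₂ (b - p.1) p.1 p.2 = 1 ∨
        paramSign ϖ v₁ v₂ d₁ d₂ (b - p.1) p.1 p.2 = -1 := by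
      have hχ : ∀ x, quadraticChar (ResidueField O) x = 0 ∨ quadraticChar (ResidueField O) x = 1 ∨
          quadraticChar (ResidueField O) x = -1 := fun x => by
        by_cases hx : x = 0
        · simp [hx]
        · exact Or.inr (quadraticChar_dichotomy hx)
      rw [paramSign]
      split_ifs <;> exact hχ _
    rcases hτ with h | h | h <;> rcases quadraticChar_dichotomy hne with h' | h' <;>
      rw [hc, h, h'] <;> simp [ha]

/-- Below the unimodular length, no overlattice has full rank modulo `ϖ`. -/
lemma numS_full_of_lt (h2 : (2 : ResidueField O) ≠ 0) (hϖ : Irreducible ϖ)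
    (hQ : IsDiagonalIn E Q ϖ u v₁ v₂ d₁ d₂) (hb : 2 * b < d₁ + d₂) {a : ℕ}
    (ha : a = Fintype.card ι + 2) :
    numS Q (Submodule.span O (Set.range E)) a b = 0 := by
  classical
  choose T hT _ using exists_isResidueSystem (O := O) hϖ
  obtain ⟨h3, -⟩ := numS_eq_card_and_signedNumS_eq_sum E h2 hϖ hQ hT a b
    (A := fun _ => False) (C := fun p => True) (by
      intro p hp ε
      have hlt : 2 * (b - p.1 + p.1) < d₁ + d₂ := by rwa [two_mul_add_eq_of_mem hp]
      have hp' := (mem_integralParams.1 hp).2.2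
      by_cases h0 : paramSign ϖ v₁ v₂ d₁ d₂ (b - p.1) p.1 p.2 = 0
      · rw [assigned_overLattice_of_eq_zero E h2 hϖ hQ hp' hlt h0]
        simp [ha]
      · rw [assigned_overLattice_of_ne_zero E h2 hϖ hQ hp' hlt h0]
        simp [ha])
  rw [h3]; simp

/-- From the unimodular length on, all overlattices have full rank modulo `ϖ`. -/
lemma numS_of_le (h2 : (2 : ResidueField O) ≠ 0) (hϖ : Irreducible ϖ)
    (hQ : IsDiagonalIn E Q ϖ u v₁ v₂ d₁ d₂) (hb : d₁ + d₂ ≤ 2 * b) {a : ℕ}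
    (ha : a < Fintype.card ι + 2) :
    numS Q (Submodule.span O (Set.range E)) a b = 0 := by
  classical
  choose T hT _ using exists_isResidueSystem (O := O) hϖ
  obtain ⟨h3, -⟩ := numS_eq_card_and_signedNumS_eq_sum E h2 hϖ hQ hT a b
    (A := fun _ => False) (C := fun p => True) (by
      intro p hp ε
      have hp' := (mem_integralParams.1 hp).2.2
      have hle := hp'.le hϖ
      have hb' := two_mul_add_eq_of_mem hp
      obtain ⟨c, hc⟩ := assigned_overLattice_of_eq E h2 hϖ hQ hp' (by omega) a
      rw [hc]
      simp [ha.ne])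
  rw [h3]; simp

lemma numS_full (h2 : (2 : ResidueField O) ≠ 0) (hϖ : Irreducible ϖ)
    (hQ : IsDiagonalIn E Q ϖ u v₁ v₂ d₁ d₂) (hT : ∀ j, IsResidueSystem (ϖ ^ j) (T j))
    (hb : d₁ + d₂ ≤ 2 * b) {a : ℕ} (ha : a = Fintype.card ι + 2) :
    numS Q (Submodule.span O (Set.range E)) a b = numIntegral ϖ v₁ v₂ T d₁ d₂ b := by
  classical
  have hex : ∀ p : Σ _ : ℕ, O, ∃ c : Prop, p ∈ integralParams ϖ v₁ v₂ T d₁ d₂ b → ∀ ε : ℤˣ,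
      (Assigned Q (overLattice E hϖ (b - p.1) p.1 p.2) a ε ↔
        a = Fintype.card ι + 2 ∧ (Even a → 0 < a → (c ↔ ε = 1))) := by
    intro p
    by_cases hp : p ∈ integralParams ϖ v₁ v₂ T d₁ d₂ b
    · have hp' := (mem_integralParams.1 hp).2.2
      have hle := hp'.le hϖ
      have hb' := two_mul_add_eq_of_mem hp
      obtain ⟨c, hc⟩ := assigned_overLattice_of_eq E h2 hϖ hQ hp' (by omega) a
      exact ⟨c, fun _ => hc⟩
    · exact ⟨True, fun h => absurd h hp⟩
  choose C hC using hex
  obtain ⟨h3, -⟩ := numS_eq_card_and_signedNumS_eq_sum E h2 hϖ hQ hT a b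
    (A := fun _ => a = Fintype.card ι + 2) (C := C) hC
  rw [h3, filter_true_of_mem fun _ _ => ha, card_integralParams]

end Count

/-! ### Closed formulas -/

section Formulas

open IsLocalRing Finset

lemma geomSum_eq {f K : ℕ} {m : ℤ} (h : (m + 1).toNat = K) :
    geomSum f m = ∑ i ∈ range K, (f : ℚ) ^ i := by
  rw [geomSum, h]

lemma zpow_eq_pow {f k : ℕ} {m : ℤ} (h : m = k) : (f : ℚ) ^ m = (f : ℚ) ^ k := by
  rw [h, zpow_natCast]

lemma delta_natCast (d : ℕ) : delta d = if Even d then 1 else 0 := by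
  rw [delta]
  congr 1
  rw [Int.even_coe_nat]

variable {O : Type*} [CommRing O] [IsDomain O] [IsDiscreteValuationRing O]
  [IsAdicComplete (maximalIdeal O) O] {ϖ : O} {v₁ v₂ : Oˣ} {d₁ d₂ b : ℕ} {T : ℕ → Finset O}

open Classical in
lemma numNull_eq [Finite (ResidueField O)] (hϖ : Irreducible ϖ) (h2 : (2 : ResidueField O) ≠ 0)
    (hT : ∀ j, IsResidueSystem (ϖ ^ j) (T j)) (hd : d₁ ≤ d₂) (hb : 2 * b < d₁ + d₂) :
    numNull ϖ v₁ v₂ T d₁ d₂ b =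
      ∑ i ∈ range (min b ((d₂ - 1) / 2) + 1 - (2 * b + 2 - d₁) / 2), Nat.card (ResidueField O) ^ i +
      if Even (d₁ + d₂) ∧ IsSquare (-(v₁ * v₂)) then
        2 * (b - (d₂ - 1) / 2) * Nat.card (ResidueField O) ^ ((d₁ + d₂) / 2 - b - 1) else 0 := by
  rw [numNull]
  split_ifs with h0 h h
  · obtain ⟨⟨k, hk⟩, h⟩ := h
    rw [numIntegral_eq hϖ h2 hT (by omega) (by omega), if_pos ⟨⟨k - 1, by omega⟩, h⟩]
    congr 3
    · congr 2; omega
    · omega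
  · by_cases hlt : d₁ - 1 + (d₂ - 1) < 2 * b
    · rw [numIntegral_of_lt hϖ hlt]
      rw [show min b ((d₂ - 1) / 2) + 1 - (2 * b + 2 - d₁) / 2 = 0 by omega]
      simp
    · rw [numIntegral_eq hϖ h2 hT (by omega) (by omega), if_neg]
      · congr 3; omega
      · rintro ⟨⟨k, hk⟩, hs⟩; exact h ⟨⟨k + 1, by omega⟩, hs⟩
  · rw [show min b ((d₂ - 1) / 2) + 1 - (2 * b + 2 - d₁) / 2 = 0 by omega,
      show b - (d₂ - 1) / 2 = 0 by omega]
    simp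
  · rw [show min b ((d₂ - 1) / 2) + 1 - (2 * b + 2 - d₁) / 2 = 0 by omega]
    simp

/-- Four cases of the count of overlattices of rank `n - 2` modulo `ϖ`. -/
lemma numNull_formulas [Finite (ResidueField O)] (hϖ : Irreducible ϖ)
    (h2 : (2 : ResidueField O) ≠ 0) (hT : ∀ j, IsResidueSystem (ϖ ^ j) (T j)) (hd : d₁ ≤ d₂) :
    let f := Nat.card (ResidueField O)
    let H := Even (d₁ + d₂) ∧ IsSquare (-(v₁ * v₂))
    let N : ℚ := numNull ϖ v₁ v₂ T d₁ d₂ b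
    (2 * b < d₁ → N = geomSum f b) ∧
      (d₁ ≤ 2 * b → 2 * b < d₂ → N = geomSum f (((d₁ : ℤ) - 1) / 2)) ∧
      (d₂ ≤ 2 * b → 2 * b < d₁ + d₂ → ¬ H →
        N = geomSum f (((d₁ : ℤ) - 1) / 2 + ((d₂ : ℤ) - 1) / 2 - b)) ∧
      (d₂ ≤ 2 * b → 2 * b < d₁ + d₂ → H →
        N = (2 * (b : ℚ) - d₂ + 1) * (f : ℚ) ^ (((d₁ : ℤ) + d₂) / 2 - b - 1)
            + geomSum f (((d₁ : ℤ) + d₂) / 2 - b - 1)) := by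
  intro f H N
  have hN : 2 * b < d₁ + d₂ → N = _ := fun hb =>
    congrArg (Nat.cast : ℕ → ℚ) (numNull_eq (v₁ := v₁) (v₂ := v₂) hϖ h2 hT hd hb)
  refine ⟨fun h1 => ?_, fun h1 h2 => ?_, fun h1 h2 hH => ?_, fun h1 h2 hH => ?_⟩
  · rw [hN (by omega), geomSum_eq rfl, show b - (d₂ - 1) / 2 = 0 by omega,
      show min b ((d₂ - 1) / 2) + 1 - (2 * b + 2 - d₁) / 2 = ((b : ℤ) + 1).toNat by omega]
    simp [f]
  · rw [hN (by omega), geomSum_eq rfl, show b - (d₂ - 1) / 2 = 0 by omega,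
      show min b ((d₂ - 1) / 2) + 1 - (2 * b + 2 - d₁) / 2 =
        (((d₁ : ℤ) - 1) / 2 + 1).toNat by omega]
    simp [f]
  · rw [hN (by omega), geomSum_eq rfl, if_neg hH,
      show min b ((d₂ - 1) / 2) + 1 - (2 * b + 2 - d₁) / 2 =
        (((d₁ : ℤ) - 1) / 2 + ((d₂ : ℤ) - 1) / 2 - b + 1).toNat by omega]
    simp [f]
  · obtain ⟨k, hk⟩ := hH.1
    obtain ⟨m, rfl⟩ : ∃ m, k = b + 1 + m := ⟨k - (b + 1), by omega⟩
    rw [hN (by omega), if_pos hH, geomSum_eq (K := m + 1) (by omega), zpow_eq_pow (k := m) (by omega),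
      show (d₁ + d₂) / 2 - b - 1 = m by omega]
    rcases Nat.even_or_odd' d₂ with ⟨e, he | he⟩
    · rw [show min b ((d₂ - 1) / 2) + 1 - (2 * b + 2 - d₁) / 2 = m by omega, sum_range_succ]
      have : 2 * (b - (d₂ - 1) / 2) + d₂ = 2 * b + 2 := by omega
      have := congrArg (Nat.cast : ℕ → ℚ) this
      push_cast at this ⊢
      linear_combination (f : ℚ) ^ m * this
    · rw [show min b ((d₂ - 1) / 2) + 1 - (2 * b + 2 - d₁) / 2 = m + 1 by omega]
      have : 2 * (b - (d₂ - 1) / 2) + d₂ = 2 * b + 1 := by omega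
      have := congrArg (Nat.cast : ℕ → ℚ) this
      push_cast at this ⊢
      linear_combination (f : ℚ) ^ m * this

/-- Four cases of the count of overlattices of rank `n - 1` modulo `ϖ`. -/
lemma numIntegral_sub_numNull_formulas [Finite (ResidueField O)] (hϖ : Irreducible ϖ)
    (h2 : (2 : ResidueField O) ≠ 0) (hT : ∀ j, IsResidueSystem (ϖ ^ j) (T j)) (hd : d₁ ≤ d₂) :
    let f := Nat.card (ResidueField O)
    let H := Even (d₁ + d₂) ∧ IsSquare (-(v₁ * v₂))
    let N : ℚ := numIntegral ϖ v₁ v₂ T d₁ d₂ b - numNull ϖ v₁ v₂ T d₁ d₂ b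
    (2 * b < d₁ → N = 0) ∧
      (d₁ ≤ 2 * b → 2 * b < d₂ → N = delta d₁ * (f : ℚ) ^ ((d₁ : ℤ) / 2)) ∧
      (d₂ ≤ 2 * b → 2 * b < d₁ + d₂ → ¬ H →
        N = delta d₁ * (f : ℚ) ^ ((d₁ : ℤ) / 2 + ((d₂ : ℤ) - 1) / 2 - b)
            + delta d₂ * (f : ℚ) ^ (((d₁ : ℤ) + d₂) / 2 - b)) ∧
      (d₂ ≤ 2 * b → 2 * b < d₁ + d₂ → H →
        N = (2 * (b : ℚ) - d₂ + 1) * ((f : ℚ) - 1) *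
          (f : ℚ) ^ (((d₁ : ℤ) + d₂) / 2 - b - 1)) := by
  intro f H N
  obtain ⟨g1, g2, g3, g4⟩ := numNull_formulas (b := b) (v₁ := v₁) (v₂ := v₂) hϖ h2 hT hd
  have hN : 2 * b < d₁ + d₂ → (numIntegral ϖ v₁ v₂ T d₁ d₂ b : ℚ) = _ := fun hb =>
    congrArg (Nat.cast : ℕ → ℚ) (numIntegral_eq (v₁ := v₁) (v₂ := v₂) hϖ h2 hT hd hb.le)
  refine ⟨fun h1 => ?_, fun h1 h2 => ?_, fun h1 h2 hH => ?_, fun h1 h2 hH => ?_⟩ <;>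
    simp only [N]
  · rw [g1 h1, hN (by omega), geomSum_eq (K := b + 1) (by omega), show b - d₂ / 2 = 0 by omega,
      show min b (d₂ / 2) + 1 - (2 * b + 1 - d₁) / 2 = b + 1 by omega]
    simp
  · rw [g2 h1 h2, hN (by omega), show b - d₂ / 2 = 0 by omega, delta_natCast,
      show min b (d₂ / 2) + 1 - (2 * b + 1 - d₁) / 2 = d₁ / 2 + 1 by omega,
      zpow_eq_pow (k := d₁ / 2) (by omega)]
    rcases Nat.even_or_odd' d₁ with ⟨e, he | he⟩
    · rw [geomSum_eq (K := d₁ / 2) (by omega), if_pos (by simp [he] : Even d₁), sum_range_succ]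
      simp [f]
    · rw [geomSum_eq (K := d₁ / 2 + 1) (by omega), if_neg (by simp [he, parity_simps] : ¬ Even d₁)]
      simp
  · rw [g3 h1 h2 hH, hN (by omega), if_neg hH, delta_natCast, delta_natCast]
    rcases Nat.even_or_odd' d₁ with ⟨e, he | he⟩ <;> rcases Nat.even_or_odd' d₂ with ⟨e', he' | he'⟩
    · obtain ⟨m, hm⟩ : ∃ m, e + e' = b + 1 + m := ⟨e + e' - (b + 1), by omega⟩
      rw [geomSum_eq (K := m) (by omega), zpow_eq_pow (k := m) (by omega),
        zpow_eq_pow (k := m + 1) (by omega),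
        show min b (d₂ / 2) + 1 - (2 * b + 1 - d₁) / 2 = m + 2 by omega, sum_range_succ,
        sum_range_succ, if_pos (by simp [he] : Even d₁), if_pos (by simp [he'] : Even d₂)]
      push_cast
      ring
    · obtain ⟨m, hm⟩ : ∃ m, e + e' = b + m := ⟨e + e' - b, by omega⟩
      rw [geomSum_eq (K := m) (by omega), zpow_eq_pow (k := m) (by omega),
        show min b (d₂ / 2) + 1 - (2 * b + 1 - d₁) / 2 = m + 1 by omega, sum_range_succ,
        if_pos (by simp [he] : Even d₁), if_neg (by simp [he', parity_simps] : ¬ Even d₂)]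
      push_cast
      ring
    · obtain ⟨m, hm⟩ : ∃ m, e + e' = b + m := ⟨e + e' - b, by omega⟩
      rw [geomSum_eq (K := m) (by omega), zpow_eq_pow (m := ((d₁ : ℤ) + d₂) / 2 - b) (k := m) (by omega),
        show min b (d₂ / 2) + 1 - (2 * b + 1 - d₁) / 2 = m + 1 by omega, sum_range_succ,
        if_neg (by simp [he, parity_simps] : ¬ Even d₁), if_pos (by simp [he'] : Even d₂)]
      push_cast
      ring
    · obtain ⟨m, hm⟩ : ∃ m, e + e' + 1 = b + m := ⟨e + e' + 1 - b, by omega⟩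
      rw [geomSum_eq (K := m) (by omega),
        show min b (d₂ / 2) + 1 - (2 * b + 1 - d₁) / 2 = m by omega,
        if_neg (by simp [he, parity_simps] : ¬ Even d₁), if_neg (by simp [he', parity_simps] : ¬ Even d₂)]
      push_cast
      ring
  · obtain ⟨k, hk⟩ := hH.1
    obtain ⟨m, rfl⟩ : ∃ m, k = b + 1 + m := ⟨k - (b + 1), by omega⟩
    rw [g4 h1 h2 hH, hN (by omega), if_pos hH, geomSum_eq (K := m + 1) (by omega),
      zpow_eq_pow (k := m) (by omega), show (d₁ + d₂) / 2 - b = m + 1 by omega]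
    rcases Nat.even_or_odd' d₂ with ⟨e, he | he⟩
    · rw [show min b (d₂ / 2) + 1 - (2 * b + 1 - d₁) / 2 = m + 2 by omega, sum_range_succ]
      have : 2 * (b - d₂ / 2) + d₂ = 2 * b := by omega
      have := congrArg (Nat.cast : ℕ → ℚ) this
      push_cast at this ⊢
      linear_combination (f : ℚ) ^ (m + 1) * this
    · rw [show min b (d₂ / 2) + 1 - (2 * b + 1 - d₁) / 2 = m + 1 by omega]
      have : 2 * (b - d₂ / 2) + d₂ = 2 * b + 1 := by omega
      have := congrArg (Nat.cast : ℕ → ℚ) this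
      push_cast at this ⊢
      linear_combination (f : ℚ) ^ (m + 1) * this

open Classical in
/-- The count of unimodular overlattices. -/
lemma numIntegral_unimodular [Finite (ResidueField O)] (hϖ : Irreducible ϖ)
    (h2 : (2 : ResidueField O) ≠ 0) (hT : ∀ j, IsResidueSystem (ϖ ^ j) (T j)) (hd : d₁ ≤ d₂)
    (hb : 2 * b = d₁ + d₂) : numIntegral ϖ v₁ v₂ T d₁ d₂ b =
      if Even (d₁ + d₂) ∧ IsSquare (-(v₁ * v₂)) then (d₁ : ℚ) + 1 else delta d₁ * delta d₂ := by
  rw [numIntegral_eq hϖ h2 hT hd hb.le, show (d₁ + d₂) / 2 - b = 0 by omega, delta_natCast,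
    delta_natCast]
  rcases Nat.even_or_odd' d₂ with ⟨e, he | he⟩
  · rw [show min b (d₂ / 2) + 1 - (2 * b + 1 - d₁) / 2 = 1 by omega,
      if_pos (Nat.even_iff.2 (by omega) : Even d₁), if_pos (by simp [he] : Even d₂),
      show 2 * (b - d₂ / 2) = d₁ by omega]
    split_ifs <;> simp [add_comm]
  · rw [show min b (d₂ / 2) + 1 - (2 * b + 1 - d₁) / 2 = 0 by omega,
      if_neg (by simp [he, parity_simps] : ¬ Even d₂),
      show 2 * (b - d₂ / 2) = d₁ + 1 by omega]
    split_ifs <;> simp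

variable [Fintype (ResidueField O)] [DecidableEq (ResidueField O)]

lemma delta_eq_unitSymbol_iff (hϖ : Irreducible ϖ) (h2 : (2 : ResidueField O) ≠ 0)
    (F : Type*) [Field F] [Algebra O F] [IsFractionRing O F] (d : ℕ) (w : Oˣ) :
    delta d = unitSymbol F ϖ w ↔ Even d ∧ IsSquare w := by
  have hw : residue O (w : O) ≠ 0 := (residue_ne_zero_iff_isUnit _).2 w.isUnit
  rw [unitSymbol_eq_quadraticChar h2 hϖ, isSquare_unit_iff h2, ← quadraticChar_one_iff_isSquare hw,
    delta_natCast]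
  rcases quadraticChar_dichotomy hw with h | h <;> rw [h] <;> split_ifs with he <;> simp [he]

/-- The signed counts of overlattices of rank `n - 1` modulo `ϖ`. -/
lemma signedIntegral_formulas (hϖ : Irreducible ϖ)
    (h2 : (2 : ResidueField O) ≠ 0) (hT : ∀ j, IsResidueSystem (ϖ ^ j) (T j)) (hd : d₁ ≤ d₂) :
    let f := Nat.card (ResidueField O)
    let χ := fun x : O => (quadraticChar (ResidueField O) (residue O x) : ℚ)
    let N : ℚ := signedIntegral ϖ v₁ v₂ T d₁ d₂ b
    (d₁ ≤ 2 * b → 2 * b < d₂ → N = χ v₁ * (delta d₁ * (f : ℚ) ^ ((d₁ : ℤ) / 2))) ∧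
      (d₂ ≤ 2 * b → 2 * b < d₁ + d₂ → delta d₁ = 1 → delta d₂ = 0 →
        N = χ v₁ * (f : ℚ) ^ (((d₁ : ℤ) + d₂ - 1) / 2 - b)) ∧
      (d₂ ≤ 2 * b → 2 * b < d₁ + d₂ → delta d₁ = 0 → delta d₂ = 1 →
        N = χ v₂ * (f : ℚ) ^ (((d₁ : ℤ) + d₂ - 1) / 2 - b)) ∧
      (d₂ ≤ 2 * b → 2 * b < d₁ + d₂ → delta (d₁ + d₂) = 1 → N = 0) := by
  intro f χ N
  have hδ : ∀ d : ℕ, (delta d = 1 ↔ Even d) ∧ (delta d = 0 ↔ ¬ Even d) := fun d => by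
    rw [delta_natCast]; split_ifs with h <;> simp [h]
  have hodd : ∀ {d : ℕ}, Odd d → ¬ Even d := fun h => Nat.not_even_iff_odd.2 h
  refine ⟨fun h3 h4 => ?_, fun h3 h4 h5 h6 => ?_, fun h3 h4 h5 h6 => ?_, fun h3 h4 h5 => ?_⟩ <;>
    simp only [N]
  · rcases Nat.even_or_odd d₁ with ho | ho
    · rw [signedIntegral_of_even hϖ h2 hT hd (by omega) ho h3, if_pos h4, (hδ _).1.2 ho,
        zpow_eq_pow (k := d₁ / 2) (by omega)]
      simp [χ, f]
    · rw [signedIntegral_of_odd hϖ h2 hT hd (by omega) ho, if_neg (by omega),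
        (hδ _).2.2 (hodd ho)]
      simp
  · rw [signedIntegral_of_even hϖ h2 hT hd h4 ((hδ _).1.1 h5) (by omega), if_neg (by omega),
      if_neg ((hδ _).2.1 h6), zpow_eq_pow (k := (d₁ + d₂ - 1) / 2 - b) (by omega)]
    simp [χ, f]
  · rw [signedIntegral_of_odd hϖ h2 hT hd h4 (Nat.not_even_iff_odd.1 ((hδ _).2.1 h5)),
      if_pos ⟨(hδ _).1.1 h6, h3⟩, zpow_eq_pow (k := (d₁ + d₂ - 1) / 2 - b) (by omega)]
    simp [χ, f]
  · have h5' : Even (d₁ + d₂) := (hδ _).1.1 (mod_cast h5)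
    rcases Nat.even_or_odd d₁ with ho | ho
    · rw [signedIntegral_of_even hϖ h2 hT hd h4 ho (by omega), if_neg (by omega),
        if_pos ((Nat.even_add.1 h5').1 ho)]
      simp
    · rw [signedIntegral_of_odd hϖ h2 hT hd h4 ho,
        if_neg fun h => hodd ho ((Nat.even_add.1 h5').2 h.1)]
      simp

end Formulas

/-! ### The diagonal basis and the symbols -/

section Diagonal

variable {O F V : Type*} [CommRing O] [IsDomain O] [IsDiscreteValuationRing O]
  [Field F] [Algebra O F] [IsFractionRing O F]
  [AddCommGroup V] [Module O V] [Module F V] [IsScalarTower O F V] {ϖ : O}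
  {ι : Type*} [Fintype ι] [DecidableEq ι]

lemma isDiagonalIn_of_gram (h2 : (2 : F) ≠ 0) (E : Module.Basis (ι ⊕ Fin 2) F V)
    (Q : QuadraticForm F V) (u : ι → Oˣ) (v₁ v₂ : Oˣ) (d₁ d₂ : ℕ)
    (hB : gram Q E = Matrix.diagonal (Sum.elim (fun i => algebraMap O F (u i))
        ![algebraMap O F (ϖ ^ d₁ * v₁), algebraMap O F (ϖ ^ d₂ * v₂)])) :
    IsDiagonalIn E Q ϖ u v₁ v₂ d₁ d₂ := by
  have hoff : ∀ i j, i ≠ j → QuadraticMap.polar Q (E i) (E j) = 0 := by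
    intro i j hij
    have h := congrFun (congrFun hB i) j
    rw [Matrix.diagonal_apply_ne _ hij, gram, Matrix.of_apply, div_eq_zero_iff] at h
    exact h.resolve_right h2
  have hdiag : ∀ i, Q (E i) = _ := fun i =>
    (gram_apply_self h2 Q E i).symm.trans ((congrFun (congrFun hB i) i).trans
      (Matrix.diagonal_apply_eq _ _))
  intro x
  conv_lhs => rw [← E.sum_repr x]
  rw [QuadraticMap.map_sum, Finset.sum_eq_zero (s := Finset.filter _ _), add_zero,
    Fintype.sum_sum_type, Fin.sum_univ_two]
  · simp only [QuadraticMap.map_smul, hdiag, Sum.elim_inl, Sum.elim_inr, smul_eq_mul,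
      Matrix.cons_val_zero, Matrix.cons_val_one, add_assoc]
    congr 1
    · exact Finset.sum_congr rfl fun k _ => by ring
    · ring
  · intro ij hij
    induction ij with
    | _ i j =>
      have hij : i ≠ j := by simpa using hij
      simp [QuadraticMap.polarSym2, QuadraticMap.polar_smul_left, QuadraticMap.polar_smul_right,
        hoff i j hij]

lemma exists_basis_isDiagonalIn (h2 : (2 : F) ≠ 0) (Q : QuadraticForm F V) (L : Submodule O V)
    [L.IsLattice F] (e : Module.Basis (ι ⊕ Fin 2) O L) (u : ι → Oˣ) (v₁ v₂ : Oˣ) (d₁ d₂ : ℕ)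
    (hB : gram Q (fun i => (e i : V)) = Matrix.diagonal
      (Sum.elim (fun i => algebraMap O F (u i))
        ![algebraMap O F (ϖ ^ d₁ * v₁), algebraMap O F (ϖ ^ d₂ * v₂)])) :
    ∃ E : Module.Basis (ι ⊕ Fin 2) F V, L = Submodule.span O (Set.range E) ∧
      IsDiagonalIn E Q ϖ u v₁ v₂ d₁ d₂ := by
  have hE : (e.extendOfIsLattice F : ι ⊕ Fin 2 → V) = fun k => (e k : V) :=
    funext (e.extendOfIsLattice_apply F)
  refine ⟨e.extendOfIsLattice F, ?_, isDiagonalIn_of_gram h2 _ Q u v₁ v₂ d₁ d₂ (by rw [hE, hB])⟩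
  have h := congrArg (Submodule.map L.subtype) e.span_eq
  rw [Submodule.map_span, ← Set.range_comp, Submodule.map_subtype_top] at h
  rw [hE]
  exact h.symm

/-- The Hilbert symbols of the signs occurring in the signed counts. -/
lemma unitSymbol_eq_quadraticChar_prod [IsAdicComplete (IsLocalRing.maximalIdeal O) O]
    [Fintype (IsLocalRing.ResidueField O)] [DecidableEq (IsLocalRing.ResidueField O)]
    (h2 : (2 : IsLocalRing.ResidueField O) ≠ 0) (hϖ : Irreducible ϖ) (F : Type*) [Field F]
    [Algebra O F] [IsFractionRing O F] (u : ι → Oˣ) (m : ℕ) :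
    unitSymbol F ϖ ((-1) ^ m * ∏ i, u i) =
      quadraticChar (IsLocalRing.ResidueField O)
        ((-1) ^ m * ∏ i, IsLocalRing.residue O (u i : O)) := by
  rw [unitSymbol_eq_quadraticChar h2 hϖ]
  simp [Units.coe_prod]

lemma unitSymbol_mul [IsAdicComplete (IsLocalRing.maximalIdeal O) O]
    (h2 : (2 : IsLocalRing.ResidueField O) ≠ 0) (hϖ : Irreducible ϖ) (F : Type*) [Field F]
    [Algebra O F] [IsFractionRing O F] [Finite (IsLocalRing.ResidueField O)] (v w : Oˣ) :
    unitSymbol F ϖ (v * w) = unitSymbol F ϖ v * unitSymbol F ϖ w := by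
  classical
  cases nonempty_fintype (IsLocalRing.ResidueField O)
  simp only [unitSymbol_eq_quadraticChar h2 hϖ, Units.val_mul, map_mul]

end Diagonal

end QuadLattice

theorem proposition4p2
    -- a local field `F` with ring of integers `O`, of odd residue characteristic `p`
    (p : ℕ) [Fact p.Prime] (hp : Odd p)
    {O : Type*} [CommRing O] [IsDomain O] [IsDiscreteValuationRing O]
    [IsAdicComplete (IsLocalRing.maximalIdeal O) O]
    [Finite (IsLocalRing.ResidueField O)] [CharP (IsLocalRing.ResidueField O) p]
    {F : Type*} [Field F] [Algebra O F] [IsFractionRing O F]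
    -- a uniformizer and the cardinality of the residue field
    (ϖ : O) (hϖ : Irreducible ϖ)
    (f : ℕ) (hf : f = Nat.card (IsLocalRing.ResidueField O))
    -- a quadratic lattice `L` of rank `n` with a diagonalizing basis `e`
    {V : Type*} [AddCommGroup V] [Module O V] [Module F V] [IsScalarTower O F V]
    (Q : QuadraticForm F V) (L : Submodule O V) [L.IsLattice F]
    (n : ℕ) (hn : 2 ≤ n) (e : Module.Basis (Fin (n - 2) ⊕ Fin 2) O L)
    (u : Fin (n - 2) → Oˣ) (v₁ v₂ : Oˣ) (d₁ d₂ : ℕ) (hd : d₁ ≤ d₂)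
    (hB : gram Q (fun i => (e i : V)) = Matrix.diagonal
      (Sum.elim (fun i => algebraMap O F (u i))
        ![algebraMap O F (ϖ ^ d₁ * v₁), algebraMap O F (ϖ ^ d₂ * v₂)]))
    (b : ℕ) :
    -- all the sets `S_(L, a^±, b)` are finite
    (∀ (a : ℕ) (ε : ℤˣ), (overlattices Q L a ε b).Finite) ∧
    -- the numbers `#S_(L, a^±, b)` for `a = n - 2`
    ((2 * b < d₁ → numS Q L (n - 2) b = geomSum f b) ∧
      (d₁ ≤ 2 * b → 2 * b < d₂ → numS Q L (n - 2) b = geomSum f (((d₁ : ℤ) - 1) / 2)) ∧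
      (d₂ ≤ 2 * b → 2 * b < d₁ + d₂ → delta (d₁ + d₂) ≠ unitSymbol F ϖ (-(v₁ * v₂)) →
        numS Q L (n - 2) b = geomSum f (((d₁ : ℤ) - 1) / 2 + ((d₂ : ℤ) - 1) / 2 - b)) ∧
      (d₂ ≤ 2 * b → 2 * b < d₁ + d₂ → delta (d₁ + d₂) = unitSymbol F ϖ (-(v₁ * v₂)) →
        numS Q L (n - 2) b =
          (2 * (b : ℚ) - d₂ + 1) * (f : ℚ) ^ (((d₁ : ℤ) + d₂) / 2 - b - 1)
            + geomSum f (((d₁ : ℤ) + d₂) / 2 - b - 1)) ∧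
      (d₁ + d₂ ≤ 2 * b → numS Q L (n - 2) b = 0)) ∧
    -- the numbers `#S_(L, a^±, b)` for `a = n - 1`
    ((2 * b < d₁ ∨ d₁ + d₂ ≤ 2 * b → numS Q L (n - 1) b = 0) ∧
      (d₁ ≤ 2 * b → 2 * b < d₂ →
        numS Q L (n - 1) b = delta d₁ * (f : ℚ) ^ ((d₁ : ℤ) / 2)) ∧
      (d₂ ≤ 2 * b → 2 * b < d₁ + d₂ → delta (d₁ + d₂) ≠ unitSymbol F ϖ (-(v₁ * v₂)) →
        numS Q L (n - 1) b =
          delta d₁ * (f : ℚ) ^ ((d₁ : ℤ) / 2 + ((d₂ : ℤ) - 1) / 2 - b)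
            + delta d₂ * (f : ℚ) ^ (((d₁ : ℤ) + d₂) / 2 - b)) ∧
      (d₂ ≤ 2 * b → 2 * b < d₁ + d₂ → delta (d₁ + d₂) = unitSymbol F ϖ (-(v₁ * v₂)) →
        numS Q L (n - 1) b =
          (2 * (b : ℚ) - d₂ + 1) * ((f : ℚ) - 1) * (f : ℚ) ^ (((d₁ : ℤ) + d₂) / 2 - b - 1))) ∧
    -- the numbers `#S_(L, a^±, b)` for `a = n`
    ((2 * b ≠ d₁ + d₂ → numS Q L n b = 0) ∧
      (2 * b = d₁ + d₂ → delta (d₁ + d₂) = unitSymbol F ϖ (-(v₁ * v₂)) →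
        numS Q L n b = d₁ + 1) ∧
      (2 * b = d₁ + d₂ → delta (d₁ + d₂) ≠ unitSymbol F ϖ (-(v₁ * v₂)) →
        numS Q L n b = delta d₁ * delta d₂)) ∧
    (delta (d₁ + d₂) = unitSymbol F ϖ (-(v₁ * v₂)) ↔ Even (d₁ + d₂) ∧ IsSquare (-(v₁ * v₂))) ∧
    -- the signed numbers for `a = n - 2` and even `n`
    (Even n →
      (2 * b < d₁ + d₂ → signedNumS Q L (n - 2) b =
        unitSymbol F ϖ ((-1) ^ ((n - 2) / 2) * ∏ i, u i) * numS Q L (n - 2) b) ∧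
      (d₁ + d₂ ≤ 2 * b → signedNumS Q L (n - 2) b = 0)) ∧
    -- the signed numbers for `a = n - 1` and odd `n`
    (Odd n →
      (2 * b < d₁ ∨ d₁ + d₂ ≤ 2 * b → signedNumS Q L (n - 1) b = 0) ∧
      (d₁ ≤ 2 * b → 2 * b < d₂ → signedNumS Q L (n - 1) b =
        unitSymbol F ϖ ((-1) ^ ((n - 1) / 2) * (∏ i, u i) * v₁)
          * (delta d₁ * (f : ℚ) ^ ((d₁ : ℤ) / 2))) ∧
      (d₂ ≤ 2 * b → 2 * b < d₁ + d₂ → delta d₁ = 1 → delta d₂ = 0 → signedNumS Q L (n - 1) b =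
        unitSymbol F ϖ ((-1) ^ ((n - 1) / 2) * (∏ i, u i) * v₁)
          * (f : ℚ) ^ (((d₁ : ℤ) + d₂ - 1) / 2 - b)) ∧
      (d₂ ≤ 2 * b → 2 * b < d₁ + d₂ → delta d₁ = 0 → delta d₂ = 1 → signedNumS Q L (n - 1) b =
        unitSymbol F ϖ ((-1) ^ ((n - 1) / 2) * (∏ i, u i) * v₂)
          * (f : ℚ) ^ (((d₁ : ℤ) + d₂ - 1) / 2 - b)) ∧
      (d₂ ≤ 2 * b → 2 * b < d₁ + d₂ → delta (d₁ + d₂) = 1 →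
        signedNumS Q L (n - 1) b = 0)) := by
  classical
  subst hf
  cases nonempty_fintype (IsLocalRing.ResidueField O)
  have h2 : (2 : IsLocalRing.ResidueField O) ≠ 0 := by
    intro h
    have h' : ((2 : ℕ) : IsLocalRing.ResidueField O) = 0 := mod_cast h
    rw [CharP.cast_eq_zero_iff _ p, Nat.prime_dvd_prime_iff_eq Fact.out Nat.prime_two] at h'
    rw [h'] at hp
    exact absurd hp (by decide)
  have h2F := two_ne_zero_of_residue h2 F
  obtain ⟨E, hL, hQ⟩ := exists_basis_isDiagonalIn h2F Q L e u v₁ v₂ d₁ d₂ hB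
  choose T hT _ using exists_isResidueSystem (O := O) hϖ
  have hc : n - 2 = Fintype.card (Fin (n - 2)) := (Fintype.card_fin _).symm
  have hc₁ : n - 1 = Fintype.card (Fin (n - 2)) + 1 := by rw [← hc]; omega
  have hc₂ : n = Fintype.card (Fin (n - 2)) + 2 := by rw [← hc]; omega
  have lt₁ : 2 * b < d₁ → 2 * b < d₁ + d₂ := by omega
  have lt₂ : 2 * b < d₂ → 2 * b < d₁ + d₂ := by omega
  have hH : delta (d₁ + d₂) = unitSymbol F ϖ (-(v₁ * v₂)) ↔
      Even (d₁ + d₂) ∧ IsSquare (-(v₁ * v₂)) := by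
    rw [← Nat.cast_add]
    exact delta_eq_unitSymbol_iff hϖ h2 F _ _
  simp only [hH, ne_eq, unitSymbol_mul h2 hϖ F _ v₁, unitSymbol_mul h2 hϖ F _ v₂,
    unitSymbol_eq_quadraticChar_prod h2 hϖ F u, unitSymbol_eq_quadraticChar h2 hϖ F v₁,
    unitSymbol_eq_quadraticChar h2 hϖ F v₂]
  have hEv : Even n → Even (n - 2) := fun h => (Nat.even_sub hn).2 (by simp [h])
  have hOd : Odd n → Even (n - 1) := fun h => Nat.Odd.sub_odd h odd_one
  have hnull := fun hb => numS_null E h2 hϖ hQ hT hd (b := b) hb hc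
  have hone := fun hb => numS_sub_one E h2 hϖ hQ hT hd (b := b) hb hc₁
  have hlow := fun a (ha : a < n) hb => numS_of_le E h2 hϖ hQ (b := b) hb (ha.trans_eq hc₂)
  have hlow₂ := hlow (n - 2) (by omega)
  have hlow₁ := hlow (n - 1) (by omega)
  rw [← hL] at hnull hone hlow₁ hlow₂
  obtain ⟨p1, p2, p3, p4⟩ := numNull_formulas (b := b) (v₁ := v₁) (v₂ := v₂) hϖ h2 hT hd
  obtain ⟨q1, q2, q3, q4⟩ :=
    numIntegral_sub_numNull_formulas (b := b) (v₁ := v₁) (v₂ := v₂) hϖ h2 hT hd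
  obtain ⟨s2, s3, s4, s5⟩ := signedIntegral_formulas (b := b) (v₁ := v₁) (v₂ := v₂) hϖ h2 hT hd
  refine ⟨fun a ε => hL ▸ finite_overlattices E h2 hϖ hQ a ε b, ⟨?_, ?_, ?_, ?_, hlow₂⟩,
    ⟨?_, ?_, ?_, ?_⟩, ⟨?_, ?_, ?_⟩, trivial, fun hev => ⟨?_, ?_⟩, fun hod => ⟨?_, ?_, ?_, ?_, ?_⟩⟩
  · exact fun h => (hnull (lt₁ h)).1.trans (p1 h)
  · exact fun h h' => (hnull (lt₂ h')).1.trans (p2 h h')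
  · exact fun h h' hH => (hnull h').1.trans (p3 h h' hH)
  · exact fun h h' hH => (hnull h').1.trans (p4 h h' hH)
  · rintro (h | h)
    · exact (hone (lt₁ h)).1.trans (q1 h)
    · exact hlow₁ h
  · exact fun h h' => (hone (lt₂ h')).1.trans (q2 h h')
  · exact fun h h' hH => (hone h').1.trans (q3 h h' hH)
  · exact fun h h' hH => (hone h').1.trans (q4 h h' hH)
  · intro h
    rcases lt_or_gt_of_ne h with h | h
    · rw [hL]; exact numS_full_of_lt E h2 hϖ hQ h hc₂
    · rw [hL, numS_full E h2 hϖ hQ hT h.le hc₂, numIntegral_of_lt hϖ h, Nat.cast_zero]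
  · intro h hH
    rw [hL, numS_full E h2 hϖ hQ hT h.ge hc₂, numIntegral_unimodular hϖ h2 hT hd h, if_pos hH]
  · intro h hH
    rw [hL, numS_full E h2 hϖ hQ hT h.ge hc₂, numIntegral_unimodular hϖ h2 hT hd h, if_neg hH]
  · intro h
    rw [(hnull h).2 (hEv hev), (hnull h).1]
  · exact fun h => signedNumS_eq_zero (hlow₂ h)
  · rintro (h | h)
    · exact signedNumS_eq_zero ((hone (lt₁ h)).1.trans (q1 h))
    · exact signedNumS_eq_zero (hlow₁ h)
  · intro h h'
    rw [(hone (lt₂ h')).2 (hOd hod), s2 h h']; push_cast; ring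
  · intro h h' h3 h4
    rw [(hone h').2 (hOd hod), s3 h h' h3 h4]; push_cast; ring
  · intro h h' h3 h4
    rw [(hone h').2 (hOd hod), s4 h h' h3 h4]; push_cast; ring
  · intro h h' h3
    rw [(hone h').2 (hOd hod), s5 h h' h3, mul_zero]
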